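/- **Theorem 1.** Let $b>1$ be an integer and let $\mathcal{A}$ be a deterministic (not necessarily complete) finite automaton with $n$ states over the alphabet $\{0,1,\dots,b-1\}$. The value of a word $u=u_\ell\cdots u_0$ over this alphabet is $\mathrm{val}(u)=\sum_{i=0}^{\ell}u_i b^i$, so the automaton, which reads words from left to right, reads the most significant digit first. A set $S\subseteq\mathbb{N}$ is eventually periodic if there are integers $p\ge 1$ and $N\ge 0$ such that, for all $x\ge N$, $x\in S$ if and only if $x+p\in S$. The automaton $\mathcal{A}$ accepts $S$ by value if, for every word $u$, $u$ is accepted by $\mathcal{A}$ if and only if $\mathrm{val}(u)\in S$; in particular words with the same value are then either all accepted or all rejected. There is a single algorithm which, given $b$ and $\mathcal{A}$ (by its transition table, initial state and set of final states), decides whether $\mathcal{A}$ accepts by value some eventually periodic set, in time $O(b\,n\log n)$ on a random access machine with words of $O(\log(bn))$ bits and unit-cost word operations (addition, truncated subtraction, multiplication, indirect memory access, test for zero), with memory initially zero outside the input. Precisely, there is a constant $C$, independent of $b$, $n$ and $\mathcal{A}$, such that the algorithm always halts within $C\,b\,n\,(1+\lfloor\log_2 n\rfloor)$ steps. -/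

import Mathlib

/-- A deterministic, not necessarily complete, finite automaton with state set `Fin n` over the
digit alphabet `{0, …, b-1}`.  `step q a = none` means that there is no transition from `q`
labelled by `a`. -/
structure DigitAutomaton (b n : ℕ) where
  step : Fin n → Fin b → Option (Fin n)
  start : Fin n
  accept : Finset (Fin n)

namespace DigitAutomaton

variable {b n : ℕ}

/-- The state reached from `q` by reading `u` from left to right, if the run exists. -/
def run (A : DigitAutomaton b n) : Fin n → List (Fin b) → Option (Fin n)
  | q, [] => some q
  | q, a :: u => (A.step q a).bind fun r => A.run r u

/-- The word `u` is accepted: its run from the initial state exists and ends in a final state. -/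
def Accepts (A : DigitAutomaton b n) (u : List (Fin b)) : Prop :=
  ∃ q ∈ A.run A.start u, q ∈ A.accept

/-- The value in base `b` of a word of digits, the leftmost digit being the most significant. -/
def value (u : List (Fin b)) : ℕ :=
  Nat.ofDigits b (u.map Fin.val).reverse

/-- `A` accepts the set `S` by value: a word is accepted exactly when its value is in `S`
(in particular, words with the same value are all accepted or all rejected). -/
def AcceptsByValue (A : DigitAutomaton b n) (S : Set ℕ) : Prop :=
  ∀ u : List (Fin b), A.Accepts u ↔ value u ∈ S

end DigitAutomaton

/-- Eventually periodic sets of natural numbers. -/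
def EventuallyPeriodic (S : Set ℕ) : Prop :=
  ∃ p N : ℕ, 1 ≤ p ∧ ∀ x, N ≤ x → (x ∈ S ↔ x + p ∈ S)

/-! A random access machine with bounded words and unit-cost operations, programmed in a small
structured language. A program names finitely many variables and finitely many arrays; every
variable and every array cell holds one word. -/

namespace RAM

/-- The contents of the variables and of the arrays. -/
structure State where
  var : ℕ → ℕ
  arr : ℕ → ℕ → ℕ

/-- Expressions: constants, variables, array cells `k[e]`, addition, truncated subtraction and
multiplication. -/
inductive Expr where
  | const (c : ℕ)
  | var (x : ℕ)
  | cell (k : ℕ) (e : Expr)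
  | add (e f : Expr)
  | sub (e f : Expr)
  | mul (e f : Expr)

namespace Expr

/-- The value of an expression. -/
def eval (s : State) : Expr → ℕ
  | const c => c
  | var x => s.var x
  | cell k e => s.arr k (e.eval s)
  | add e f => e.eval s + f.eval s
  | sub e f => e.eval s - f.eval s
  | mul e f => e.eval s * f.eval s

/-- Every value occurring in the evaluation of the expression (addresses included) is a machine
word, that is, less than `W`. -/
def Fits (W : ℕ) (s : State) : Expr → Prop
  | const c => c < W
  | var x => s.var x < W
  | cell k e => e.Fits W s ∧ s.arr k (e.eval s) < W
  | add e f => e.Fits W s ∧ f.Fits W s ∧ e.eval s + f.eval s < W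
  | sub e f => e.Fits W s ∧ f.Fits W s
  | mul e f => e.Fits W s ∧ f.Fits W s ∧ e.eval s * f.eval s < W

/-- The time needed to evaluate an expression: one step for each constant, access and operation. -/
def cost : Expr → ℕ
  | const _ => 1
  | var _ => 1
  | cell _ e => e.cost + 1
  | add e f => e.cost + f.cost + 1
  | sub e f => e.cost + f.cost + 1
  | mul e f => e.cost + f.cost + 1

end Expr

/-- Programs: `x := e`, `k[i] := e`, sequencing, conditionals and loops.
A test succeeds when its expression is not zero. -/
inductive Program where
  | skip
  | assign (x : ℕ) (e : Expr)
  | store (k : ℕ) (i e : Expr)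
  | seq (P Q : Program)
  | cond (e : Expr) (P Q : Program)
  | loop (e : Expr) (P : Program)

/-- The state after `x := v`. -/
def State.setVar (s : State) (x v : ℕ) : State :=
  { s with var := Function.update s.var x v }

/-- The state after `k[i] := v`. -/
def State.setCell (s : State) (k i v : ℕ) : State :=
  { s with arr := Function.update s.arr k (Function.update (s.arr k) i v) }

/-- `Exec W P s t s'`: on a machine with words `0, …, W-1`, the program `P` started in `s` halts
in `s'` after exactly `t` steps, and no value computed on the way overflows a word.
(A computation that overflows has no derivation.) -/
inductive Exec (W : ℕ) : Program → State → ℕ → State → Prop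
  | skip (s : State) : Exec W .skip s 1 s
  | assign (x : ℕ) (e : Expr) (s : State) (he : e.Fits W s) :
      Exec W (.assign x e) s (e.cost + 1) (s.setVar x (e.eval s))
  | store (k : ℕ) (i e : Expr) (s : State) (hi : i.Fits W s) (he : e.Fits W s) :
      Exec W (.store k i e) s (i.cost + e.cost + 1) (s.setCell k (i.eval s) (e.eval s))
  | seq {P Q : Program} {s s' s'' : State} {t t' : ℕ}
      (hP : Exec W P s t s') (hQ : Exec W Q s' t' s'') :
      Exec W (.seq P Q) s (t + t') s''
  | cond_true {e : Expr} {P Q : Program} {s s' : State} {t : ℕ}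
      (he : e.Fits W s) (h : e.eval s ≠ 0) (hP : Exec W P s t s') :
      Exec W (.cond e P Q) s (e.cost + 1 + t) s'
  | cond_false {e : Expr} {P Q : Program} {s s' : State} {t : ℕ}
      (he : e.Fits W s) (h : e.eval s = 0) (hQ : Exec W Q s t s') :
      Exec W (.cond e P Q) s (e.cost + 1 + t) s'
  | loop_true {e : Expr} {P : Program} {s s' s'' : State} {t t' : ℕ}
      (he : e.Fits W s) (h : e.eval s ≠ 0) (hP : Exec W P s t s')
      (hL : Exec W (.loop e P) s' t' s'') :
      Exec W (.loop e P) s (e.cost + 1 + t + t') s''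
  | loop_false {e : Expr} {P : Program} {s : State}
      (he : e.Fits W s) (h : e.eval s = 0) :
      Exec W (.loop e P) s (e.cost + 1) s

/-- The machine's initial state on the input automaton `A`: variables `0`, `1`, `2` hold `b`, `n`
and the initial state; array `0` holds the transition table, row by row (cell `q * b + a` holds
the target of the transition from `q` labelled by `a`, or `n` if there is none); array `1` holds
the indicator of the set of final states; everything else is `0`. -/
def input {b n : ℕ} (A : DigitAutomaton b n) : State where
  var x := if x = 0 then b else if x = 1 then n else if x = 2 then (A.start : ℕ) else 0
  arr k i :=
    if k = 0 then
      if h : i < n * b then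
        (A.step (Fin.divNat ⟨i, h⟩) (Fin.modNat ⟨i, h⟩)).elim n Fin.val
      else 0
    else if k = 1 then
      if h : i < n then (if (⟨i, h⟩ : Fin n) ∈ A.accept then 1 else 0) else 0
    else 0

end RAM

/-! Complete the automaton by a sink, so that it has N = n + 1 states, and let F m be the state
reached by the canonical representation of m (`reach`). Some set is accepted by value if and only if
leading zeros do not matter, that is, the initial state is Nerode equivalent to its successor by 0;
the set is then forced to be {m | F m is final} (`exists_byValue_iff`).

Eventual periodicity is read in the coarser equivalence `Ultimate`: the same words of large length
are accepted from both states. Reading w after the representation of m ≥ 1 leads to m * b ^ |w| +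
val w, so long words see large numbers only, and the set is eventually periodic if and only if F is
purely periodic on m ≥ 1 modulo `Ultimate` (`eventuallyPeriodic_iff`). Two states are ultimately
equivalent as soon as all their successors are; hence a period d * b ^ j can be divided by b ^ j,
and once some period exists, a single coincidence F m ~ F (m + d) makes d a period
(`Period.of_rel`). The only candidate to test is therefore the least k < N with F 1 ~ F (1 + k), or
k = N if there is none, by the pigeonhole principle; and it is enough to compare F x with F (x + k)
for x + k < k * b + b (`Period.of_le`, `exists_period_iff`). This takes O(b N) comparisons.

The Nerode classes come from Hopcroft's algorithm. Its cost is bounded by a potential to which a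
state contributes its weight times the logarithm of the size of its block, plus its weight if the
block is pending: a split never raises it (`SplitStep.pot_le`), and taking a splitter releases what
treating it costs (`refine_spec`).

`Ultimate` is the least equivalence that contains the Nerode equivalence and identifies states with
equivalent successors (`Ultimate.imp`). It is computed by congruence closure. To avoid signatures of
length b, each state x is unfolded into elements a * N + x with 0 ≤ a ≤ b; the element of level a
stands for the successors by the letters a, …, b - 1, and its signature is the pair formed by the
class of the next element and the class of one successor (`SuccRel.level_step`). Smaller classes are
merged into larger ones, so an element is renamed at most log N times (`closPot_merge`).

On the machine side, loop-free code is executed symbolically (`WP.of_lf`), and loops carry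
invariants that also bound the time (`WP.while`, `WP.for`). Each phase takes time O(b N log N). -/

/-! ### Program logic for the random access machine, with running times and word bounds. -/

namespace RAM

/-- All words of the state are at most `B`. -/
def Bdd (B : ℕ) (s : State) : Prop :=
  2 ≤ B ∧ (∀ x, s.var x ≤ B) ∧ ∀ k i, s.arr k i ≤ B

namespace Expr

instance : Add Expr := ⟨Expr.add⟩
instance : Sub Expr := ⟨Expr.sub⟩
instance : Mul Expr := ⟨Expr.mul⟩

@[simp] theorem eval_const (s : State) (c : ℕ) : (const c).eval s = c := rfl
@[simp] theorem eval_var (s : State) (x : ℕ) : (var x).eval s = s.var x := rfl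
@[simp] theorem eval_cell (s : State) (k : ℕ) (e : Expr) :
    (cell k e).eval s = s.arr k (e.eval s) := rfl
@[simp] theorem eval_add (s : State) (e f : Expr) : (e + f).eval s = e.eval s + f.eval s := rfl
@[simp] theorem eval_sub (s : State) (e f : Expr) : (e - f).eval s = e.eval s - f.eval s := rfl
@[simp] theorem eval_mul (s : State) (e f : Expr) : (e * f).eval s = e.eval s * f.eval s := rfl
@[simp] theorem cost_const (c : ℕ) : (const c).cost = 1 := rfl
@[simp] theorem cost_var (x : ℕ) : (var x).cost = 1 := rfl
@[simp] theorem cost_cell (k : ℕ) (e : Expr) : (cell k e).cost = e.cost + 1 := rfl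
@[simp] theorem cost_add (e f : Expr) : (e + f).cost = e.cost + f.cost + 1 := rfl
@[simp] theorem cost_sub (e f : Expr) : (e - f).cost = e.cost + f.cost + 1 := rfl
@[simp] theorem cost_mul (e f : Expr) : (e * f).cost = e.cost + f.cost + 1 := rfl

/-- All constants of the expression are at most `2`. -/
def small : Expr → Bool
  | const c => decide (c ≤ 2)
  | var _ => true
  | cell _ e => e.small
  | add e f => e.small && f.small
  | sub e f => e.small && f.small
  | mul e f => e.small && f.small

/-- The expression is short and has small constants. -/
def ok (e : Expr) : Bool := e.small && decide (e.cost < 30)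

/-- Products add exponents, and a sum at most doubles its larger term, which one more factor B ≥ 2
absorbs; so the cost of an expression serves as an exponent for its value and for all intermediate
values. -/
theorem eval_le {B : ℕ} {s : State} (h : Bdd B s) :
    ∀ e : Expr, e.small = true → e.eval s ≤ B ^ e.cost ∧
      ∀ W, B ^ e.cost < W → e.Fits W s := by
  obtain ⟨h2, hv, ha⟩ := h
  have pos : ∀ e : Expr, 1 ≤ e.cost := by
    intro e; cases e <;> simp [cost]
  have hle : ∀ e : Expr, B ≤ B ^ e.cost := fun e => Nat.le_self_pow (by have := pos e; omega) B
  have hB1 : 1 ≤ B := by omega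
  intro e
  induction e with
  | const c =>
    intro hs
    simp only [small, decide_eq_true_eq] at hs
    refine ⟨?_, fun W hW => ?_⟩
    · simp only [eval, cost, pow_one]; omega
    · simp only [Fits]; simp only [cost, pow_one] at hW; omega
  | var x =>
    intro _
    refine ⟨?_, fun W hW => ?_⟩
    · simp only [eval, cost, pow_one]; exact hv x
    · simp only [Fits]; simp only [cost, pow_one] at hW; exact (hv x).trans_lt hW
  | cell k e ih =>
    intro hs
    obtain ⟨i1, i2⟩ := ih hs
    have h1 : B ^ e.cost ≤ B ^ (cell k e).cost := Nat.pow_le_pow_right hB1 (by simp [cost])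
    refine ⟨(ha _ _).trans (hle _), fun W hW => ⟨i2 W (h1.trans_lt hW), ?_⟩⟩
    exact ((ha _ _).trans (hle _)).trans_lt hW
  | add e f ihe ihf =>
    intro hs
    simp only [small, Bool.and_eq_true] at hs
    obtain ⟨i1, i2⟩ := ihe hs.1
    obtain ⟨j1, j2⟩ := ihf hs.2
    have h1 : B ^ e.cost ≤ B ^ (add e f).cost := Nat.pow_le_pow_right hB1 (by simp [cost]; omega)
    have h2' : B ^ f.cost ≤ B ^ (add e f).cost := Nat.pow_le_pow_right hB1 (by simp [cost]; omega)
    have key : e.eval s + f.eval s ≤ B ^ (add e f).cost := by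
      have a1 : B ^ e.cost ≤ B ^ (e.cost + f.cost) := Nat.pow_le_pow_right hB1 (by omega)
      have a2 : B ^ f.cost ≤ B ^ (e.cost + f.cost) := Nat.pow_le_pow_right hB1 (by omega)
      have a3 : B ^ (e.cost + f.cost) * 2 ≤ B ^ (e.cost + f.cost) * B := Nat.mul_le_mul_left _ h2
      simp only [cost, pow_succ]
      omega
    exact ⟨key, fun W hW => ⟨i2 W (h1.trans_lt hW), j2 W (h2'.trans_lt hW), key.trans_lt hW⟩⟩
  | sub e f ihe ihf =>
    intro hs
    simp only [small, Bool.and_eq_true] at hs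
    obtain ⟨i1, i2⟩ := ihe hs.1
    obtain ⟨j1, j2⟩ := ihf hs.2
    have h1 : B ^ e.cost ≤ B ^ (sub e f).cost := Nat.pow_le_pow_right hB1 (by simp [cost]; omega)
    have h2' : B ^ f.cost ≤ B ^ (sub e f).cost := Nat.pow_le_pow_right hB1 (by simp [cost]; omega)
    exact ⟨(Nat.sub_le _ _).trans (i1.trans h1),
      fun W hW => ⟨i2 W (h1.trans_lt hW), j2 W (h2'.trans_lt hW)⟩⟩
  | mul e f ihe ihf =>
    intro hs
    simp only [small, Bool.and_eq_true] at hs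
    obtain ⟨i1, i2⟩ := ihe hs.1
    obtain ⟨j1, j2⟩ := ihf hs.2
    have h1 : B ^ e.cost ≤ B ^ (mul e f).cost := Nat.pow_le_pow_right hB1 (by simp [cost]; omega)
    have h2' : B ^ f.cost ≤ B ^ (mul e f).cost := Nat.pow_le_pow_right hB1 (by simp [cost]; omega)
    have key : e.eval s * f.eval s ≤ B ^ (mul e f).cost := by
      calc e.eval s * f.eval s ≤ B ^ e.cost * B ^ f.cost := Nat.mul_le_mul i1 j1
        _ = B ^ (e.cost + f.cost) := (pow_add _ _ _).symm
        _ ≤ _ := Nat.pow_le_pow_right hB1 (by simp [cost])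
    exact ⟨key, fun W hW => ⟨i2 W (h1.trans_lt hW), j2 W (h2'.trans_lt hW), key.trans_lt hW⟩⟩

/-- This separates two bounds: stored words stay at most B, while evaluation may go beyond B inside
words below B ^ 30. Overflow is thus excluded by a syntactic check, and only stored values need an
estimate. -/
theorem fits {B : ℕ} {s : State} (h : Bdd B s) {e : Expr} (he : e.ok = true) :
    e.Fits (B ^ 30) s := by
  simp only [ok, Bool.and_eq_true, decide_eq_true_eq] at he
  exact (eval_le h e he.1).2 _ (Nat.pow_lt_pow_right (by have := h.1; omega) he.2)

end Expr

@[simp] theorem State.setVar_var (s : State) (x v y : ℕ) :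
    (s.setVar x v).var y = if y = x then v else s.var y := Function.update_apply _ _ _ _
@[simp] theorem State.setVar_arr (s : State) (x v : ℕ) : (s.setVar x v).arr = s.arr := rfl
@[simp] theorem State.setCell_var (s : State) (k i v : ℕ) : (s.setCell k i v).var = s.var := rfl
@[simp] theorem State.setCell_arr (s : State) (k i v l : ℕ) :
    (s.setCell k i v).arr l = if l = k then Function.update (s.arr k) i v else s.arr l :=
  Function.update_apply _ _ _ _

theorem Bdd.setVar {B : ℕ} {s : State} (h : Bdd B s) (x : ℕ) {v : ℕ} (hv : v ≤ B) :
    Bdd B (s.setVar x v) := by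
  refine ⟨h.1, fun y => ?_, h.2.2⟩
  rw [State.setVar_var]; split_ifs
  exacts [hv, h.2.1 y]

theorem Bdd.setCell {B : ℕ} {s : State} (h : Bdd B s) (k i : ℕ) {v : ℕ} (hv : v ≤ B) :
    Bdd B (s.setCell k i v) := by
  refine ⟨h.1, h.2.1, fun l j => ?_⟩
  rw [State.setCell_arr]; split_ifs with hl
  · rw [Function.update_apply]; split_ifs
    exacts [hv, h.2.2 k j]
  · exact h.2.2 l j

namespace Program

/-- All expressions of the program are short, with small constants. -/
def ok : Program → Bool
  | skip => true
  | assign _ e => e.ok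
  | store _ i e => i.ok && e.ok
  | seq P Q => P.ok && Q.ok
  | cond e P Q => e.ok && P.ok && Q.ok
  | loop e P => e.ok && P.ok

/-- The program assigns the variable. -/
def writesVar : Program → ℕ → Bool
  | skip, _ => false
  | assign x _, y => x == y
  | store _ _ _, _ => false
  | seq P Q, y => P.writesVar y || Q.writesVar y
  | cond _ P Q, y => P.writesVar y || Q.writesVar y
  | loop _ P, y => P.writesVar y

/-- The program stores into the array. -/
def writesArr : Program → ℕ → Bool
  | skip, _ => false
  | assign _ _, _ => false
  | store k _ _, y => k == y
  | seq P Q, y => P.writesArr y || Q.writesArr y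
  | cond _ P Q, y => P.writesArr y || Q.writesArr y
  | loop _ P, y => P.writesArr y

/-- The weakest precondition of a loop-free program, with the time as part of the outcome. -/
def lf (B : ℕ) : Program → State → (ℕ → State → Prop) → Prop
  | skip, s, Q => Q 1 s
  | assign x e, s, Q => e.eval s ≤ B ∧ Q (e.cost + 1) (s.setVar x (e.eval s))
  | store k i e, s, Q =>
    e.eval s ≤ B ∧ Q (i.cost + e.cost + 1) (s.setCell k (i.eval s) (e.eval s))
  | seq P P', s, Q => P.lf B s fun t s' => P'.lf B s' fun t' s'' => Q (t + t') s''
  | cond e P P', s, Q =>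
    (e.eval s ≠ 0 → P.lf B s fun t s' => Q (e.cost + 1 + t) s') ∧
    (e.eval s = 0 → P'.lf B s fun t s' => Q (e.cost + 1 + t) s')
  | loop _ _, _, _ => False

end Program

/-- The states agree on everything that the program does not write. -/
structure Frame (P : Program) (s s' : State) : Prop where
  var : ∀ x, P.writesVar x = false → s'.var x = s.var x
  arr : ∀ k, P.writesArr k = false → s'.arr k = s.arr k

theorem Frame.rfl' (P : Program) (s : State) : Frame P s s := ⟨fun _ _ => rfl, fun _ _ => rfl⟩

theorem Frame.trans {P : Program} {s s' s'' : State} (h : Frame P s s') (h' : Frame P s' s'') :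
    Frame P s s'' :=
  ⟨fun x hx => (h'.var x hx).trans (h.var x hx), fun k hk => (h'.arr k hk).trans (h.arr k hk)⟩

theorem Frame.mono {P Q : Program} {s s' : State} (h : Frame P s s')
    (hv : ∀ x, Q.writesVar x = false → P.writesVar x = false)
    (ha : ∀ x, Q.writesArr x = false → P.writesArr x = false) : Frame Q s s' :=
  ⟨fun x hx => h.var x (hv x hx), fun k hk => h.arr k (ha k hk)⟩

/-- Invariants need to mention only what a program changes: everything else is recovered from the
frame, whose side conditions are decided by computation. -/
theorem Exec.frame {W : ℕ} {P : Program} {s s' : State} {t : ℕ} (h : Exec W P s t s') :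
    Frame P s s' := by
  induction h with
  | skip s => exact Frame.rfl' _ _
  | assign x e s he =>
    refine ⟨fun y hy => ?_, fun _ _ => rfl⟩
    simp only [Program.writesVar, beq_eq_false_iff_ne] at hy
    rw [State.setVar_var, if_neg (Ne.symm hy)]
  | store k i e s hi he =>
    refine ⟨fun _ _ => rfl, fun y hy => ?_⟩
    simp only [Program.writesArr, beq_eq_false_iff_ne] at hy
    rw [State.setCell_arr, if_neg (Ne.symm hy)]
  | seq hP hQ i1 i2 =>
    exact (i1.mono (fun x hx => by simp_all [Program.writesVar])
      (fun x hx => by simp_all [Program.writesArr])).trans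
      (i2.mono (fun x hx => by simp_all [Program.writesVar])
      (fun x hx => by simp_all [Program.writesArr]))
  | cond_true he h hP i =>
    exact i.mono (fun x hx => by simp_all [Program.writesVar])
      (fun x hx => by simp_all [Program.writesArr])
  | cond_false he h hP i =>
    exact i.mono (fun x hx => by simp_all [Program.writesVar])
      (fun x hx => by simp_all [Program.writesArr])
  | loop_true he h hP hL i1 i2 =>
    exact (i1.mono (fun x hx => by simp_all [Program.writesVar])
      (fun x hx => by simp_all [Program.writesArr])).trans i2
  | loop_false he h => exact Frame.rfl' _ _

/-- Started in `s` with all words bounded by `B`, the program halts without exceeding `B`, and the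
running time and the final state satisfy `Q`. -/
def WP (B : ℕ) (P : Program) (s : State) (Q : ℕ → State → Prop) : Prop :=
  Bdd B s → ∃ t s', Exec (B ^ 30) P s t s' ∧ Bdd B s' ∧ Q t s'

section rules

variable {B : ℕ} {P P' : Program} {s : State} {Q Q' : ℕ → State → Prop}

theorem WP.mono (h : WP B P s Q) (h' : ∀ t s', Frame P s s' → Q t s' → Q' t s') :
    WP B P s Q' := fun hB =>
  let ⟨t, s', h1, h2, h3⟩ := h hB
  ⟨t, s', h1, h2, h' _ _ h1.frame h3⟩

theorem WP.seq (h : WP B P s fun t s' => WP B P' s' fun t' s'' => Q (t + t') s'') :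
    WP B (P.seq P') s Q := fun hB =>
  let ⟨_, _, h1, h2, h3⟩ := h hB
  let ⟨_, _, k1, k2, k3⟩ := h3 h2
  ⟨_, _, h1.seq k1, k2, k3⟩

theorem WP.cond {e : Expr} (he : e.ok = true)
    (h1 : e.eval s ≠ 0 → WP B P s fun t s' => Q (e.cost + 1 + t) s')
    (h2 : e.eval s = 0 → WP B P' s fun t s' => Q (e.cost + 1 + t) s') :
    WP B (P.cond e P') s Q := by
  intro hB
  by_cases h : e.eval s = 0
  · obtain ⟨t, s', k1, k2, k3⟩ := h2 h hB
    exact ⟨_, s', .cond_false (Expr.fits hB he) h k1, k2, k3⟩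
  · obtain ⟨t, s', k1, k2, k3⟩ := h1 h hB
    exact ⟨_, s', .cond_true (Expr.fits hB he) h k1, k2, k3⟩

/-- Without loops the weakest precondition is computed by recursion on the program, so a concrete
fragment reduces by simplification to bounds on the stored values and a statement about an explicit
final state. -/
theorem WP.of_lf : ∀ {P : Program} {s : State} {Q : ℕ → State → Prop}, P.ok = true →
    P.lf B s Q → WP B P s Q := by
  intro P
  induction P with
  | skip => exact fun _ h hB => ⟨1, _, .skip _, hB, h⟩
  | assign x e => exact fun he h hB => ⟨_, _, .assign x e _ (Expr.fits hB he), hB.setVar x h.1, h.2⟩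
  | store k i e =>
    intro s Q he h hB
    simp only [Program.ok, Bool.and_eq_true] at he
    exact ⟨_, _, .store k i e _ (Expr.fits hB he.1) (Expr.fits hB he.2), hB.setCell k _ h.1, h.2⟩
  | seq P P' ih ih' =>
    intro s Q he h
    simp only [Program.ok, Bool.and_eq_true] at he
    exact WP.seq ((ih he.1 h).mono fun t s' _ h' => ih' he.2 h')
  | cond e P P' ih ih' =>
    intro s Q he h
    simp only [Program.ok, Bool.and_eq_true] at he
    exact WP.cond he.1.1 (fun h0 => ih he.1.2 (h.1 h0)) (fun h0 => ih' he.2 (h.2 h0))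
  | loop e P => exact fun _ h => h.elim

/-- Loops, with an invariant that depends on the remaining time. -/
theorem WP.while {e : Expr} (I : ℕ → State → Prop) (p : ℕ) (he : e.ok = true)
    (h0 : I p s)
    (hI : ∀ p s', I p s' → Frame (P.loop e) s s' → e.eval s' ≠ 0 →
      WP B P s' fun t s'' => Frame P s' s'' → ∃ p', I p' s'' ∧ t + (e.cost + 1) + p' ≤ p) :
    WP B (P.loop e) s fun t s' => ∃ p', I p' s' ∧ e.eval s' = 0 ∧ t + p' ≤ p + (e.cost + 1) := by
  have key : ∀ p s', I p s' → Frame (P.loop e) s s' → WP B (P.loop e) s'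
      fun t s' => ∃ p', I p' s' ∧ e.eval s' = 0 ∧ t + p' ≤ p + (e.cost + 1) := by
    intro p
    induction p using Nat.strong_induction_on with
    | _ p ih =>
      intro s' hs' hF hB
      by_cases h : e.eval s' = 0
      · exact ⟨_, s', .loop_false (Expr.fits hB he) h, hB, p, hs', h, by omega⟩
      · obtain ⟨t, s2, k1, k2, k3⟩ := hI p s' hs' hF h hB
        obtain ⟨p', j1, j2⟩ := k3 k1.frame
        have hF2 : Frame (P.loop e) s s2 := hF.trans (k1.frame.mono (fun _ h => h) fun _ h => h)
        obtain ⟨t', s3, l1, l2, p'', l3, l4, l5⟩ := ih p' (by omega) s2 j1 hF2 k2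
        exact ⟨_, s3, .loop_true (Expr.fits hB he) h k1 l1, l2, p'', l3, l4, by omega⟩
  exact key p s h0 (Frame.rfl' _ _)

end rules

/-- `for i = 0, …, e - 1 do P`. -/
def forLoop (i : ℕ) (e : Expr) (P : Program) : Program :=
  .seq (.assign i (.const 0)) (.loop (e - .var i) (.seq P (.assign i (.var i + .const 1))))

/-- The time is a sum of bounds that depend on the iteration, which allows each iteration to be
charged to the data it treats. The bound `e` is evaluated anew at each test, hence the demand `hem`
that it keep the value `m`. The constant 40 covers a test and an increment, as `e.cost < 28`. -/
theorem WP.for {B : ℕ} {P : Program} {s : State} {e : Expr} {i : ℕ}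
    (I : ℕ → State → Prop) (m : ℕ) (c : ℕ → ℕ) (he : (e - .var i).ok = true)
    (hi : P.writesVar i = false) (hm : m ≤ B)
    (h0 : I 0 (s.setVar i 0))
    (hem : ∀ j s', j ≤ m → I j s' → Frame (forLoop i e P) s s' → s'.var i = j → e.eval s' = m)
    (hI : ∀ j s', j < m → I j s' → Frame (forLoop i e P) s s' → s'.var i = j →
      WP B P s' fun t s'' => Frame P s' s'' → t ≤ c j ∧ I (j + 1) (s''.setVar i (j + 1))) :
    WP B (forLoop i e P) s fun t s' =>
      I m s' ∧ s'.var i = m ∧ t ≤ ∑ j ∈ Finset.range m, (c j + 40) + 40 := by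
  have hcost : e.cost < 28 := by
    have h := of_decide_eq_true (Bool.and_eq_true_iff.1 he).2
    simp only [Expr.cost_sub, Expr.cost_var] at h
    omega
  refine WP.seq (WP.of_lf rfl ?_)
  refine ⟨Nat.zero_le _, ?_⟩
  have hF0 : Frame (forLoop i e P) s (s.setVar i 0) := by
    refine ⟨fun x hx => ?_, fun _ _ => rfl⟩
    simp [forLoop, Program.writesVar] at hx
    rw [State.setVar_var, if_neg (fun h => hx.1 h.symm)]
  have mono : ∀ {a b}, Frame (.loop (e - .var i) (.seq P (.assign i (.var i + .const 1)))) a b →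
      Frame (forLoop i e P) a b := fun h => h.mono
    (fun x hx => by simp_all [forLoop, Program.writesVar])
    (fun x hx => by simp_all [forLoop, Program.writesArr])
  have main := WP.while (B := B) (s := s.setVar i 0) (e := e - .var i)
    (P := .seq P (.assign i (.var i + .const 1)))
    (fun p s' => ∃ j, j ≤ m ∧ I j s' ∧ s'.var i = j ∧ p = ∑ l ∈ Finset.Ico j m, (c l + 40))
    (∑ l ∈ Finset.Ico 0 m, (c l + 40)) he ⟨0, Nat.zero_le _, h0, by simp, rfl⟩ ?_
  · refine main.mono ?_
    rintro t s' hF ⟨p', ⟨j, hj, hIj, hij, rfl⟩, hz, ht⟩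
    have := hem j s' hj hIj (hF0.trans (mono hF)) hij
    simp only [Expr.eval_sub, this, Expr.eval_var, hij] at hz
    obtain rfl : j = m := by omega
    refine ⟨hIj, hij, ?_⟩
    simp only [Finset.Ico_self, Finset.sum_empty, Expr.cost_sub, Expr.cost_var] at ht
    rw [Nat.Ico_zero_eq_range] at ht
    simp only [Expr.cost_const]
    omega
  · rintro p s' ⟨j, hj, hIj, hij, rfl⟩ hF hz
    have hF' := hF0.trans (mono hF)
    have h1 := hem j s' hj hIj hF' hij
    simp only [Expr.eval_sub, h1, Expr.eval_var, hij] at hz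
    have hjm : j < m := by omega
    refine WP.seq ((hI j s' hjm hIj hF' hij).mono ?_)
    intro t s'' hF2 h2
    obtain ⟨h3, h4⟩ := h2 hF2
    have h5 : s''.var i = j := (hF2.var i hi).trans hij
    refine WP.of_lf rfl ⟨?_, fun _ => ⟨_, ⟨j + 1, hjm, ?_, ?_, rfl⟩, ?_⟩⟩
    · simp [h5]; omega
    · simpa [h5] using h4
    · simp [h5]
    · rw [Finset.sum_eq_sum_Ico_succ_bot hjm]
      simp
      omega

end RAM

/-! ### Lists stored in segments of arrays, and lists of predecessors. -/

/-- The list of the values `f o, …, f (o + l - 1)`. -/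
def seg (f : ℕ → ℕ) (o l : ℕ) : List ℕ := (List.range l).map fun i => f (o + i)

section seg

variable {f g : ℕ → ℕ} {o l : ℕ}

@[simp] theorem seg_zero : seg f o 0 = [] := rfl

theorem seg_succ : seg f o (l + 1) = seg f o l ++ [f (o + l)] := by
  simp [seg, List.range_succ]

@[simp] theorem length_seg : (seg f o l).length = l := by simp [seg]

theorem mem_seg {x : ℕ} : x ∈ seg f o l ↔ ∃ i < l, f (o + i) = x := by simp [seg]

theorem getElem_seg {i : ℕ} (h : i < (seg f o l).length) : (seg f o l)[i] = f (o + i) := by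
  simp [seg]

theorem seg_congr (h : ∀ i < l, f (o + i) = g (o + i)) : seg f o l = seg g o l :=
  List.map_congr_left fun i hi => h i (List.mem_range.1 hi)

theorem seg_update_of_ne {k v : ℕ} (h : ∀ i < l, o + i ≠ k) :
    seg (Function.update f k v) o l = seg f o l :=
  seg_congr fun i hi => Function.update_of_ne (h i hi) _ _

theorem row_ne {N c d i j : ℕ} (hi : i < N) (hj : j < N) (h : c ≠ d) : c * N + i ≠ d * N + j := by
  intro e
  apply h
  have h1 : (c * N + i) / N = c := by
    rw [mul_comm, Nat.mul_add_div (by omega), Nat.div_eq_of_lt hi, add_zero]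
  have h2 : (d * N + j) / N = d := by
    rw [mul_comm, Nat.mul_add_div (by omega), Nat.div_eq_of_lt hj, add_zero]
  rw [← h1, e, h2]

theorem seg_update_row {N c d i v : ℕ} (hl : l ≤ N) (hi : i < N) (h : c ≠ d) :
    seg (Function.update f (d * N + i) v) (c * N) l = seg f (c * N) l :=
  seg_update_of_ne fun _ hj => row_ne (hj.trans_le hl) hi h

theorem seg_update_append {v : ℕ} :
    seg (Function.update f (o + l) v) o (l + 1) = seg f o l ++ [v] := by
  rw [seg_succ, seg_update_of_ne fun i hi => by omega, Function.update_self]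

theorem take_seg {i : ℕ} (h : i < l) :
    (seg f o l).take (i + 1) = (seg f o l).take i ++ [f (o + i)] := by
  rw [List.take_add_one, List.getElem?_eq_getElem (by simpa using h), getElem_seg]
  rfl

theorem take_succ_of_seg_eq {L : List ℕ} {i : ℕ} (e : seg f o l = L) (h : i < l) :
    L.take (i + 1) = L.take i ++ [f (o + i)] := e ▸ take_seg h

theorem mem_of_seg_eq {L : List ℕ} {i : ℕ} (e : seg f o l = L) (h : i < l) : f (o + i) ∈ L :=
  e ▸ mem_seg.2 ⟨i, h, rfl⟩

theorem sum_seg {w : ℕ → ℕ} : ∑ i ∈ Finset.range l, w (f (o + i)) = ((seg f o l).map w).sum := by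
  induction l with
  | zero => rfl
  | succ l ih => rw [Finset.sum_range_succ, seg_succ, ih]; simp

theorem sum_of_seg_eq {L : List ℕ} {w : ℕ → ℕ} (e : seg f o l = L) :
    ∑ i ∈ Finset.range l, w (f (o + i)) = (L.map w).sum := e ▸ sum_seg

end seg

theorem List.Nodup.length_le_of_lt {L : List ℕ} {N : ℕ} (h : L.Nodup) (h' : ∀ x ∈ L, x < N) :
    L.length ≤ N := by
  have := (h.subperm (l₂ := List.range N) fun x hx => List.mem_range.2 (h' x hx)).length_le
  simpa using this

/-- The predecessors of `q` by the letter `a`, where `tr (a * N + x)` is the successor of `x`. -/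
def preds (N : ℕ) (tr : ℕ → ℕ) (a q : ℕ) : List ℕ :=
  (List.range N).filter fun x => tr (a * N + x) = q

theorem mem_preds {N : ℕ} {tr : ℕ → ℕ} {a q x : ℕ} :
    x ∈ preds N tr a q ↔ x < N ∧ tr (a * N + x) = q := by simp [preds]

theorem nodup_preds {N : ℕ} {tr : ℕ → ℕ} {a q : ℕ} : (preds N tr a q).Nodup :=
  List.nodup_range.filter _

theorem length_preds_le {N : ℕ} {tr : ℕ → ℕ} {a q : ℕ} : (preds N tr a q).length ≤ N :=
  nodup_preds.length_le_of_lt fun _ h => (mem_preds.1 h).1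

theorem sum_length_preds {N : ℕ} {tr : ℕ → ℕ} {a : ℕ} (h : ∀ x < N, tr (a * N + x) < N) :
    ∑ q ∈ Finset.range N, (preds N tr a q).length = N := by
  have h1 : ∀ q, (preds N tr a q).length =
      ((Finset.range N).filter fun x => tr (a * N + x) = q).card := fun q => by
    rw [← List.toFinset_card_of_nodup nodup_preds]
    congr 1
    ext x
    simp [mem_preds]
  simp_rw [h1]
  rw [← Finset.card_eq_sum_card_fiberwise (s := Finset.range N) (t := Finset.range N)
    (f := fun x => tr (a * N + x)) fun x hx => by simpa using h x (by simpa using hx)]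
  simp

/-! ### The decision program and its parameters. -/

namespace RAM

/-! Variables: `0` `b`, `1` `n`, `2` the initial state, `3` the number `N = n + 1` of states of the
completed automaton.  Arrays: `2` successors (`a * N + x` for the state `x` and the letter `a`),
`3` and `4` numbers and lists of predecessors, `5` names of the classes, `6` lists of their members,
`7` positions in these lists, `8` sizes of the classes, `9` pending blocks, `10` stack of the pending
blocks, `11` the splitter, `12` and `13` lists and numbers of the marked states of the blocks,
`14` list of the blocks with marked states, `15` table of the signatures, `16` stack of the items to
be examined, `17` states reached by the representations of the integers. -/

open RAM.Expr RAM.Program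

infixr:60 " ;; " => Program.seq

/-- Completes the automaton and lists the predecessors. -/
def setup : Program :=
  assign 3 (var 1 + const 1) ;;
  forLoop 4 (var 0) (forLoop 5 (var 3) (
    cond (var 1 - var 5) (assign 7 (cell 0 (var 5 * var 0 + var 4))) (assign 7 (var 1)) ;;
    store 2 (var 4 * var 3 + var 5) (var 7) ;;
    store 4 ((var 4 * var 3 + var 7) * var 3 + cell 3 (var 4 * var 3 + var 7)) (var 5) ;;
    store 3 (var 4 * var 3 + var 7) (cell 3 (var 4 * var 3 + var 7) + const 1)))

/-- Marks the state in variable `7`. -/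
def mark : Program :=
  assign 8 (cell 5 (var 7)) ;;
  cond (cell 13 (var 8)) skip (store 14 (var 14) (var 8) ;; assign 14 (var 14 + const 1)) ;;
  store 12 (var 8 * var 3 + cell 13 (var 8)) (var 7) ;;
  store 13 (var 8) (cell 13 (var 8) + const 1)

/-- Moves the state in variable `7` from the block in variable `8` to the block in variable `12`. -/
def move : Program :=
  assign 11 (cell 6 (var 8 * var 3 + (cell 8 (var 8) - const 1))) ;;
  store 6 (var 8 * var 3 + cell 7 (var 7)) (var 11) ;;
  store 7 (var 11) (cell 7 (var 7)) ;;
  store 8 (var 8) (cell 8 (var 8) - const 1) ;;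
  store 6 (var 12 * var 3 + cell 8 (var 12)) (var 7) ;;
  store 7 (var 7) (cell 8 (var 12)) ;;
  store 8 (var 12) (cell 8 (var 12) + const 1) ;;
  store 5 (var 7) (var 12)

/-- Makes the block in variable `8` or the new block in variable `12` pending. -/
def push : Program :=
  assign 15 (var 12) ;;
  cond (cell 9 (var 8)) skip (cond (cell 8 (var 12) - cell 8 (var 8)) (assign 15 (var 8)) skip) ;;
  store 10 (var 13) (var 15) ;;
  assign 13 (var 13 + const 1) ;;
  store 9 (var 15) (const 1) ;;
  assign 12 (var 12 + const 1)

/-- Splits the block in variable `8` by its marked states. -/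
def splitBlock : Program :=
  forLoop 10 (cell 13 (var 8)) (assign 7 (cell 12 (var 8 * var 3 + var 10)) ;; move) ;; push

/-- Splits all blocks by their marked states. -/
def split : Program :=
  forLoop 9 (var 14) (
    assign 8 (cell 14 (var 9)) ;;
    cond (cell 8 (var 8) - cell 13 (var 8)) splitBlock skip ;;
    store 13 (var 8) (const 0)) ;;
  assign 14 (const 0)

/-- The initial partition, by acceptance. -/
def initBlocks : Program :=
  forLoop 5 (var 3) (store 6 (var 5) (var 5) ;; store 7 (var 5) (var 5)) ;;
  store 8 (const 0) (var 3) ;;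
  assign 12 (const 1) ;;
  store 9 (const 0) (const 1) ;;
  assign 13 (const 1) ;;
  forLoop 5 (var 3) (cond (cell 1 (var 5)) (assign 7 (var 5) ;; mark) skip) ;;
  split

/-- Splits all blocks by the predecessors by the letter in variable `4` of the splitter. -/
def splitLetter : Program :=
  forLoop 17 (var 16) (
    assign 5 (cell 11 (var 17)) ;;
    forLoop 6 (cell 3 (var 4 * var 3 + var 5)) (
      assign 7 (cell 4 ((var 4 * var 3 + var 5) * var 3 + var 6)) ;;
      mark)) ;;
  split

/-- Takes a pending block as the splitter. -/
def popBlock : Program :=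
  assign 13 (var 13 - const 1) ;;
  assign 8 (cell 10 (var 13)) ;;
  store 9 (var 8) (const 0) ;;
  assign 16 (cell 8 (var 8)) ;;
  forLoop 17 (var 16) (store 11 (var 17) (cell 6 (var 8 * var 3 + var 17)))

/-- Hopcroft's algorithm. -/
def refine : Program :=
  initBlocks ;;
  loop (var 13) (popBlock ;; forLoop 4 (var 0) splitLetter)

/-- Initialisation of the classes of the elements `a * N + x`, for `1 ≤ a`, and of the stack. -/
def initClasses : Program :=
  forLoop 5 (var 0 * var 3 - var 3) (
    store 5 (var 3 + var 5) (var 3 + var 5) ;;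
    store 6 ((var 3 + var 5) * var 3) (var 3 + var 5) ;;
    store 8 (var 3 + var 5) (const 1)) ;;
  forLoop 5 (var 3) (store 5 (var 0 * var 3 + var 5) (var 0 * var 3)) ;;
  forLoop 5 (var 0 * var 3) (store 16 (var 5) (var 5)) ;;
  assign 19 (var 0 * var 3)

/-- Pushes the items that depend on the element in variable `26`. -/
def pushDependents : Program :=
  cond (var 3 - var 26)
    (forLoop 4 (var 0) (forLoop 6 (cell 3 (var 4 * var 3 + var 26)) (
      store 16 (var 19) (var 4 * var 3 + cell 4 ((var 4 * var 3 + var 26) * var 3 + var 6)) ;;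
      assign 19 (var 19 + const 1))))
    (store 16 (var 19) (var 26 - var 3) ;; assign 19 (var 19 + const 1))

/-- Merges the class in variable `23` into the class in variable `24`. -/
def mergeInto : Program :=
  forLoop 17 (cell 8 (var 23)) (
    assign 26 (cell 6 (var 23 * var 3 + var 17)) ;;
    store 5 (var 26) (var 24) ;;
    store 6 (var 24 * var 3 + cell 8 (var 24)) (var 26) ;;
    store 8 (var 24) (cell 8 (var 24) + const 1) ;;
    pushDependents)

/-- Merges the classes in the variables `23` and `24` if they are distinct. -/
def merge : Program :=
  cond ((var 23 - var 24) + (var 24 - var 23))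
    (cond (cell 8 (var 23) - cell 8 (var 24))
      (assign 25 (var 23) ;; assign 23 (var 24) ;; assign 24 (var 25)) skip ;;
     mergeInto)
    skip

/-- Examines the item on the top of the stack. -/
def examine : Program :=
  assign 19 (var 19 - const 1) ;;
  assign 20 (cell 16 (var 19)) ;;
  assign 21 (cell 5 (var 20 + var 3) * var 3 + cell 5 (cell 2 (var 20))) ;;
  cond (cell 15 (var 21))
    (assign 23 (cell 5 (var 20)) ;; assign 24 (cell 5 (cell 15 (var 21) - const 1)) ;; merge)
    (store 15 (var 21) (var 20 + const 1))

/-- Closure of the partition by the identification of the states with equivalent successors. -/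
def coarsen : Program :=
  initClasses ;; loop (var 19) examine

/-- Lists the states reached by the representations of the integers. -/
def reachAll : Program :=
  store 17 (const 0) (var 2) ;;
  forLoop 5 (var 3 + const 1) (
    assign 7 (cell 17 (var 5)) ;;
    forLoop 4 (var 0)
      (store 17 (var 5 * var 0 + var 4) (cell 2 (var 4 * var 3 + var 7))))

/-- The difference of the classes of the states reached by two integers. -/
def differ (e f : Expr) : Expr :=
  (cell 5 (cell 17 e) - cell 5 (cell 17 f)) + (cell 5 (cell 17 f) - cell 5 (cell 17 e))

/-- Looks for the period, into variable `27`. -/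
def findPeriod : Program :=
  assign 27 (const 1) ;;
  loop ((var 3 - var 27) * differ (const 1) (const 1 + var 27)) (assign 27 (var 27 + const 1))

/-- Clears variable `18` if the period is wrong. -/
def checkPeriod : Program :=
  forLoop 5 (var 27 * var 0 + var 0 - (var 27 + const 1))
    (cond (differ (const 1 + var 5) (const 1 + var 5 + var 27)) (assign 18 (const 0)) skip)

/-- Sets variable `18` if the initial state is equivalent to its successor by the letter `0`. -/
def checkStart : Program :=
  assign 18 (const 1 - ((cell 5 (var 2) - cell 5 (cell 2 (var 2))) +
    (cell 5 (cell 2 (var 2)) - cell 5 (var 2))))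

/-- The decision procedure. -/
def decideProgram : Program :=
  setup ;; refine ;; checkStart ;; coarsen ;; reachAll ;; findPeriod ;; checkPeriod ;;
  assign 0 (var 18)

/-- The data about the automaton that do not change after the setup. -/
structure Static (b N : ℕ) (tr : ℕ → ℕ) (s : State) : Prop where
  base : s.var 0 = b
  num : s.var 3 = N
  succ : ∀ e < b * N, s.arr 2 e = tr e
  pred : ∀ a < b, ∀ q < N, seg (s.arr 4) ((a * N + q) * N) (s.arr 3 (a * N + q)) = preds N tr a q

theorem Static.of_frame {b N : ℕ} {tr : ℕ → ℕ} {s s' : State} (h : Static b N tr s)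
    {P : Program} (hF : Frame P s s') (h0 : P.writesVar 0 = false := by rfl)
    (h3 : P.writesVar 3 = false := by rfl) (h2 : P.writesArr 2 = false := by rfl)
    (h4 : P.writesArr 3 = false := by rfl) (h5 : P.writesArr 4 = false := by rfl) :
    Static b N tr s' := by
  obtain ⟨i0, i1, i2, i3⟩ := h
  constructor
  · rw [hF.var 0 h0, i0]
  · rw [hF.var 3 h3, i1]
  · rw [hF.arr 2 h2]; exact i2
  · rw [hF.arr 4 h5, hF.arr 3 h4]; exact i3

theorem Static.cnt {b N : ℕ} {tr : ℕ → ℕ} {s : State} (h : Static b N tr s) {a q : ℕ}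
    (ha : a < b) (hq : q < N) : s.arr 3 (a * N + q) = (preds N tr a q).length := by
  rw [← h.pred a ha q hq, length_seg]

/-- The hypotheses on the sizes: the number of letters, the number of states, the bound of the
words, and the completed transition table. -/
structure Params (b N B : ℕ) (tr : ℕ → ℕ) : Prop where
  two_le_b : 2 ≤ b
  two_le_N : 2 ≤ N
  bound : 1000 * (b * N * N) ≤ B
  tr_lt : ∀ e < b * N, tr e < N

theorem Params.tr_lt' {b N B a x : ℕ} {tr : ℕ → ℕ} (h : Params b N B tr) (ha : a < b) (hx : x < N) :
    tr (a * N + x) < N := by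
  refine h.tr_lt _ ?_
  nlinarith

theorem Params.le_bound {b N B : ℕ} {tr : ℕ → ℕ} (h : Params b N B tr) :
    500 * (b * N) + 500 * (N * N) ≤ B ∧ b ≤ b * N ∧ 2 * N ≤ b * N ∧ 2 * N ≤ N * N := by
  obtain ⟨h1, h2, h3, -⟩ := h
  have h4 : 2 * (b * N) ≤ b * N * N := by nlinarith [Nat.zero_le (b * N)]
  have h5 : 2 * (N * N) ≤ b * N * N := by nlinarith [Nat.zero_le (N * N)]
  refine ⟨by omega, by nlinarith, by nlinarith, by nlinarith⟩

end RAM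

/-! ### Partitions stored in arrays: moving and marking states. -/

namespace RAM
open RAM.Expr RAM.Program

/-- The arrays `mem`, `pos` and `size` list the classes of the partition given by `cls`. -/
structure PartInv (N : ℕ) (cls mem pos size : ℕ → ℕ) : Prop where
  pos_lt : ∀ q < N, pos q < size (cls q)
  mem_pos : ∀ q < N, mem (cls q * N + pos q) = q
  mem_lt : ∀ c, ∀ i < size c, mem (c * N + i) < N ∧ cls (mem (c * N + i)) = c ∧
    pos (mem (c * N + i)) = i

namespace PartInv

variable {N : ℕ} {cls mem pos size : ℕ → ℕ}

theorem mem_seg_iff (h : PartInv N cls mem pos size) {c q : ℕ} :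
    q ∈ seg mem (c * N) (size c) ↔ q < N ∧ cls q = c := by
  rw [mem_seg]
  constructor
  · rintro ⟨i, hi, rfl⟩
    exact ⟨(h.mem_lt c i hi).1, (h.mem_lt c i hi).2.1⟩
  · rintro ⟨hq, rfl⟩
    exact ⟨_, h.pos_lt q hq, h.mem_pos q hq⟩

theorem nodup_seg (h : PartInv N cls mem pos size) (c : ℕ) : (seg mem (c * N) (size c)).Nodup := by
  refine List.Nodup.map_on (fun i hi j hj e => ?_) List.nodup_range
  rw [List.mem_range] at hi hj
  rw [← (h.mem_lt c i hi).2.2, e, (h.mem_lt c j hj).2.2]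

/-- The number of states of a class. -/
def _root_.RAM.blockCard (N : ℕ) (cls : ℕ → ℕ) (c : ℕ) : ℕ :=
  ((Finset.range N).filter fun q => cls q = c).card

theorem size_eq (h : PartInv N cls mem pos size) (c : ℕ) : size c = blockCard N cls c := by
  have := List.toFinset_card_of_nodup (h.nodup_seg c)
  rw [length_seg] at this
  rw [← this, blockCard]
  congr 1
  ext q
  simp [h.mem_seg_iff]

theorem size_le (h : PartInv N cls mem pos size) (c : ℕ) : size c ≤ N := by
  rw [h.size_eq]
  exact (Finset.card_filter_le _ _).trans (Finset.card_range N).le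

theorem size_lt (h : PartInv N cls mem pos size) {c q : ℕ} (hq : q < N) (hc : cls q ≠ c) :
    size c < N := by
  rw [h.size_eq]
  conv_rhs => rw [← Finset.card_range N]
  refine Finset.card_lt_card (Finset.filter_ssubset.2 ⟨q, by simpa using hq, hc⟩)

/-- The last member of the old class fills the hole left by p, and p is appended to the row of d. If
p itself is the last member, the update of its position to the end of d comes later and prevails.
The row of d has room because p is outside d, so d has fewer than N members. -/
theorem move (h : PartInv N cls mem pos size) {p d : ℕ} (hp : p < N) (hd : cls p ≠ d) :
    PartInv N (Function.update cls p d)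
      (Function.update
        (Function.update mem (cls p * N + pos p) (mem (cls p * N + (size (cls p) - 1))))
        (d * N + size d) p)
      (Function.update
        (Function.update pos (mem (cls p * N + (size (cls p) - 1))) (pos p)) p (size d))
      (Function.update (Function.update size (cls p) (size (cls p) - 1)) d (size d + 1)) := by
  generalize hc : cls p = c at *
  have hpc : pos p < size c := hc ▸ h.pos_lt p hp
  have hl := h.mem_lt c (size c - 1) (by omega)
  generalize hl' : mem (c * N + (size c - 1)) = l at *
  obtain ⟨hl1, hl2, hl3⟩ := hl
  have hsc := h.size_le c
  have hsd : size d < N := h.size_lt hp (by rwa [hc])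
  have inj : ∀ q < N, ∀ r < N, cls q = cls r → pos q = pos r → q = r := fun q hq r hr h1 h2 => by
    rw [← h.mem_pos q hq, h1, h2, h.mem_pos r hr]
  constructor
  · intro q hq
    by_cases hqp : q = p
    · subst hqp; simp
    · rw [Function.update_of_ne hqp, Function.update_of_ne hqp]
      have h1 := h.pos_lt q hq
      by_cases hql : q = l
      · subst hql
        rw [Function.update_self, hl2, Function.update_of_ne hd, Function.update_self]
        have : pos p ≠ pos q := fun e => hqp (inj q hq p hp (by rw [hc, hl2]) e.symm)
        omega
      · rw [Function.update_of_ne hql]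
        by_cases hqc : cls q = c
        · have h2 : pos q ≠ pos l := fun e => hql (inj q hq l hl1 (by rw [hqc, hl2]) e)
          rw [hqc] at h1
          rw [hqc, Function.update_of_ne hd, Function.update_self]
          omega
        · by_cases hqd : cls q = d
          · rw [hqd] at h1
            rw [hqd, Function.update_self]; omega
          · rwa [Function.update_of_ne hqd, Function.update_of_ne hqc]
  · intro q hq
    by_cases hqp : q = p
    · subst hqp; simp
    · rw [Function.update_of_ne hqp, Function.update_of_ne hqp]
      have h1 := h.pos_lt q hq
      have h1' := h.size_le (cls q)
      by_cases hql : q = l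
      · subst hql
        rw [Function.update_self, hl2, Function.update_of_ne (row_ne (by omega) hsd hd),
          Function.update_self]
      · rw [Function.update_of_ne hql]
        rw [Function.update_of_ne, Function.update_of_ne, h.mem_pos q hq]
        · by_cases hqc : cls q = c
          · intro e
            rw [hqc] at e
            exact hqp (inj q hq p hp (hqc.trans hc.symm) (by omega))
          · exact row_ne (by omega) (by omega) hqc
        · by_cases hqd : cls q = d
          · rw [hqd] at h1 ⊢; omega
          · exact row_ne (by omega) (by omega) hqd
  · intro c' i hi
    by_cases hcd : c' = d
    · subst hcd
      rw [Function.update_self] at hi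
      by_cases hid : i = size c'
      · subst hid; simp [hp]
      · have hi' : i < size c' := by omega
        rw [Function.update_of_ne (by omega), Function.update_of_ne (row_ne (by omega) (by omega)
          hd.symm)]
        obtain ⟨m1, m2, m3⟩ := h.mem_lt c' i hi'
        have n1 : mem (c' * N + i) ≠ p := fun e => hd (by rw [← hc, ← e, m2])
        have n2 : mem (c' * N + i) ≠ l := fun e => hd (by rw [← hl2, ← e, m2])
        rw [Function.update_of_ne n1, Function.update_of_ne n1, Function.update_of_ne n2]
        exact ⟨m1, m2, m3⟩
    · rw [Function.update_of_ne hcd] at hi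
      have hiN : i < N := by
        by_cases hcc : c' = c
        · subst hcc; rw [Function.update_self] at hi; omega
        · rw [Function.update_of_ne hcc] at hi; have := h.size_le c'; omega
      rw [Function.update_of_ne (row_ne hiN hsd hcd)]
      by_cases hcc : c' = c
      · subst hcc
        rw [Function.update_self] at hi
        by_cases hip : i = pos p
        · subst hip
          rw [Function.update_self]
          have : l ≠ p := by rintro rfl; omega
          rw [Function.update_of_ne this, Function.update_of_ne this, Function.update_self]
          exact ⟨hl1, hl2, rfl⟩
        · rw [Function.update_of_ne (by omega)]
          obtain ⟨m1, m2, m3⟩ := h.mem_lt c' i (by omega)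
          have n1 : mem (c' * N + i) ≠ p := fun e => hip (by rw [← m3, e])
          have n2 : mem (c' * N + i) ≠ l := fun e => by rw [e] at m3; omega
          rw [Function.update_of_ne n1, Function.update_of_ne n1, Function.update_of_ne n2]
          exact ⟨m1, m2, m3⟩
      · rw [Function.update_of_ne hcc] at hi
        rw [Function.update_of_ne (row_ne hiN (by omega) hcc)]
        obtain ⟨m1, m2, m3⟩ := h.mem_lt c' i hi
        have n1 : mem (c' * N + i) ≠ p := fun e => hcc (by rw [← hc, ← e, m2])
        have n2 : mem (c' * N + i) ≠ l := fun e => hcc (by rw [← hl2, ← e, m2])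
        rw [Function.update_of_ne n1, Function.update_of_ne n1, Function.update_of_ne n2]
        exact ⟨m1, m2, m3⟩

end PartInv

/-- The partition stored in the arrays of the state. -/
abbrev State.part (N : ℕ) (s : State) : Prop :=
  PartInv N (s.arr 5) (s.arr 6) (s.arr 7) (s.arr 8)

variable {b N B : ℕ} {tr : ℕ → ℕ}

theorem move_spec (hP : Params b N B tr) {s : State} (hN : s.var 3 = N) (h : s.part N)
    (hp : s.var 7 < N) (hc : s.arr 5 (s.var 7) = s.var 8) (hd : s.var 8 ≠ s.var 12)
    (hd' : s.var 12 ≤ N) :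
    WP B move s fun t s' => t ≤ 70 ∧ s'.part N ∧
      s'.arr 5 = Function.update (s.arr 5) (s.var 7) (s.var 12) := by
  obtain ⟨g1, g2, g3, g4⟩ := hP.le_bound
  have hm := h.move hp (hc ▸ hd)
  rw [hc] at hm
  have k1 := h.pos_lt _ hp
  rw [hc] at k1
  have k2 := h.mem_lt (s.var 8) (s.arr 8 (s.var 8) - 1) (by omega)
  have k3 := h.size_le (s.var 8)
  have k4 := h.size_le (s.var 12)
  refine WP.of_lf rfl ?_
  simp [move, lf, hN, hd.symm, State.part]
  exact ⟨by omega, by omega, by omega, by omega, by omega, by omega, by omega, hm⟩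

/-- The lists of the marked states: `ml` lists the marked states in the order of their marking. -/
structure MarkInv (N : ℕ) (ml : List ℕ) (s : State) : Prop where
  rows : ∀ c, seg (s.arr 12) (c * N) (s.arr 13 c) = ml.filter fun p => s.arr 5 p = c
  nodup : (seg (s.arr 14) 0 (s.var 14)).Nodup
  mem : ∀ c, c ∈ seg (s.arr 14) 0 (s.var 14) ↔ ∃ p ∈ ml, s.arr 5 p = c

theorem MarkInv.length_eq {ml : List ℕ} {s : State} (h : MarkInv N ml s) (c : ℕ) :
    s.arr 13 c = (ml.filter fun p => s.arr 5 p = c).length := by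
  rw [← h.rows, length_seg]

theorem MarkInv.length_le {ml : List ℕ} {s : State} (h : MarkInv N ml s) (c : ℕ) :
    s.arr 13 c ≤ ml.length := by
  rw [h.length_eq]
  exact List.length_filter_le _ _

theorem MarkInv.touched_le {ml : List ℕ} {s : State} (h : MarkInv N ml s) :
    s.var 14 ≤ ml.length := by
  have := (h.nodup.subperm (l₂ := ml.map (s.arr 5)) fun c hc => by
    obtain ⟨p, hp, rfl⟩ := (h.mem c).1 hc
    exact List.mem_map_of_mem hp).length_le
  simpa using this

theorem mark_spec (hP : Params b N B tr) {s : State} (hN : s.var 3 = N) {ml : List ℕ}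
    (h : MarkInv N ml s) (hl : ml.length < N) {p : ℕ} (hp : s.var 7 = p) (hpN : p < N)
    (hc : s.arr 5 p ≤ N) :
    WP B mark s fun t s' => t ≤ 40 ∧ MarkInv N (ml ++ [p]) s' := by
  obtain ⟨g1, g2, g3, g4⟩ := hP.le_bound
  have k1 := h.length_le (s.arr 5 p)
  have k2 := h.touched_le
  have rows : ∀ c, seg (Function.update (s.arr 12) (s.arr 5 p * N + s.arr 13 (s.arr 5 p)) p) (c * N)
      (Function.update (s.arr 13) (s.arr 5 p) (s.arr 13 (s.arr 5 p) + 1) c) =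
      (ml ++ [p]).filter fun q => s.arr 5 q = c := by
    intro c
    rw [List.filter_append, ← h.rows]
    by_cases hc : c = s.arr 5 p
    · subst hc
      rw [Function.update_self, seg_update_append]
      simp
    · rw [Function.update_of_ne hc, seg_update_row ((h.length_le c).trans hl.le) (by omega) hc]
      simp [Ne.symm hc]
  have mem' : s.arr 13 (s.arr 5 p) ≠ 0 ↔ s.arr 5 p ∈ seg (s.arr 14) 0 (s.var 14) := by
    rw [h.mem, h.length_eq, Ne, List.length_eq_zero_iff, List.filter_eq_nil_iff]
    simp
  refine WP.of_lf rfl ?_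
  simp only [mark, lf]
  simp only [eval_cell, eval_var, hp, State.setVar_arr, State.setVar_var, State.setCell_arr,
    State.setCell_var, eval_add, eval_mul, eval_const, hN, cost_cell, cost_var, cost_add, cost_mul,
    cost_const, if_true, Nat.reduceEqDiff, if_false]
  refine ⟨by omega, fun h0 => ⟨by omega, by omega, by omega, ?_⟩,
    fun h0 => ⟨by omega, by omega, by omega, by omega, by omega, ?_⟩⟩
  · constructor
    · simpa [hp, hN] using rows
    · simpa using h.nodup
    · intro c
      simp [h.mem]
      rintro rfl
      exact (h.mem _).1 (mem'.1 h0)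
  · have e0 : seg (Function.update (s.arr 14) (s.var 14) (s.arr 5 p)) 0 (s.var 14 + 1) =
        seg (s.arr 14) 0 (s.var 14) ++ [s.arr 5 p] := by
      conv_lhs => rw [show s.var 14 = 0 + s.var 14 by omega]
      simpa using seg_update_append (f := s.arr 14) (o := 0) (l := s.var 14) (v := s.arr 5 p)
    constructor
    · simpa [hp, hN] using rows
    · simp [e0]
      rw [List.nodup_append]
      refine ⟨h.nodup, by simp, ?_⟩
      have := mt mem'.2 (by simpa using h0)
      intro a ha c hc
      rw [List.mem_singleton] at hc
      subst hc
      rintro rfl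
      exact this ha
    · intro c
      simp [e0, h.mem]
      exact or_congr_right eq_comm

end RAM

/-! ### Splitting the blocks by the marked states. -/

namespace RAM
open RAM.Expr RAM.Program

/-- A partition of `0, …, N - 1` into `nb` blocks, some of them pending. -/
structure Conf where
  cls : ℕ → ℕ
  pend : ℕ → ℕ
  nb : ℕ

/-- No block is empty, and only blocks are pending. -/
structure Conf.WF (N : ℕ) (c : Conf) : Prop where
  lt : ∀ q < N, c.cls q < c.nb
  surj : ∀ d < c.nb, ∃ q < N, c.cls q = d
  pend_lt : ∀ d, c.pend d ≠ 0 → d < c.nb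

theorem Conf.WF.nb_le {N : ℕ} {c : Conf} (h : c.WF N) : c.nb ≤ N := by
  have : Finset.range c.nb ⊆ (Finset.range N).image c.cls := fun d hd => by
    obtain ⟨q, hq, e⟩ := h.surj d (Finset.mem_range.1 hd)
    exact Finset.mem_image.2 ⟨q, Finset.mem_range.2 hq, e⟩
  simpa using (Finset.card_le_card this).trans Finset.card_image_le

/-- A block is split by the set `X`, into two nonempty parts; the new block becomes pending, unless
the old one is not pending and becomes the smaller one. -/
def SplitStep (N : ℕ) (X : ℕ → Prop) (c c' : Conf) : Prop :=
  ∃ d, (∃ q < N, c.cls q = d ∧ X q) ∧ (∃ q < N, c.cls q = d ∧ ¬ X q) ∧ c'.nb = c.nb + 1 ∧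
    (∀ q < N, (X q → c.cls q = d → c'.cls q = c.nb) ∧
      (¬ X q ∨ c.cls q ≠ d → c'.cls q = c.cls q)) ∧
    ((c'.pend = Function.update c.pend c.nb 1 ∧
        (c.pend d ≠ 0 ∨ blockCard N c'.cls c.nb ≤ blockCard N c'.cls d)) ∨
      (c'.pend = Function.update c.pend d 1 ∧
        c.pend d = 0 ∧ blockCard N c'.cls d ≤ blockCard N c'.cls c.nb))

/-- The partition and the pending blocks stored in the arrays of the state. -/
def State.conf (s : State) : Conf := ⟨s.arr 5, s.arr 9, s.var 12⟩

/-- The data of Hopcroft's algorithm. -/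
structure HopInv (N : ℕ) (s : State) : Prop where
  part : s.part N
  wf : s.conf.WF N
  nodup : (seg (s.arr 10) 0 (s.var 13)).Nodup
  mem : ∀ d, d ∈ seg (s.arr 10) 0 (s.var 13) ↔ s.arr 9 d ≠ 0

theorem HopInv.stack_le {N : ℕ} {s : State} (h : HopInv N s) : s.var 13 ≤ N := by
  have := h.nodup.length_le_of_lt (N := N) fun d hd =>
    (h.wf.pend_lt d ((h.mem d).1 hd)).trans_le h.wf.nb_le
  simpa using this

variable {b N B : ℕ} {tr : ℕ → ℕ}

theorem SplitSteps.nb_le {X : ℕ → Prop} {c c' : Conf}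
    (h : Relation.ReflTransGen (SplitStep N X) c c') : c.nb ≤ c'.nb := by
  induction h with
  | refl => exact le_rfl
  | tail _ h ih =>
    obtain ⟨d, -, -, h, -⟩ := h
    omega

theorem splitBlock_spec (hP : Params b N B tr) {s : State} (hN : s.var 3 = N) (h : HopInv N s)
    {d : ℕ} (hd : s.var 8 = d) {L : List ℕ} (hL : seg (s.arr 12) (d * N) (s.arr 13 d) = L)
    (hLn : L.Nodup) (hLm : ∀ x ∈ L, x < N ∧ s.arr 5 x = d) (hL0 : L ≠ [])
    (hLs : L.length < s.arr 8 d) {X : ℕ → Prop} (hX : ∀ q < N, s.arr 5 q = d → (X q ↔ q ∈ L)) :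
    WP B splitBlock s fun t s' => t ≤ 130 * L.length + 100 ∧ HopInv N s' ∧
      SplitStep N X s.conf s'.conf ∧ s'.arr 5 = fun q => if q ∈ L then s.var 12 else s.arr 5 q := by
  obtain ⟨g1, g2, g3, g4⟩ := hP.le_bound
  have hlen : s.arr 13 d = L.length := by rw [← hL, length_seg]
  obtain ⟨p0, hp0⟩ := List.exists_mem_of_ne_nil L hL0
  have hdnb : d < s.var 12 := by
    rw [← (hLm p0 hp0).2]; exact h.wf.lt p0 (hLm p0 hp0).1
  have hnbN := h.wf.nb_le
  change s.var 12 ≤ N at hnbN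
  have hsd := h.part.size_le d
  refine WP.seq ((WP.for (fun j s' => s'.part N ∧
    s'.arr 5 = fun q => if q ∈ L.take j then s.var 12 else s.arr 5 q) L.length (fun _ => 80) rfl rfl
    (by omega) ⟨by simpa [State.part] using h.part, by simp⟩ ?_ ?_).mono ?_)
  · intro j s' _ _ hF _
    simp [hF.arr 13 rfl, hF.var 8 rfl, hd, hlen]
  · rintro j s' hj ⟨h1, h2⟩ hF hij
    refine WP.seq (WP.of_lf rfl ?_)
    simp only [lf, eval_cell, eval_add, eval_mul, eval_var, hF.arr 12 rfl, hF.var 8 rfl,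
      hF.var 3 rfl, hij, hd, hN]
    have hj' : j < s.arr 13 d := by omega
    have hm := hLm _ (mem_of_seg_eq hL hj')
    have ht := take_succ_of_seg_eq hL hj'
    have hnot : s.arr 12 (d * N + j) ∉ L.take j := by
      have := (List.take_sublist (j + 1) L).nodup hLn
      rw [ht, List.nodup_append] at this
      intro hmem
      exact this.2.2 _ hmem _ (List.mem_singleton.2 rfl) rfl
    refine ⟨by omega, (move_spec hP ?_ ?_ ?_ ?_ ?_ ?_).mono ?_⟩
    · simp [hF.var 3 rfl, hN]
    · simpa [State.part] using h1
    · simp [hm.1]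
    · simp [hF.var 8 rfl, hd, h2, hnot, hm.2]
    · simp [hF.var 8 rfl, hF.var 12 rfl, hd]; omega
    · simp [hF.var 12 rfl]; omega
    · rintro t s'' - ⟨k1, k2, k3⟩ hF'
      refine ⟨by simp; omega, by simpa [State.part] using k2, ?_⟩
      simp [k3, hF.var 12 rfl, h2]
      funext q
      rw [Function.update_apply]
      by_cases hq : q = s.arr 12 (d * N + j)
      · simp [ht, hq]
      · simp [ht, hq]
  · rintro t s' hF ⟨⟨h1, h2⟩, -, ht⟩
    rw [List.take_length] at h2
    rw [Finset.sum_const, Finset.card_range, smul_eq_mul] at ht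
    have hb1 := h1.size_eq d
    have hb2 := h1.size_eq (s.var 12)
    have n1 := h1.size_le d
    have n2 := h1.size_le (s.var 12)
    have hst := h.stack_le
    have hcls : ∀ q < N, (X q → s.arr 5 q = d → s'.arr 5 q = s.var 12) ∧
      (¬ X q ∨ s.arr 5 q ≠ d → s'.arr 5 q = s.arr 5 q) := by
      intro q hq
      rw [h2]
      constructor
      · intro k1 k2; simp [(hX q hq k2).1 k1]
      · rintro hh
        have : q ∉ L := by
          intro hqL
          rcases hh with hh | hh
          · exact hh ((hX q hq (hLm q hqL).2).2 hqL)
          · exact hh (hLm q hqL).2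
        simp [this]
    have hex1 : ∃ q < N, s.arr 5 q = d ∧ X q :=
      ⟨p0, (hLm p0 hp0).1, (hLm p0 hp0).2, (hX _ (hLm p0 hp0).1 (hLm p0 hp0).2).2 hp0⟩
    -- If all states of the block were marked, its list of members would be contained in the
    -- strictly shorter list `L`.
    have hex2 : ∃ q < N, s.arr 5 q = d ∧ ¬ X q := by
      by_contra hcon
      push Not at hcon
      have := ((h.part.nodup_seg d).subperm (l₂ := L) fun q hq => by
        rw [h.part.mem_seg_iff] at hq
        exact (hX q hq.1 hq.2).1 (hcon q hq.1 hq.2)).length_le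
      simp at this
      omega
    have hnotmem : ∀ E, s.arr 9 E = 0 → E ∉ seg (s.arr 10) 0 (s.var 13) := fun E hE hmem =>
      (h.mem E).1 hmem hE
    have hseg : ∀ E, seg (Function.update (s.arr 10) (s.var 13) E) 0 (s.var 13 + 1) =
        seg (s.arr 10) 0 (s.var 13) ++ [E] := fun E => by
      simpa using seg_update_append (f := s.arr 10) (o := 0) (l := s.var 13) (v := E)
    -- The invariant is restored in the same way whichever half `E` is made pending; all that
    -- matters is that `E` was not pending, so that the stack remains without repetition.
    have fin : ∀ (E : ℕ) (s'' : State), E ≤ s.var 12 → s.arr 9 E = 0 →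
        s''.arr 5 = s'.arr 5 → s''.arr 6 = s'.arr 6 → s''.arr 7 = s'.arr 7 → s''.arr 8 = s'.arr 8 →
        s''.arr 9 = Function.update (s.arr 9) E 1 → s''.var 12 = s.var 12 + 1 →
        s''.arr 10 = Function.update (s.arr 10) (s.var 13) E → s''.var 13 = s.var 13 + 1 →
        HopInv N s'' := by
      intro E s'' hE hE0 e5 e6 e7 e8 e9 e12 e10 e13
      refine ⟨?_, ⟨?_, ?_, ?_⟩, ?_, ?_⟩
      · rw [State.part, e5, e6, e7, e8]; exact h1
      · intro q hq
        change s''.arr 5 q < s''.var 12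
        rw [e5, e12, h2]
        have := h.wf.lt q hq
        change s.arr 5 q < s.var 12 at this
        dsimp only
        split_ifs <;> omega
      · intro c hc
        change c < s''.var 12 at hc
        change ∃ q < N, s''.arr 5 q = c
        rw [e5]
        rw [e12] at hc
        by_cases hc' : c = s.var 12
        · obtain ⟨q, hq, hqd, hqX⟩ := hex1
          exact ⟨q, hq, by rw [(hcls q hq).1 hqX hqd, hc']⟩
        · by_cases hcd : c = d
          · obtain ⟨q, hq, hqd, hqX⟩ := hex2
            exact ⟨q, hq, by rw [(hcls q hq).2 (Or.inl hqX), hqd, hcd]⟩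
          · obtain ⟨q, hq, hqc⟩ := h.wf.surj c (show c < s.var 12 by omega)
            change s.arr 5 q = c at hqc
            exact ⟨q, hq, by rw [(hcls q hq).2 (Or.inr (by rwa [hqc])), hqc]⟩
      · intro c hc
        change s''.arr 9 c ≠ 0 at hc
        change c < s''.var 12
        rw [e12]
        rw [e9, Function.update_apply] at hc
        split_ifs at hc with hcE
        · omega
        · have := h.wf.pend_lt c hc
          change c < s.var 12 at this
          omega
      · rw [e10, e13, hseg, List.nodup_append]
        refine ⟨h.nodup, by simp, fun a ha c hc => ?_⟩
        rw [List.mem_singleton] at hc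
        subst hc
        rintro rfl
        exact hnotmem _ hE0 ha
      · intro c
        rw [e10, e13, hseg, e9, List.mem_append, List.mem_singleton, h.mem, Function.update_apply]
        split_ifs with hc <;> simp [hc]
    have hpnb : s.arr 9 (s.var 12) = 0 := by
      by_contra hcon
      exact lt_irrefl _ (h.wf.pend_lt _ hcon)
    refine WP.of_lf rfl ?_
    simp [push, lf, hF.var 12 rfl, hF.var 8 rfl, hF.var 13 rfl, hF.arr 9 rfl, hd]
    have b1 : s.var 12 ≤ B := by omega
    have b2 : s.var 13 < B := by omega
    have b3 : s.var 12 < B := by omega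
    have b4 : 1 ≤ B := by omega
    refine ⟨b1, fun h0 => ⟨b1, b2, b4, b3, by omega, ?_, ?_, h2⟩, fun h0 =>
      ⟨fun hlt => ⟨by omega, b2, b4, b3, by omega, ?_, ?_, h2⟩,
        fun hle => ⟨b1, b2, b4, b3, by omega, ?_, ?_, h2⟩⟩⟩
    · exact fin (s.var 12) _ le_rfl hpnb rfl rfl rfl rfl (by simp [hF.arr 9 rfl]) rfl
        (by simp [hF.arr 10 rfl]) (by simp)
    · refine ⟨d, hex1, hex2, by simp [State.conf], hcls, Or.inl ⟨?_, Or.inl h0⟩⟩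
      simp [State.conf, hF.arr 9 rfl]
    · exact fin d _ hdnb.le h0 rfl rfl rfl rfl (by simp [hF.arr 9 rfl]) rfl
        (by simp [hF.arr 10 rfl]) (by simp)
    · refine ⟨d, hex1, hex2, by simp [State.conf], hcls, Or.inr ⟨?_, h0, ?_⟩⟩
      · simp [State.conf, hF.arr 9 rfl]
      · rw [hb1, hb2] at hlt
        simp [State.conf]
        omega
    · exact fin (s.var 12) _ le_rfl hpnb rfl rfl rfl rfl (by simp [hF.arr 9 rfl]) rfl
        (by simp [hF.arr 10 rfl]) (by simp)
    · refine ⟨d, hex1, hex2, by simp [State.conf], hcls, Or.inl ⟨?_, Or.inr ?_⟩⟩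
      · simp [State.conf, hF.arr 9 rfl]
      · rw [hb1, hb2] at hle
        simp [State.conf]
        omega

/-- Marked and unmarked states are in different blocks. -/
def Separated (N : ℕ) (X : ℕ → Prop) (cls : ℕ → ℕ) : Prop :=
  ∀ p < N, ∀ q < N, cls p = cls q → X p → X q

theorem SplitStep.refine {X : ℕ → Prop} {c c' : Conf} (h : SplitStep N X c c') (hc : c.WF N)
    {p q : ℕ} (hp : p < N) (hq : q < N) (e : c'.cls p = c'.cls q) : c.cls p = c.cls q := by
  obtain ⟨d, -, -, -, h1, -⟩ := h
  have hp' := hc.lt p hp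
  have hq' := hc.lt q hq
  by_cases hpd : X p ∧ c.cls p = d <;> by_cases hqd : X q ∧ c.cls q = d
  · rw [hpd.2, hqd.2]
  · rw [(h1 p hp).1 hpd.1 hpd.2, (h1 q hq).2 (by tauto)] at e; omega
  · rw [(h1 q hq).1 hqd.1 hqd.2, (h1 p hp).2 (by tauto)] at e; omega
  · rwa [(h1 q hq).2 (by tauto), (h1 p hp).2 (by tauto)] at e

/-- Fibres over distinct names are disjoint. Hence the work on all touched blocks is bounded by the
number of marked states. -/
theorem sum_length_filter_le {tb : List ℕ} (h : tb.Nodup) (f : ℕ → ℕ) (ml : List ℕ) :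
    (tb.map fun d => (ml.filter fun p => f p = d).length).sum ≤ ml.length := by
  induction ml with
  | nil => simp
  | cons p ml ih =>
    have h1 : ∀ d, ((p :: ml).filter fun p => f p = d).length =
        (ml.filter fun p => f p = d).length + if d = f p then 1 else 0 := by
      intro d
      rw [List.filter_cons]
      by_cases hd : f p = d
      · simp [hd]
      · simp [hd, Ne.symm hd]
    have h2 : ∀ tb : List ℕ, (tb.map fun d => if d = f p then 1 else 0).sum = tb.count (f p) := by
      intro tb
      induction tb with
      | nil => rfl
      | cons d tb ih => rw [List.map_cons, List.sum_cons, ih, List.count_cons, add_comm]; simp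
    simp_rw [h1]
    rw [List.sum_map_add, List.length_cons, h2]
    exact Nat.add_le_add ih (List.nodup_iff_count_le_one.1 h _)

theorem HopInv.congr {s s' : State} (h : HopInv N s) (e5 : s'.arr 5 = s.arr 5)
    (e6 : s'.arr 6 = s.arr 6) (e7 : s'.arr 7 = s.arr 7) (e8 : s'.arr 8 = s.arr 8)
    (e9 : s'.arr 9 = s.arr 9) (e10 : s'.arr 10 = s.arr 10) (e12 : s'.var 12 = s.var 12)
    (e13 : s'.var 13 = s.var 13) : HopInv N s' := by
  obtain ⟨h1, h2, h3, h4⟩ := h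
  refine ⟨by rw [State.part, e5, e6, e7, e8]; exact h1, ?_, by rwa [e10, e13], ?_⟩
  · rw [State.conf, e5, e9, e12]; exact h2
  · rw [e10, e13, e9]; exact h4

/-- The blocks of the state `s` in the list `tb` have been split by the marked states `ml`. -/
structure SplitInv (N : ℕ) (ml tb : List ℕ) (s s' : State) : Prop where
  hop : HopInv N s'
  steps : Relation.ReflTransGen (SplitStep N (· ∈ ml)) s.conf s'.conf
  count : ∀ d, s'.arr 13 d = if d ∈ tb then 0 else s.arr 13 d
  old : ∀ q < N, s.arr 5 q ∉ tb → s'.arr 5 q = s.arr 5 q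
  new : ∀ q < N, s'.arr 5 q = s.arr 5 q ∨ s.var 12 ≤ s'.arr 5 q
  refine : ∀ p < N, ∀ q < N, s'.arr 5 p = s'.arr 5 q → s.arr 5 p = s.arr 5 q
  sep : ∀ p < N, ∀ q < N, s'.arr 5 p = s'.arr 5 q → s.arr 5 p ∈ tb → p ∈ ml → q ∈ ml

/-- Only the touched blocks are visited and each counter is reset on the way, so the cost is
proportional to the number of marked states and not to the number of blocks. -/
theorem split_spec (hP : Params b N B tr) {s : State} (hN : s.var 3 = N) (h : HopInv N s)
    {ml : List ℕ} (hm : MarkInv N ml s) (hml : ml.Nodup) (hml' : ∀ x ∈ ml, x < N) :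
    WP B split s fun t s' => t ≤ 500 * ml.length + 50 ∧ HopInv N s' ∧ MarkInv N [] s' ∧
      Relation.ReflTransGen (SplitStep N (· ∈ ml)) s.conf s'.conf ∧
      Separated N (· ∈ ml) (s'.arr 5) := by
  obtain ⟨g1, g2, g3, g4⟩ := hP.le_bound
  have hmN := hml.length_le_of_lt hml'
  obtain ⟨tb, htb⟩ : ∃ tb, seg (s.arr 14) 0 (s.var 14) = tb := ⟨_, rfl⟩
  have htl : tb.length = s.var 14 := by rw [← htb, length_seg]
  have htn := hm.nodup
  rw [htb] at htn
  have htle := hm.touched_le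
  have hrow : ∀ d, (ml.filter fun p => s.arr 5 p = d).Nodup := fun d => hml.filter _
  have hsum : ∑ j ∈ Finset.range (s.var 14), s.arr 13 (s.arr 14 (0 + j)) ≤ ml.length := by
    rw [sum_of_seg_eq htb, List.map_congr_left (fun d _ => hm.length_eq d)]
    exact sum_length_filter_le htn _ ml
  refine WP.seq ((WP.for (fun j s' => SplitInv N ml (tb.take j) s s')
    (s.var 14) (fun j => 130 * s.arr 13 (s.arr 14 (0 + j)) + 150) rfl rfl
    (by omega) ?_ ?_ ?_).mono ?_)
  · exact ⟨h.congr rfl rfl rfl rfl rfl rfl rfl rfl, by exact .refl, by simp, by simp, by simp,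
      by simp, by simp⟩
  · intro j s' _ _ hF _
    simp [hF.var 14 rfl]
  · rintro j s' hj ⟨h1, h2, h3, h4, h5, h6, h7⟩ hF hij
    obtain ⟨c, hc⟩ : ∃ c, s.arr 14 (0 + j) = c := ⟨_, rfl⟩
    have hc' : s.arr 14 j = c := by rw [← hc, zero_add]
    have hctb : c ∈ tb := hc ▸ mem_of_seg_eq htb hj
    have ht : tb.take (j + 1) = tb.take j ++ [c] := hc ▸ take_succ_of_seg_eq htb hj
    have hct : c ∉ tb.take j := by
      have := (List.take_sublist (j + 1) tb).nodup htn
      rw [ht, List.nodup_append] at this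
      intro hmem
      exact this.2.2 _ hmem _ (List.mem_singleton.2 rfl) rfl
    have htake : ∀ d, d ∈ tb.take (j + 1) ↔ d ∈ tb.take j ∨ d = c := by simp [ht]
    obtain ⟨p, hp, hpc⟩ : ∃ p ∈ ml, s.arr 5 p = c := (hm.mem c).1 (htb ▸ hctb)
    have hcnb : c < s.var 12 := hpc ▸ h.wf.lt p (hml' p hp)
    -- States that changed block have received a name that was unused at the beginning of the pass,
    -- so a touched block still to be visited has kept exactly its members.
    have hblk : ∀ q < N, s'.arr 5 q = c ↔ s.arr 5 q = c := by
      intro q hq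
      constructor
      · intro e
        rcases h5 q hq with h5 | h5
        · rw [← h5, e]
        · omega
      · intro e
        rw [h4 q hq (by rwa [e]), e]
    have hLmem : ∀ x, x ∈ (ml.filter fun p => s.arr 5 p = c) ↔ x ∈ ml ∧ s.arr 5 x = c := by simp
    obtain ⟨L, hL⟩ : ∃ L, (ml.filter fun p => s.arr 5 p = c) = L := ⟨_, rfl⟩
    rw [hL] at hLmem
    have hLn : L.Nodup := hL ▸ hrow c
    have hrows := hm.rows c
    rw [hL] at hrows
    have hlen : s.arr 13 c = L.length := by rw [← hrows, length_seg]
    have h13 : s'.arr 13 c = L.length := by rw [h3 c, if_neg hct, hlen]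
    have hnbN := h1.wf.nb_le
    have hnb0 := h.wf.nb_le
    change s.var 12 ≤ N at hnb0
    have key : ∀ s'' s3, s''.arr 13 = s'.arr 13 →
        s3 = s''.setCell 13 c 0 → HopInv N s'' →
        Relation.ReflTransGen (SplitStep N (· ∈ ml)) s'.conf s''.conf →
        (∀ q < N, s'.arr 5 q ≠ c → s''.arr 5 q = s'.arr 5 q) →
        (∀ q < N, s''.arr 5 q = s'.arr 5 q ∨ s.var 12 ≤ s''.arr 5 q) →
        (∀ p < N, ∀ q < N, s''.arr 5 p = s''.arr 5 q → s'.arr 5 p = s'.arr 5 q) →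
        (∀ p < N, ∀ q < N, s''.arr 5 p = s''.arr 5 q → s'.arr 5 p = c → p ∈ ml → q ∈ ml) →
        SplitInv N ml (tb.take (j + 1)) s (s3.setVar 9 (j + 1)) := by
      intro s'' s3 hF2 e3 k1 k2 k3 k4 k5 k6
      subst e3
      refine ⟨k1.congr rfl rfl rfl rfl rfl rfl rfl rfl, h2.trans k2, ?_, ?_, ?_, ?_, ?_⟩
      · intro d
        simp only [State.setCell_arr, State.setVar_arr, if_true, hF2, Function.update_apply, h3,
          htake]
        by_cases hdc : d = c <;> simp [hdc]
      · intro q hq hqt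
        rw [htake, not_or] at hqt
        have e : s'.arr 5 q = s.arr 5 q := h4 q hq hqt.1
        exact (k3 q hq (by rw [e]; exact hqt.2)).trans e
      · intro q hq
        change s''.arr 5 q = s.arr 5 q ∨ s.var 12 ≤ s''.arr 5 q
        rcases k4 q hq with k | k
        · rw [k]; exact h5 q hq
        · exact Or.inr k
      · intro p hp q hq e
        exact h6 p hp q hq (k5 p hp q hq e)
      · intro p hp q hq e hpt hpml
        rw [htake] at hpt
        rcases hpt with hpt | hpt
        · exact h7 p hp q hq (k5 p hp q hq e) hpt hpml
        · exact k6 p hp q hq e ((hblk p hp).2 hpt) hpml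
    refine WP.seq (WP.of_lf rfl ?_)
    simp only [lf, eval_cell, eval_var, hF.arr 14 rfl, hij, hc']
    refine ⟨by omega, WP.seq (WP.cond rfl (fun h0 => ?_) (fun h0 => ?_))⟩
    · simp only [eval_sub, eval_cell, eval_var, State.setVar_arr, State.setVar_var, if_true,
        h13] at h0
      have hspec := splitBlock_spec hP (s := s'.setVar 8 c) (d := c) (L := L) (X := (· ∈ ml))
        (by simp [hF.var 3 rfl, hN]) (h1.congr rfl rfl rfl rfl rfl rfl rfl rfl) (by simp)
        (by simp [hF.arr 12 rfl, h13, ← hlen, hrows]) hLn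
        (fun x hx => ⟨hml' x ((hLmem x).1 hx).1, (hblk x (hml' x ((hLmem x).1 hx).1)).2
          ((hLmem x).1 hx).2⟩)
        (List.ne_nil_of_mem ((hLmem p).2 ⟨hp, hpc⟩)) (by simp; omega)
        (fun q hq hqc => by
          rw [hLmem]
          exact ⟨fun hm => ⟨hm, (hblk q hq).1 hqc⟩, fun hm => hm.1⟩)
      refine hspec.mono ?_
      rintro t s'' hF2 ⟨k1, k2, k3, k4⟩
      simp only [State.setVar_arr, State.setVar_var] at k4
      norm_num at k4
      refine WP.of_lf rfl ?_
      have e8 : s''.var 8 = c := by simp [hF2.var 8 rfl]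
      simp only [lf, eval_const, eval_var, e8]
      refine ⟨Nat.zero_le _, fun hF3 => ?_⟩
      have hLin : ∀ q < N, s'.arr 5 q ≠ c → q ∉ L := fun q hq hqc hqL =>
        hqc ((hblk q hq).2 ((hLmem q).1 hqL).2)
      have hnb12 : s.var 12 ≤ s'.var 12 := by
        have := SplitSteps.nb_le h2
        exact this
      refine ⟨by simp [hc', hlen]; omega, key s'' _ (hF2.arr 13 rfl) rfl k2 (.single k3) ?_ ?_ ?_ ?_⟩
      · intro q hq hqc
        rw [k4]; simp [hLin q hq hqc]
      · intro q hq
        rw [k4]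
        by_cases hqL : q ∈ L <;> simp [hqL, hnb12]
      · intro p hp q hq e
        exact k3.refine h1.wf hp hq e
      · intro p hp q hq e hpc hpm
        have hpL : p ∈ L := (hLmem p).2 ⟨hpm, (hblk p hp).1 hpc⟩
        rw [k4] at e
        simp only [hpL, if_true] at e
        split_ifs at e with hqL
        · exact ((hLmem q).1 hqL).1
        · have := h1.wf.lt q hq
          change s'.arr 5 q < s'.var 12 at this
          omega
    · simp only [eval_sub, eval_cell, eval_var, State.setVar_arr, State.setVar_var, if_true,
        h13] at h0
      refine WP.of_lf rfl (WP.of_lf rfl ?_)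
      simp only [lf, eval_const, eval_var, State.setVar_var, if_true]
      refine ⟨Nat.zero_le _, fun hF3 => ⟨by simp,
        key (s'.setVar 8 c) _ rfl rfl (h1.congr rfl rfl rfl rfl rfl rfl rfl rfl) .refl
        (fun _ _ _ => rfl) (fun _ _ => Or.inl rfl) (fun _ _ _ _ e => e) ?_⟩⟩
      intro p hp q hq e hpc hpm
      by_contra hqm
      have hqc : s'.arr 5 q = c := by rw [← hpc]; exact e.symm
      -- Here the number of marks is at least the size of the block; one further unmarked member `q`
      -- would make the block too large.
      have hsub : ∀ x ∈ q :: L, x ∈ seg (s'.arr 6) (c * N) (s'.arr 8 c) := by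
        intro x hx
        rw [h1.part.mem_seg_iff]
        rcases List.mem_cons.1 hx with rfl | hx
        · exact ⟨hq, hqc⟩
        · have := (hLmem x).1 hx
          exact ⟨hml' x this.1, (hblk x (hml' x this.1)).2 this.2⟩
      have hqL : q ∉ L := fun hqL => hqm ((hLmem q).1 hqL).1
      have := ((List.nodup_cons.2 ⟨hqL, hLn⟩).subperm hsub).length_le
      simp at this
      omega
  · rintro t s' hF ⟨⟨h1, h2, h3, h4, h5, h6, h7⟩, -, ht⟩
    have htt : tb.take (s.var 14) = tb := by rw [← htl, List.take_length]
    rw [htt] at h3 h4 h7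
    refine WP.of_lf rfl ⟨Nat.zero_le _, ?_, h1.congr rfl rfl rfl rfl rfl rfl rfl rfl, ?_, h2, ?_⟩
    · rw [Finset.sum_add_distrib, Finset.sum_add_distrib, ← Finset.mul_sum] at ht
      simp at ht
      simp at hsum
      simp
      omega
    · have h13 : ∀ d, s'.arr 13 d = 0 := by
        intro d
        rw [h3]
        split_ifs with hd
        · rfl
        · rw [hm.length_eq, List.length_eq_zero_iff, List.filter_eq_nil_iff]
          intro p hp
          rw [← htb, hm.mem] at hd
          simpa using fun e => hd ⟨p, hp, e⟩
      constructor
      · intro c; simp [h13]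
      · simp
      · simp
    · intro p hp q hq e hpm
      refine h7 p hp q hq e ?_ hpm
      rw [← htb, hm.mem]
      exact ⟨p, hpm, rfl⟩

end RAM

/-! ### Abstract splits: soundness, potential and stability. -/

namespace RAM

variable {b N : ℕ} {tr : ℕ → ℕ}

theorem SplitStep.card {X : ℕ → Prop} {c c' : Conf} (h : SplitStep N X c c') (hc : c.WF N) :
    c'.WF N ∧ ∃ d, d < c.nb ∧ 0 < blockCard N c'.cls d ∧ 0 < blockCard N c'.cls c.nb ∧
      blockCard N c'.cls d + blockCard N c'.cls c.nb = blockCard N c.cls d ∧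
      (∀ e, e ≠ d → e ≠ c.nb → blockCard N c'.cls e = blockCard N c.cls e) ∧
      (∀ q < N, c'.cls q = c.cls q ∨ c.cls q = d ∧ c'.cls q = c.nb) ∧
      ((c'.pend = Function.update c.pend c.nb 1 ∧
        (c.pend d ≠ 0 ∨ blockCard N c'.cls c.nb ≤ blockCard N c'.cls d)) ∨
      (c'.pend = Function.update c.pend d 1 ∧
        c.pend d = 0 ∧ blockCard N c'.cls d ≤ blockCard N c'.cls c.nb)) := by
  classical
  obtain ⟨d, ⟨q1, h1, h1d, h1X⟩, ⟨q2, h2, h2d, h2X⟩, hnb, hcls, hp⟩ := h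
  have hd : d < c.nb := h1d ▸ hc.lt q1 h1
  have e1 : c'.cls q1 = c.nb := (hcls q1 h1).1 h1X h1d
  have e2 : c'.cls q2 = d := ((hcls q2 h2).2 (Or.inl h2X)).trans h2d
  have alt : ∀ q < N, c'.cls q = c.cls q ∨ c.cls q = d ∧ c'.cls q = c.nb := by
    intro q hq
    by_cases hX : X q
    · by_cases hqd : c.cls q = d
      · exact Or.inr ⟨hqd, (hcls q hq).1 hX hqd⟩
      · exact Or.inl ((hcls q hq).2 (Or.inr hqd))
    · exact Or.inl ((hcls q hq).2 (Or.inl hX))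
  refine ⟨⟨?_, ?_, ?_⟩, d, hd, ?_, ?_, ?_, ?_, alt, hp⟩
  · intro q hq
    have := hc.lt q hq
    rcases alt q hq with e | e <;> omega
  · intro e he
    by_cases h3 : e = c.nb
    · exact ⟨q1, h1, e1.trans h3.symm⟩
    by_cases h4 : e = d
    · exact ⟨q2, h2, e2.trans h4.symm⟩
    obtain ⟨q, hq, hqe⟩ := hc.surj e (by omega)
    rcases alt q hq with h | h
    · exact ⟨q, hq, h.trans hqe⟩
    · exact absurd (hqe.symm.trans h.1) h4
  · intro e he
    have hle : c.pend e ≠ 0 → e < c'.nb := fun h => by have := hc.pend_lt e h; omega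
    rcases hp with ⟨h, -⟩ | ⟨h, -⟩ <;> rw [h, Function.update_apply] at he <;> split_ifs at he with h5
    · omega
    · exact hle he
    · omega
    · exact hle he
  · exact Finset.card_pos.2 ⟨q2, by simp [h2, e2]⟩
  · exact Finset.card_pos.2 ⟨q1, by simp [h1, e1]⟩
  · unfold blockCard
    rw [← Finset.card_union_of_disjoint]
    · congr 1
      ext q
      simp only [Finset.mem_union, Finset.mem_filter, Finset.mem_range, ← and_or_left]
      refine and_congr_right fun hq => ?_
      have := hc.lt q hq
      rcases alt q hq with h | h <;> omega
    · rw [Finset.disjoint_left]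
      intro q hq hq'
      simp at hq hq'
      omega
  · intro e he1 he2
    unfold blockCard
    congr 1
    ext q
    simp only [Finset.mem_filter, Finset.mem_range]
    refine and_congr_right fun hq => ?_
    rcases alt q hq with h | h
    · rw [h]
    · rw [h.1, h.2]; exact ⟨fun h => absurd h.symm he2, fun h => absurd h.symm he1⟩

theorem SplitStep.pend_cases {X : ℕ → Prop} {c c' : Conf} (h : SplitStep N X c c') {e : ℕ}
    (he : c.pend e ≠ 0) : c'.pend e ≠ 0 := by
  obtain ⟨d, -, -, -, -, ⟨h, -⟩ | ⟨h, -⟩⟩ := h <;> rw [h, Function.update_apply] <;>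
    split_ifs <;> simp [he]

theorem SplitSteps.wf {X : ℕ → Prop} {c c' : Conf} (h : Relation.ReflTransGen (SplitStep N X) c c')
    (hc : c.WF N) : c'.WF N := by
  induction h with
  | refl => exact hc
  | tail _ h ih => exact (h.card ih).1

theorem SplitSteps.refine {X : ℕ → Prop} {c c' : Conf}
    (h : Relation.ReflTransGen (SplitStep N X) c c') (hc : c.WF N) {p q : ℕ} (hp : p < N)
    (hq : q < N) (e : c'.cls p = c'.cls q) : c.cls p = c.cls q := by
  induction h with
  | refl => exact e
  | tail h1 h ih => exact ih (h.refine (SplitSteps.wf h1 hc) hp hq e)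

theorem SplitSteps.separated {X Y : ℕ → Prop} {c c' : Conf}
    (h : Relation.ReflTransGen (SplitStep N X) c c') (hc : c.WF N) (hY : Separated N Y c.cls) :
    Separated N Y c'.cls :=
  fun p hp q hq e => hY p hp q hq (SplitSteps.refine h hc hp hq e)

/-- A splitting set that does not distinguish `E`-related states sends both to the same half. This
keeps Nerode equivalent states together. -/
theorem SplitSteps.sound {X : ℕ → Prop} {E : ℕ → ℕ → Prop} {c c' : Conf}
    (h : Relation.ReflTransGen (SplitStep N X) c c')
    (hX : ∀ p < N, ∀ q < N, E p q → (X p ↔ X q))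
    (hE : ∀ p < N, ∀ q < N, E p q → c.cls p = c.cls q) :
    ∀ p < N, ∀ q < N, E p q → c'.cls p = c'.cls q := by
  induction h with
  | refl => exact hE
  | @tail c1 c2 _ h ih =>
    intro p hp q hq e
    obtain ⟨d, -, -, -, h, -⟩ := h
    have h1 := ih p hp q hq e
    have h2 := hX p hp q hq e
    by_cases hh : X p ∧ c1.cls p = d
    · rw [(h p hp).1 hh.1 hh.2, (h q hq).1 (h2.1 hh.1) (h1 ▸ hh.2)]
    · rw [(h p hp).2 (by tauto), (h q hq).2 (by rw [← h1, ← h2]; tauto), h1]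

/-- The amortised cost of the pending work, where treating the state `q` costs `w q`. -/
def hopPot (N : ℕ) (w : ℕ → ℕ) (c : Conf) : ℕ :=
  ∑ q ∈ Finset.range N, w q *
    (Nat.log 2 (blockCard N c.cls (c.cls q)) + if c.pend (c.cls q) ≠ 0 then 1 else 0)

theorem log_add_one_le {m k : ℕ} (hm : 0 < m) (h : 2 * m ≤ k) : Nat.log 2 m + 1 ≤ Nat.log 2 k := by
  rw [← Nat.log_mul_base (by norm_num) hm.ne']
  exact Nat.log_mono_right (by omega)

/-- Hopcroft's choice of the smaller half. If the old block was pending, both halves are pending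
afterwards and the logarithms can only decrease. If it was not, the half that becomes pending has at
most half of the old size, so its logarithm drops by at least 1, which pays for the pending term. -/
theorem SplitStep.pot_le {X : ℕ → Prop} {c c' : Conf} (h : SplitStep N X c c') (hc : c.WF N)
    (w : ℕ → ℕ) : hopPot N w c' ≤ hopPot N w c := by
  obtain ⟨-, d, hd, p1, p2, hsum, hother, alt, hp⟩ := h.card hc
  refine Finset.sum_le_sum fun q hq => Nat.mul_le_mul_left _ ?_
  rw [Finset.mem_range] at hq
  have hqn := hc.lt q hq
  have hnp : c.pend c.nb = 0 := by
    by_contra hcon; exact lt_irrefl _ (hc.pend_lt _ hcon)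
  have l1 : Nat.log 2 (blockCard N c'.cls d) ≤ Nat.log 2 (blockCard N c.cls d) :=
    Nat.log_mono_right (by omega)
  have l2 : Nat.log 2 (blockCard N c'.cls c.nb) ≤ Nat.log 2 (blockCard N c.cls d) :=
    Nat.log_mono_right (by omega)
  have l3 : blockCard N c'.cls c.nb ≤ blockCard N c'.cls d →
      Nat.log 2 (blockCard N c'.cls c.nb) + 1 ≤ Nat.log 2 (blockCard N c.cls d) :=
    fun h => log_add_one_le p2 (by omega)
  have l4 : blockCard N c'.cls d ≤ blockCard N c'.cls c.nb →
      Nat.log 2 (blockCard N c'.cls d) + 1 ≤ Nat.log 2 (blockCard N c.cls d) :=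
    fun h => log_add_one_le p1 (by omega)
  by_cases hqd : c.cls q = d
  · rcases alt q hq with h1 | h1
    · rw [h1, hqd]
      rcases hp with ⟨h2, h3⟩ | ⟨h2, h3, h4⟩
      · rw [h2, Function.update_of_ne (by omega)]; omega
      · rw [h2, Function.update_self]
        simp [h3, l4 h4]
    · rw [h1.1, h1.2]
      rcases hp with ⟨h2, h3⟩ | ⟨h2, h3, h4⟩
      · rw [h2, Function.update_self]
        rcases h3 with h3 | h3
        · simp [h3, l2]
        · have := l3 h3; simp; omega
      · rw [h2, Function.update_of_ne (by omega), hnp, h3]; simpa using l2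
  · rcases alt q hq with h1 | h1
    · rw [h1, hother _ hqd (by omega)]
      rcases hp with ⟨h2, -⟩ | ⟨h2, -⟩
      · rw [h2, Function.update_of_ne (by omega)]
      · rw [h2, Function.update_of_ne hqd]
    · exact absurd h1.1 hqd

theorem SplitSteps.pot_le {X : ℕ → Prop} {c c' : Conf}
    (h : Relation.ReflTransGen (SplitStep N X) c c') (hc : c.WF N) (w : ℕ → ℕ) :
    hopPot N w c' ≤ hopPot N w c := by
  induction h with
  | refl => exact le_rfl
  | tail h1 h ih => exact (h.pot_le (SplitSteps.wf h1 hc) w).trans ih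

/-- Equivalent states have equivalent successors, up to the pending blocks and the splitter `T`. -/
def Stable (b N : ℕ) (tr : ℕ → ℕ) (T : ℕ → Prop) (c : Conf) : Prop :=
  ∀ p < N, ∀ q < N, c.cls p = c.cls q → ∀ a < b, c.cls (tr (a * N + p)) ≠ c.cls (tr (a * N + q)) →
    c.pend (c.cls (tr (a * N + p))) ≠ 0 ∨ c.pend (c.cls (tr (a * N + q))) ≠ 0 ∨
      ¬ (T (tr (a * N + p)) ↔ T (tr (a * N + q)))

/-- Two successors that this step separates lie in the two halves, one of which is pending now.
Successors separated before keep their reason: a pending block passes its status to both halves, and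
`T` is a fixed set of states rather than a block. -/
theorem SplitStep.stable {X T : ℕ → Prop} {c c' : Conf} (h : SplitStep N X c c') (hc : c.WF N)
    (ht : ∀ a < b, ∀ x < N, tr (a * N + x) < N) (hs : Stable b N tr T c) :
    Stable b N tr T c' := by
  intro p hp q hq e a ha hne
  have e' := h.refine hc hp hq e
  have hpend : ∀ {e}, c.pend e ≠ 0 → c'.pend e ≠ 0 := fun he => h.pend_cases he
  obtain ⟨-, d, hd, -, -, -, -, alt, hpp⟩ := h.card hc
  generalize hx : tr (a * N + p) = x at *
  generalize hy : tr (a * N + q) = y at *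
  have hxN : x < N := hx ▸ ht a ha p hp
  have hyN : y < N := hy ▸ ht a ha q hq
  have hkey : ∀ z < N, c.pend (c.cls z) ≠ 0 → c'.pend (c'.cls z) ≠ 0 := by
    intro z hz hzp
    rcases alt z hz with h1 | h1
    · rw [h1]; exact hpend hzp
    · rw [h1.1] at hzp
      rcases hpp with ⟨h2, -⟩ | ⟨-, h3, -⟩
      · rw [h1.2, h2, Function.update_self]; simp
      · exact absurd h3 hzp
  by_cases hxy : c.cls x = c.cls y
  · have hone : ∀ u v, u < N → v < N → c.cls u = c.cls v → c'.cls u = c.cls u →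
        (c.cls v = d ∧ c'.cls v = c.nb) → c'.pend (c'.cls u) ≠ 0 ∨ c'.pend (c'.cls v) ≠ 0 := by
      intro u v hu hv h1 h2 h3
      rcases hpp with ⟨h4, -⟩ | ⟨h4, -⟩
      · right; rw [h3.2, h4, Function.update_self]; simp
      · left; rw [h2, h1, h3.1, h4, Function.update_self]; simp
    rcases alt x hxN with h1 | h1 <;> rcases alt y hyN with h2 | h2
    · exact absurd (by rw [h1, h2, hxy]) hne
    · rcases hone x y hxN hyN hxy h1 h2 with h | h
      exacts [Or.inl h, Or.inr (Or.inl h)]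
    · rcases hone y x hyN hxN hxy.symm h2 h1 with h | h
      exacts [Or.inr (Or.inl h), Or.inl h]
    · exact absurd (h1.2.trans h2.2.symm) hne
  · have := hs p hp q hq e' a ha (by rwa [hx, hy])
    rw [hx, hy] at this
    rcases this with h1 | h1 | h1
    · exact Or.inl (hkey x hxN h1)
    · exact Or.inr (Or.inl (hkey y hyN h1))
    · exact Or.inr (Or.inr h1)

theorem SplitSteps.stable {X T : ℕ → Prop} {c c' : Conf}
    (h : Relation.ReflTransGen (SplitStep N X) c c') (hc : c.WF N)
    (ht : ∀ a < b, ∀ x < N, tr (a * N + x) < N) (hs : Stable b N tr T c) :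
    Stable b N tr T c' := by
  induction h with
  | refl => exact hs
  | tail h1 h ih => exact h.stable (SplitSteps.wf h1 hc) ht ih

/-- Taking the pending block `d` as the splitter. -/
theorem Stable.pop {c : Conf} {d : ℕ} (h : Stable b N tr (fun _ => False) c) :
    Stable b N tr (fun x => c.cls x = d) ⟨c.cls, Function.update c.pend d 0, c.nb⟩ := by
  intro p hp q hq e a ha hne
  simp only [Function.update_apply] at *
  rcases h p hp q hq e a ha hne with h1 | h1 | h1
  · by_cases hd : c.cls (tr (a * N + p)) = d
    · right; right
      intro hiff
      exact hne (hd.trans (hiff.1 hd).symm)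
    · left; rwa [if_neg hd]
  · by_cases hd : c.cls (tr (a * N + q)) = d
    · right; right
      intro hiff
      exact hne ((hiff.2 hd).trans hd.symm)
    · right; left; rwa [if_neg hd]
  · exact absurd Iff.rfl h1

/-- Once the preimages of the splitter by every letter are respected, the splitter no longer
distinguishes successors of equivalent states, and only pending blocks remain as an excuse. -/
theorem Stable.unsplit {c : Conf} {T : ℕ → Prop} (h : Stable b N tr T c)
    (hT : ∀ a < b, Separated N (fun x => T (tr (a * N + x))) c.cls) :
    Stable b N tr (fun _ => False) c := by
  intro p hp q hq e a ha hne
  rcases h p hp q hq e a ha hne with h1 | h1 | h1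
  · exact Or.inl h1
  · exact Or.inr (Or.inl h1)
  · exact absurd ⟨hT a ha p hp q hq e, hT a ha q hq p hp e.symm⟩ h1

/-- The pending terms of the members of `d` disappear; what they release pays for the round that
uses `d` as splitter. -/
theorem hopPot_pop {c : Conf} {d : ℕ} (w : ℕ → ℕ) (hd : c.pend d ≠ 0) :
    hopPot N w ⟨c.cls, Function.update c.pend d 0, c.nb⟩ +
      ∑ q ∈ (Finset.range N).filter (fun q => c.cls q = d), w q = hopPot N w c := by
  rw [Finset.sum_filter, hopPot, hopPot, ← Finset.sum_add_distrib]
  refine Finset.sum_congr rfl fun q _ => ?_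
  simp only [Function.update_apply]
  by_cases h : c.cls q = d
  · simp [h, hd]; ring
  · simp [h]

end RAM

/-! ### Completion of the automaton and initial partition. -/

namespace RAM
open RAM.Expr RAM.Program

variable {b N B : ℕ} {tr : ℕ → ℕ}

/-- The table of the successors and the lists of predecessors, up to the letter `a` and the
state `i`. -/
structure SetupInv (b N : ℕ) (tr : ℕ → ℕ) (a i : ℕ) (s : State) : Prop where
  num : s.var 3 = N
  succ : ∀ c < b, ∀ x < N, c < a ∨ c = a ∧ x < i → s.arr 2 (c * N + x) = tr (c * N + x)
  pred : ∀ c < b, ∀ q < N, seg (s.arr 4) ((c * N + q) * N) (s.arr 3 (c * N + q)) =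
    (List.range (if c < a then N else if c = a then i else 0)).filter
      fun x => tr (c * N + x) = q

theorem row_inj {N a c x y : ℕ} (hx : x < N) (hy : y < N) :
    a * N + x = c * N + y ↔ a = c ∧ x = y := by
  constructor
  · intro e
    have : a = c := by
      by_contra h
      exact row_ne hx hy h e
    subst this
    exact ⟨rfl, by omega⟩
  · rintro ⟨rfl, rfl⟩; rfl

theorem setup_spec (hP : Params b N B tr) {s : State} (hb : s.var 0 = b) (hn : s.var 1 + 1 = N)
    (htr : ∀ a < b, ∀ x < N, tr (a * N + x) =
      if x < s.var 1 then s.arr 0 (x * b + a) else s.var 1)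
    (h3 : ∀ i, s.arr 3 i = 0) :
    WP B setup s fun t s' => t ≤ 400 * (b * N) ∧ Static b N tr s' := by
  obtain ⟨g1, g2, g3, g4⟩ := hP.le_bound
  refine WP.seq (WP.of_lf rfl ?_)
  simp only [lf, eval_add, eval_var, eval_const, hn]
  refine ⟨by omega, (WP.for (fun a s' => SetupInv b N tr a 0 s') b (fun _ => 200 * N + 100) rfl rfl
    (by omega) ⟨by simp, ?_, ?_⟩ ?_ ?_).mono ?_⟩
  · intro c _ x _ hh; omega
  · intro c _ q _; simp [h3]
  · intro j s' _ _ hF _; simp [hF.var 0 rfl, hb]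
  · intro a s' ha hI hF hij
    refine (WP.for (fun i s'' => SetupInv b N tr a i s'') N (fun _ => 100) rfl rfl
      (by omega) ⟨by simp [hI.num], hI.succ, hI.pred⟩ ?_ ?_).mono ?_
    · intro j s'' _ h _ _; simp [h.num]
    · intro i s'' hi hI' hF' hii
      have e0 : s''.var 0 = b := by rw [hF'.var 0 rfl, hF.var 0 rfl]; simp [hb]
      have e1 : s''.var 1 = s.var 1 := by rw [hF'.var 1 rfl, hF.var 1 rfl]; simp
      have e4 : s''.var 4 = a := by rw [hF'.var 4 rfl, hij]
      have e0' : s''.arr 0 = s.arr 0 := by rw [hF'.arr 0 rfl, hF.arr 0 rfl]; simp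
      have hv := hP.tr_lt' ha hi
      have hvt := htr a ha i hi
      have hnum := hI'.num
      generalize hv' : tr (a * N + i) = v at hv hvt
      have hlen : s''.arr 3 (a * N + v) = ((List.range i).filter
          fun x => tr (a * N + x) = v).length := by
        have := hI'.pred a ha v hv
        simp only [lt_irrefl, if_false, if_true] at this
        rw [← this, length_seg]
      have hlen' : s''.arr 3 (a * N + v) ≤ i := by
        rw [hlen]; exact (List.length_filter_le _ _).trans (by simp)
      have main : ∀ s3 : State, s3.var 3 = N →
          s3.arr 2 = Function.update (s''.arr 2) (a * N + i) v →
          s3.arr 4 = Function.update (s''.arr 4) ((a * N + v) * N + s''.arr 3 (a * N + v)) i →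
          s3.arr 3 = Function.update (s''.arr 3) (a * N + v) (s''.arr 3 (a * N + v) + 1) →
          SetupInv b N tr a (i + 1) (s3.setVar 5 (i + 1)) := by
        intro s3 k1 k2 k3 k4
        refine ⟨by simpa using k1, fun c hc x hx hh => ?_, fun c hc q hq => ?_⟩
        · simp only [State.setVar_arr]
          rw [k2, Function.update_apply]
          split_ifs with he
          · obtain ⟨rfl, rfl⟩ := (row_inj hx hi).1 he
            exact hv'.symm
          · refine hI'.succ c hc x hx ?_
            rcases hh with hh | ⟨rfl, hh⟩
            · exact Or.inl hh
            · have : x ≠ i := by rintro rfl; exact he rfl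
              exact Or.inr ⟨rfl, by omega⟩
        · simp only [State.setVar_arr]
          rw [k3, k4, Function.update_apply]
          have hI2 := hI'.pred c hc q hq
          by_cases he : c * N + q = a * N + v
          · obtain ⟨rfl, rfl⟩ := (row_inj hq hv).1 he
            rw [if_pos rfl, seg_update_append, hI2]
            simp [List.range_succ, hv']
          · have hle : s''.arr 3 (c * N + q) ≤ N := by
              have := congrArg List.length hI2
              rw [length_seg] at this
              rw [this]
              refine (List.length_filter_le _ _).trans ?_
              rw [List.length_range]
              split_ifs <;> omega
            rw [if_neg he, seg_update_row hle (by omega) he, hI2]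
            rcases lt_trichotomy c a with hc' | rfl | hc'
            · simp [hc']
            · have : q ≠ v := by rintro rfl; exact he rfl
              simp [List.range_succ, hv', this.symm]
            · simp [hc'.ne', not_lt.2 hc'.le]
      have hcell : s''.arr 3 (a * N + v) + 1 ≤ B := by omega
      refine WP.of_lf rfl ?_
      by_cases hin : i < s.var 1
      · rw [if_pos hin] at hvt
        simp [lf, e0, e1, e4, hii, hnum, e0', ← hvt]
        refine ⟨fun _ => ⟨by omega, by omega, by omega, fun _ => ?_⟩, by omega⟩
        exact main _ (by simp [hnum]) (by simp) (by simp) (by simp)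
      -- The remaining state is the sink, which has no row in the input table and is its own
      -- successor.
      · rw [if_neg hin] at hvt
        simp [lf, e0, e1, e4, hii, hnum, ← hvt]
        refine ⟨by omega, fun _ => ⟨by omega, by omega, by omega, fun _ => ?_⟩⟩
        exact main _ (by simp [hnum]) (by simp) (by simp) (by simp)
    · rintro t s'' hF' ⟨⟨k0, k1, k2⟩, -, ht⟩ -
      refine ⟨by simp at ht; omega, by simp [k0], fun c hc x hx hh => ?_, fun c hc q hq => ?_⟩
      · exact k1 c hc x hx (by omega)
      · have := k2 c hc q hq
        simp only [State.setVar_arr]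
        rw [this]
        congr 2
        split_ifs <;> omega
  · rintro t s' hF ⟨⟨k0, k1, k2⟩, -, ht⟩
    simp at ht
    refine ⟨?_, by simp [hF.var 0 rfl, hb], k0, fun e he => ?_, fun a ha q hq => ?_⟩
    · simp
      nlinarith
    · have h1 := Nat.div_add_mod' e N
      have h2 : e % N < N := Nat.mod_lt _ (by omega)
      have h3 : e / N < b := Nat.div_lt_of_lt_mul (by rwa [mul_comm])
      rw [← h1]
      exact k1 _ h3 _ h2 (Or.inl h3)
    · rw [k2 a ha q hq, if_pos ha]; rfl

theorem MarkInv.congr {ml : List ℕ} {s s' : State} (h : MarkInv N ml s)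
    (e5 : s'.arr 5 = s.arr 5) (e12 : s'.arr 12 = s.arr 12) (e13 : s'.arr 13 = s.arr 13)
    (e14 : s'.arr 14 = s.arr 14) (v14 : s'.var 14 = s.var 14) : MarkInv N ml s' := by
  obtain ⟨h1, h2, h3⟩ := h
  exact ⟨by rwa [e5, e12, e13], by rwa [e14, v14], by rwa [e5, e14, v14]⟩

theorem SplitSteps.congr {X Y : ℕ → Prop} {c c' : Conf} (hXY : ∀ q < N, X q ↔ Y q)
    (h : Relation.ReflTransGen (SplitStep N X) c c') :
    Relation.ReflTransGen (SplitStep N Y) c c' := by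
  refine Relation.ReflTransGen.mono ?_ _ _ h
  rintro c c' ⟨d, ⟨q1, h1, h1d, h1X⟩, ⟨q2, h2, h2d, h2X⟩, h3, h4, h5⟩
  exact ⟨d, ⟨q1, h1, h1d, (hXY _ h1).1 h1X⟩, ⟨q2, h2, h2d, fun h => h2X ((hXY _ h2).2 h)⟩, h3,
    fun q hq => by rw [← hXY q hq]; exact h4 q hq, h5⟩

theorem initBlocks_spec (hP : Params b N B tr) {s : State} (hs : s.var 3 = N)
    (h5 : ∀ i, s.arr 5 i = 0) (h8 : ∀ i, s.arr 8 i = 0) (h9 : ∀ i, s.arr 9 i = 0)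
    (h10 : s.arr 10 0 = 0)    (h13 : ∀ i, s.arr 13 i = 0) (v14 : s.var 14 = 0) :
    WP B initBlocks s fun t s' => t ≤ 1000 * N ∧ HopInv N s' ∧ MarkInv N [] s' ∧
      Relation.ReflTransGen (SplitStep N (s.arr 1 · ≠ 0))
        ⟨fun _ => 0, Function.update (fun _ => 0) 0 1, 1⟩ s'.conf ∧
      Separated N (s.arr 1 · ≠ 0) (s'.arr 5) := by
  obtain ⟨g1, g2, g3, g4⟩ := hP.le_bound
  have h2N := hP.two_le_N
  refine WP.seq ((WP.for (fun j s' => ∀ x < j, s'.arr 6 x = x ∧ s'.arr 7 x = x) N (fun _ => 20) rfl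
    rfl (by omega) (by simp) (fun j s' _ _ hF _ => by simp [hF.var 3 rfl, hs]) ?_).mono ?_)
  · intro j s' hj h hF hij
    refine WP.of_lf rfl ?_
    simp [lf, hij]
    refine ⟨by omega, fun _ x hx => ?_⟩
    simp only [Function.update_apply]
    split_ifs with hxj
    · exact ⟨hxj.symm, hxj.symm⟩
    · exact h x (by omega)
  rintro t1 s1 hF1 ⟨hI, -, ht1⟩
  simp at ht1
  refine WP.seq (WP.of_lf rfl ?_)
  simp only [lf, eval_const, eval_var, hF1.var 3 rfl, hs]
  refine ⟨by omega, WP.seq (WP.of_lf rfl ⟨by simp; omega, WP.seq (WP.of_lf rfl ⟨by simp; omega,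
    WP.seq (WP.of_lf rfl ⟨by simp; omega, ?_⟩)⟩)⟩)⟩
  simp only [eval_const, cost_const, cost_var]
  obtain ⟨s2, hs2⟩ : ∃ s2, s2 = (((s1.setCell 8 0 N).setVar 12 1).setCell 9 0 1).setVar 13 1 :=
    ⟨_, rfl⟩
  rw [← hs2]
  have a5 : s2.arr 5 = fun _ => 0 := by
    rw [hs2]; simp [hF1.arr 5 rfl]; exact funext h5
  have a8 : s2.arr 8 = Function.update (fun _ => 0) 0 N := by
    rw [hs2]; simp [hF1.arr 8 rfl]; congr 1; exact funext h8
  have a9 : s2.arr 9 = Function.update (fun _ => 0) 0 1 := by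
    rw [hs2]; simp [hF1.arr 9 rfl]; congr 1; exact funext h9
  have a13 : s2.arr 13 = fun _ => 0 := by
    rw [hs2]; simp [hF1.arr 13 rfl]; exact funext h13
  have a1 : s2.arr 1 = s.arr 1 := by rw [hs2]; simp [hF1.arr 1 rfl]
  have w3 : s2.var 3 = N := by rw [hs2]; simp [hF1.var 3 rfl, hs]
  have w12 : s2.var 12 = 1 := by rw [hs2]; simp
  have w13 : s2.var 13 = 1 := by rw [hs2]; simp
  have w14 : s2.var 14 = 0 := by rw [hs2]; simp [hF1.var 14 rfl, v14]
  have a6 : ∀ x < N, s2.arr 6 x = x := by rw [hs2]; simpa using fun x hx => (hI x hx).1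
  have a7 : ∀ x < N, s2.arr 7 x = x := by rw [hs2]; simpa using fun x hx => (hI x hx).2
  have conf2 : s2.conf = ⟨fun _ => 0, Function.update (fun _ => 0) 0 1, 1⟩ := by
    rw [State.conf, a5, a9, w12]
  have hop2 : HopInv N s2 := by
    have hpart : s2.part N := by
      constructor
      · intro q hq; rw [a5, a8, a7 q hq]; simpa using hq
      · intro q hq; rw [a5, a7 q hq]; simpa using a6 q hq
      · intro c i hi
        rw [a8, Function.update_apply] at hi
        split_ifs at hi with hc
        · subst hc
          simp only [zero_mul, zero_add]
          rw [a6 i hi, a7 i hi, a5]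
          exact ⟨hi, rfl, rfl⟩
        · omega
    have hseg : seg (s2.arr 10) 0 (s2.var 13) = [s2.arr 10 0] := by rw [w13]; rfl
    -- The stack of pending blocks is never written here: memory is initially zero, and 0 is the
    -- name of the only block.
    have h10' : s2.arr 10 0 = 0 := by rw [hs2]; simpa [hF1.arr 10 rfl] using h10
    refine ⟨hpart, ?_, by rw [hseg]; simp, ?_⟩
    · rw [conf2]
      refine ⟨fun q hq => by simp, fun d hd => ⟨0, by omega, ?_⟩, fun d hd => ?_⟩
      · simp at hd ⊢; omega
      · simp [Function.update_apply] at hd; simp [hd]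
    · intro d
      rw [hseg, h10', a9, List.mem_singleton, Function.update_apply]
      split_ifs with hd <;> simp [hd]
  have mark2 : MarkInv N [] s2 := ⟨by simp [a13], by simp [w14], by simp [w14]⟩
  obtain ⟨ml, hml⟩ : ∃ ml : ℕ → List ℕ, ∀ j, ml j = (List.range j).filter fun x => s.arr 1 x ≠ 0 :=
    ⟨_, fun _ => rfl⟩
  have hmls : ∀ j, ml (j + 1) = ml j ++ if s.arr 1 j ≠ 0 then [j] else [] := by
    intro j
    rw [hml, hml, List.range_succ, List.filter_append, List.filter_singleton]
    simp
  have hmlm : ∀ j x, x ∈ ml j ↔ x < j ∧ s.arr 1 x ≠ 0 := by intro j x; rw [hml]; simp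
  refine WP.seq ((WP.for (fun j s' => MarkInv N (ml j) s') N (fun _ => 60) rfl rfl (by omega)
    ?_ (fun j s' _ _ hF _ => by simp [hF.var 3 rfl, w3]) ?_).mono ?_)
  · rw [hml]; exact mark2.congr rfl rfl rfl rfl rfl
  · intro j s' hj h hF hij
    have c1 : s'.arr 1 = s.arr 1 := by rw [hF.arr 1 rfl, a1]
    have c5 : s'.arr 5 = fun _ => 0 := by rw [hF.arr 5 rfl, a5]
    refine WP.cond rfl (fun h0 => ?_) (fun h0 => ?_)
    · simp only [eval_cell, eval_var, hij, c1] at h0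
      refine WP.seq (WP.of_lf rfl ?_)
      simp only [lf, eval_var, hij]
      refine ⟨by omega, (mark_spec hP (s := s'.setVar 7 j) (ml := ml j) (p := j) (by simp [hF.var 3 rfl, w3])
        (h.congr rfl rfl rfl rfl rfl) ?_ (by simp) hj (by simp [c5])).mono ?_⟩
      · rw [hml]
        exact (List.length_filter_le _ _).trans_lt (by simpa using hj)
      · rintro t s'' - ⟨k1, k2⟩ -
        refine ⟨by simp; omega, ?_⟩
        rw [hmls, if_pos h0]
        exact k2.congr rfl rfl rfl rfl rfl
    · simp only [eval_cell, eval_var, hij, c1] at h0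
      refine WP.of_lf rfl fun _ => ⟨by simp, ?_⟩
      rw [hmls, if_neg (by simpa using h0), List.append_nil]
      exact h.congr rfl rfl rfl rfl rfl
  · rintro t2 s3 hF2 ⟨hm, -, ht2⟩
    simp at ht2
    have hX : ∀ q < N, q ∈ ml N ↔ s.arr 1 q ≠ 0 := fun q hq => by rw [hmlm]; simp [hq]
    have hlen : (ml N).length ≤ N := by
      rw [hml]; exact (List.length_filter_le _ _).trans (by simp)
    have hop3 : HopInv N s3 := hop2.congr (hF2.arr 5 rfl) (hF2.arr 6 rfl) (hF2.arr 7 rfl)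
      (hF2.arr 8 rfl) (hF2.arr 9 rfl) (hF2.arr 10 rfl) (hF2.var 12 rfl) (hF2.var 13 rfl)
    have conf3 : s3.conf = s2.conf := by
      rw [State.conf, hF2.arr 5 rfl, hF2.arr 9 rfl, hF2.var 12 rfl]; rfl
    refine (split_spec hP (by rw [hF2.var 3 rfl, w3]) hop3 hm ?_ fun x hx =>
      ((hmlm _ _).1 hx).1).mono ?_
    · rw [hml]; exact List.nodup_range.filter _
    · rintro t s4 - ⟨k1, k2, k3, k4, k5⟩
      refine ⟨by omega, k2, k3, ?_, ?_⟩
      · rw [← conf2, ← conf3]; exact SplitSteps.congr hX k4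
      · intro p hp q hq e h1
        exact (hX q hq).1 (k5 p hp q hq e ((hX p hp).2 h1))

end RAM

/-! ### One splitter: marking predecessors and taking pending blocks. -/

namespace RAM
open RAM.Expr RAM.Program

variable {b N B : ℕ} {tr : ℕ → ℕ}

/-- A state has only one successor by `a`, so the preimages of distinct states are disjoint and no
state is marked twice. -/
theorem nodup_flatMap_preds {T : List ℕ} (hT : T.Nodup) (a : ℕ) :
    (T.flatMap (preds N tr a)).Nodup := by
  rw [List.nodup_flatMap]
  refine ⟨fun _ _ => nodup_preds, hT.imp fun hne => ?_⟩
  rw [Function.onFun, List.disjoint_left]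
  intro x hx hy
  exact hne ((mem_preds.1 hx).2.symm.trans (mem_preds.1 hy).2)

/-- The cost counts the members of `T` and the transitions into `T`. The splitter is read from a
separate copy because the block it came from may itself be split in the round. -/
theorem splitLetter_spec (hP : Params b N B tr) {s : State} (hs : Static b N tr s)
    (h : HopInv N s) (hm : MarkInv N [] s) {a : ℕ} (ha : s.var 4 = a) (hab : a < b) {T : List ℕ}
    (hT : seg (s.arr 11) 0 (s.var 16) = T) (hTn : T.Nodup) (hTN : ∀ q ∈ T, q < N) :
    WP B splitLetter s fun t s' =>
      t ≤ 150 * T.length + 650 * (T.map fun q => (preds N tr a q).length).sum + 150 ∧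
      HopInv N s' ∧ MarkInv N [] s' ∧
      Relation.ReflTransGen (SplitStep N fun x => tr (a * N + x) ∈ T) s.conf s'.conf ∧
      Separated N (fun x => tr (a * N + x) ∈ T) (s'.arr 5) := by
  obtain ⟨g1, g2, g3, g4⟩ := hP.le_bound
  have hlT : T.length = s.var 16 := by rw [← hT, length_seg]
  have hlN := hTn.length_le_of_lt hTN
  have hfl : ∀ m : List ℕ, m.Nodup → (∀ x ∈ m, x < N) → m.length ≤ N :=
    fun m h1 h2 => h1.length_le_of_lt h2
  have hflN : ∀ T : List ℕ, ∀ x ∈ T.flatMap (preds N tr a), x < N := by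
    intro T x hx
    obtain ⟨q, -, hq⟩ := List.mem_flatMap.1 hx
    exact (mem_preds.1 hq).1
  have hclsN : ∀ p < N, s.arr 5 p ≤ N := fun p hp => ((h.wf.lt p hp).trans_le h.wf.nb_le).le
  refine WP.seq ((WP.for (fun i s' => MarkInv N ((T.take i).flatMap (preds N tr a)) s')
    (s.var 16) (fun i => 100 * (preds N tr a (s.arr 11 (0 + i))).length + 100) rfl rfl (by omega)
    (by rw [List.take_zero, List.flatMap_nil]; exact hm.congr rfl rfl rfl rfl rfl)
    (fun j s' _ _ hF _ => by simp [hF.var 16 rfl]) ?_).mono ?_)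
  · intro i s' hi hI hF hii
    obtain ⟨q, hq⟩ : ∃ q, s.arr 11 (0 + i) = q := ⟨_, rfl⟩
    have hq' : s.arr 11 i = q := by rw [← hq, zero_add]
    have hqT : q ∈ T := hq ▸ mem_of_seg_eq hT hi
    have hqN := hTN q hqT
    have ht : T.take (i + 1) = T.take i ++ [q] := hq ▸ take_succ_of_seg_eq hT hi
    have hst := hs.of_frame hF
    have e4 : s'.var 4 = a := (hF.var 4 rfl).trans ha
    have hnd := nodup_flatMap_preds (N := N) (tr := tr) ((List.take_sublist (i + 1) T).nodup hTn) a
    rw [ht, List.flatMap_append, List.flatMap_singleton] at hnd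
    have hndl : ∀ j, ((T.take i).flatMap (preds N tr a) ++ (preds N tr a q).take j).Nodup :=
      fun j => (List.Sublist.append_left (List.take_sublist j _) _).nodup hnd
    have hpl : (preds N tr a q).length ≤ N := length_preds_le
    refine WP.seq (WP.of_lf rfl ?_)
    simp only [lf, eval_cell, eval_var, hF.arr 11 rfl, hii, hq']
    refine ⟨by omega, (WP.for (fun j s'' => MarkInv N ((T.take i).flatMap (preds N tr a) ++
      (preds N tr a q).take j) s'') (preds N tr a q).length (fun _ => 60) rfl rfl (by omega)
      (by rw [List.take_zero, List.append_nil]; exact hI.congr rfl rfl rfl rfl rfl)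
      (fun j s'' _ _ hF' _ => ?_) ?_).mono ?_⟩
    · simp [hF'.arr 3 rfl, hF'.var 4 rfl, hF'.var 3 rfl, hF'.var 5 rfl, e4, hst.num,
        hst.cnt hab hqN]
    · intro j s'' hj hI' hF' hjj
      have hpr := hst.pred a hab q hqN
      rw [hst.cnt hab hqN] at hpr
      have hp := mem_of_seg_eq hpr hj
      have htj := take_succ_of_seg_eq hpr hj
      generalize hpp : s'.arr 4 ((a * N + q) * N + j) = p at hp htj
      have hpN := (mem_preds.1 hp).1
      have hnext := hndl (j + 1)
      rw [htj, ← List.append_assoc] at hnext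
      have hlen := hfl _ hnext (by
        intro x hx
        rw [List.mem_append, List.mem_append, List.mem_singleton] at hx
        rcases hx with (hx | hx) | rfl
        · exact hflN _ _ hx
        · exact (mem_preds.1 (List.mem_of_mem_take hx)).1
        · exact hpN)
      rw [List.length_append, List.length_singleton] at hlen
      refine WP.seq (WP.of_lf rfl ?_)
      simp [lf, hF'.arr 4 rfl, hF'.var 4 rfl, hF'.var 3 rfl, hF'.var 5 rfl, e4, hst.num, hjj, hpp]
      refine ⟨by omega, (mark_spec hP (s := s''.setVar 7 p)
        (by simp [hF'.var 3 rfl, hst.num]) (hI'.congr rfl rfl rfl rfl rfl) (by omega)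
        (by simp) hpN (by simp [hF'.arr 5 rfl, hF.arr 5 rfl, hclsN p hpN])).mono ?_⟩
      rintro t s3 - ⟨k1, k2⟩ -
      refine ⟨by omega, ?_⟩
      rw [htj, ← List.append_assoc]
      exact k2.congr rfl rfl rfl rfl rfl
    · rintro t s'' hF' ⟨hI', -, ht'⟩ -
      rw [List.take_length] at hI'
      refine ⟨?_, ?_⟩
      · simp at ht'
        rw [hq]
        simp
        omega
      · rw [ht, List.flatMap_append, List.flatMap_singleton]
        exact hI'.congr rfl rfl rfl rfl rfl
  · rintro t s' hF ⟨hI, -, ht⟩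
    rw [← hlT, List.take_length] at hI
    have hX : ∀ q < N, q ∈ T.flatMap (preds N tr a) ↔ tr (a * N + q) ∈ T := by
      intro q hq
      rw [List.mem_flatMap]
      constructor
      · rintro ⟨r, hr, hqr⟩; rw [(mem_preds.1 hqr).2]; exact hr
      · intro hh; exact ⟨_, hh, mem_preds.2 ⟨hq, rfl⟩⟩
    have hlen : (T.flatMap (preds N tr a)).length =
        (T.map fun q => (preds N tr a q).length).sum := by rw [List.length_flatMap]
    refine (split_spec hP (by rw [hF.var 3 rfl, hs.num])
      (h.congr (hF.arr 5 rfl) (hF.arr 6 rfl) (hF.arr 7 rfl)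
      (hF.arr 8 rfl) (hF.arr 9 rfl) (hF.arr 10 rfl) (hF.var 12 rfl) (hF.var 13 rfl)) hI
      (nodup_flatMap_preds hTn a) (hflN T)).mono ?_
    rintro t' s'' - ⟨k1, k2, k3, k4, k5⟩
    have conf3 : s'.conf = s.conf := by
      rw [State.conf, hF.arr 5 rfl, hF.arr 9 rfl, hF.var 12 rfl]; rfl
    refine ⟨?_, k2, k3, ?_, ?_⟩
    · rw [Finset.sum_add_distrib, Finset.sum_add_distrib, ← Finset.mul_sum,
        sum_of_seg_eq (w := fun q => (preds N tr a q).length) hT] at ht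
      simp only [Finset.sum_const, Finset.card_range, smul_eq_mul] at ht
      omega
    · rw [← conf3]; exact SplitSteps.congr hX k4
    · intro p hp q hq e h1
      exact (hX q hq).1 (k5 p hp q hq e ((hX p hp).2 h1))

theorem popBlock_spec (hP : Params b N B tr) {s : State} (hs : s.var 3 = N)
    (h : HopInv N s) (h0 : s.var 13 ≠ 0) :
    WP B popBlock s fun t s' => ∃ d, s.arr 9 d ≠ 0 ∧ t ≤ 60 * s.arr 8 d + 80 ∧
      HopInv N s' ∧ s'.conf = ⟨s.arr 5, Function.update (s.arr 9) d 0, s.var 12⟩ ∧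
      seg (s'.arr 11) 0 (s'.var 16) = seg (s.arr 6) (d * N) (s.arr 8 d) := by
  obtain ⟨g1, g2, g3, g4⟩ := hP.le_bound
  obtain ⟨m, hm⟩ : ∃ m, s.var 13 = m + 1 := ⟨s.var 13 - 1, by omega⟩
  have hst := h.stack_le
  obtain ⟨d, hd⟩ : ∃ d, s.arr 10 m = d := ⟨_, rfl⟩
  have hseg := h.mem
  have hnd := h.nodup
  rw [hm, seg_succ, zero_add, hd] at hseg hnd
  rw [List.nodup_append] at hnd
  have hpd : s.arr 9 d ≠ 0 := (hseg d).1 (by simp)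
  have hdnb := h.wf.pend_lt d hpd
  have hnb := h.wf.nb_le
  have hsz := h.part.size_le d
  have hmemN : ∀ i < s.arr 8 d, s.arr 6 (d * N + i) < N := fun i hi => (h.part.mem_lt d i hi).1
  refine WP.seq (WP.of_lf rfl ⟨by simp; omega, WP.seq (WP.of_lf rfl ⟨by simp [hm, hd]; omega,
    WP.seq (WP.of_lf rfl ⟨by simp, WP.seq (WP.of_lf rfl ⟨by simp [hm, hd]; omega, ?_⟩)⟩)⟩)⟩)
  simp only [eval_sub, eval_var, eval_const, eval_cell, hm, Nat.add_sub_cancel, State.setVar_arr,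
    State.setVar_var, if_true, hd, State.setCell_arr, State.setCell_var, cost_sub, cost_var,
    cost_const, cost_cell, Nat.reduceEqDiff, if_false]
  refine (WP.for (fun i s' => ∀ j < i, s'.arr 11 j = s.arr 6 (d * N + j)) (s.arr 8 d)
    (fun _ => 20) rfl rfl (by omega) (by simp)
    (fun j s' _ _ hF _ => by simp [hF.var 16 rfl]) ?_).mono ?_
  · intro i s' hi hI hF hii
    refine WP.of_lf rfl ?_
    simp [lf, hii, hF.arr 6 rfl, hF.var 8 rfl, hF.var 3 rfl, hs]
    have := hmemN i hi
    refine ⟨by omega, fun _ j hj => ?_⟩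
    rw [Function.update_apply]
    split_ifs with hji
    · rw [hji]
    · exact hI j (by omega)
  · rintro t s' hF ⟨hI, -, ht⟩
    simp at ht
    have e5 : s'.arr 5 = s.arr 5 := by simp [hF.arr 5 rfl]
    have e9 : s'.arr 9 = Function.update (s.arr 9) d 0 := by simp [hF.arr 9 rfl]
    have e12 : s'.var 12 = s.var 12 := by simp [hF.var 12 rfl]
    have e13 : s'.var 13 = m := by simp [hF.var 13 rfl]
    refine ⟨d, hpd, by omega, ⟨?_, ⟨?_, ?_, ?_⟩, ?_, ?_⟩, ?_, ?_⟩
    · have := h.part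
      simpa [State.part, hF.arr 5 rfl, hF.arr 6 rfl, hF.arr 7 rfl, hF.arr 8 rfl] using this
    · intro q hq; have := h.wf.lt q hq; simpa [State.conf, e5, e12] using this
    · intro q hq; have := h.wf.surj q (by simpa [State.conf, e12] using hq)
      simpa [State.conf, e5] using this
    · intro q hq
      simp only [State.conf, e9, e12, Function.update_apply] at hq ⊢
      split_ifs at hq
      · exact absurd rfl hq
      · exact h.wf.pend_lt q hq
    · rw [e13, hF.arr 10 rfl]; simpa using hnd.1
    · intro c
      rw [e13, hF.arr 10 rfl, e9, Function.update_apply]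
      simp
      have h1 := hseg c
      rw [List.mem_append, List.mem_singleton] at h1
      constructor
      · intro hc
        exact ⟨fun e => hnd.2.2 c hc d (by simp) e, h1.1 (Or.inl hc)⟩
      · rintro ⟨hc1, hc2⟩
        exact (h1.2 hc2).resolve_right hc1
    · rw [State.conf, e5, e9, e12]
    · rw [hF.var 16 rfl]
      simp only [State.setVar_var, if_true]
      exact List.map_congr_left fun i hi => by
        rw [zero_add]; exact hI i (List.mem_range.1 hi)

end RAM

/-! ### Correctness and cost of Hopcroft's algorithm. -/

namespace RAM
open RAM.Expr RAM.Program

variable {b N B : ℕ} {tr : ℕ → ℕ}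

/-- The number of letters plus the number of transitions to `q`. -/
def weight (b N : ℕ) (tr : ℕ → ℕ) (q : ℕ) : ℕ :=
  b + ∑ a ∈ Finset.range b, (preds N tr a q).length

theorem sum_weight (hP : Params b N B tr) :
    ∑ q ∈ Finset.range N, weight b N tr q = 2 * (b * N) := by
  unfold weight
  rw [Finset.sum_add_distrib, Finset.sum_comm,
    Finset.sum_congr rfl fun a ha => sum_length_preds fun x hx =>
      hP.tr_lt' (Finset.mem_range.1 ha) hx]
  simp
  ring

/-- The invariant of Hopcroft's algorithm. -/
structure RefineInv (b N : ℕ) (tr : ℕ → ℕ) (acc : ℕ → ℕ) (E : ℕ → ℕ → Prop) (T : ℕ → Prop)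
    (s : State) : Prop where
  hop : HopInv N s
  mark : MarkInv N [] s
  stable : Stable b N tr T s.conf
  sound : ∀ p < N, ∀ q < N, E p q → s.arr 5 p = s.arr 5 q
  sep : Separated N (acc · ≠ 0) (s.arr 5)

/-- Every splitting set is the preimage of a union of `E`-classes, so `E` is never broken;
conversely, stability with nothing pending makes the final partition a congruence that respects
acceptance. Applied to the Nerode equivalence, this identifies the partition. -/
theorem refine_spec (hP : Params b N B tr) {s : State} (hs : Static b N tr s)
    (h5 : ∀ i, s.arr 5 i = 0) (h8 : ∀ i, s.arr 8 i = 0) (h9 : ∀ i, s.arr 9 i = 0)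
    (h10 : s.arr 10 0 = 0) (h13 : ∀ i, s.arr 13 i = 0) (v14 : s.var 14 = 0) {E : ℕ → ℕ → Prop}
    (hEacc : ∀ p < N, ∀ q < N, E p q → (s.arr 1 p ≠ 0 ↔ s.arr 1 q ≠ 0))
    (hEtr : ∀ p < N, ∀ q < N, E p q → ∀ a < b, E (tr (a * N + p)) (tr (a * N + q))) :
    WP B refine s fun t s' => t ≤ 4000 * (b * N * (Nat.log 2 N + 1)) ∧ HopInv N s' ∧
      (∀ p < N, ∀ q < N, E p q → s'.arr 5 p = s'.arr 5 q) ∧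
      ∀ p < N, ∀ q < N, s'.arr 5 p = s'.arr 5 q → (s.arr 1 p ≠ 0 ↔ s.arr 1 q ≠ 0) ∧
        ∀ a < b, s'.arr 5 (tr (a * N + p)) = s'.arr 5 (tr (a * N + q)) := by
  obtain ⟨g1, g2, g3, g4⟩ := hP.le_bound
  have h2N := hP.two_le_N
  have h2b := hP.two_le_b
  have ht' : ∀ a < b, ∀ x < N, tr (a * N + x) < N := fun a ha x hx => hP.tr_lt' ha hx
  refine WP.seq ((initBlocks_spec hP hs.num h5 h8 h9 h10 h13 v14).mono ?_)
  rintro t1 s1 hF1 ⟨ht1, hop1, mark1, steps1, sep1⟩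
  obtain ⟨c0, hc0⟩ : ∃ c0 : Conf, c0 = ⟨fun _ => 0, Function.update (fun _ => 0) 0 1, 1⟩ := ⟨_, rfl⟩
  rw [← hc0] at steps1
  have wf0 : c0.WF N := by
    rw [hc0]
    refine ⟨fun q hq => by simp, fun d hd => ⟨0, by omega, ?_⟩, fun d hd => ?_⟩
    · simp at hd ⊢; omega
    · simp [Function.update_apply] at hd; simp [hd]
  have stable0 : Stable b N tr (fun _ => False) c0 := by
    intro p _ q _ _ a _ hne
    rw [hc0] at hne
    exact absurd rfl hne
  -- All states lie in one pending block of size N, and the weights add up to 2 * (b * N).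
  have pot0 : hopPot N (weight b N tr) c0 = 2 * (b * N) * (Nat.log 2 N + 1) := by
    rw [← sum_weight hP, hopPot, Finset.sum_mul, hc0]
    refine Finset.sum_congr rfl fun q _ => ?_
    simp [blockCard]
  have inv1 : RefineInv b N tr (s.arr 1) E (fun _ => False) s1 :=
    ⟨hop1, mark1, SplitSteps.stable steps1 wf0 ht' stable0,
      SplitSteps.sound steps1 hEacc (by rw [hc0]; simp), sep1⟩
  have pot1 := SplitSteps.pot_le steps1 wf0 (weight b N tr)
  have hs1 := hs.of_frame hF1
  -- The remaining time is a multiple of the potential; 1200 steps per unit of weight cover a whole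
  -- round.
  refine (WP.while (fun p s' => RefineInv b N tr (s.arr 1) E (fun _ => False) s' ∧
    p = 1200 * hopPot N (weight b N tr) s'.conf) _ rfl ⟨inv1, rfl⟩ ?_).mono ?_
  · rintro p s2 ⟨⟨hop2, mark2, st2, sd2, sp2⟩, rfl⟩ hF2 h0
    have hs2 := hs1.of_frame hF2
    refine WP.seq ((popBlock_spec hP hs2.num hop2 h0).mono ?_)
    rintro t3 s3 hF3 ⟨d, hd, ht3, hop3, conf3, hT⟩
    have hs3 := hs2.of_frame hF3
    have c5 : s3.arr 5 = s2.arr 5 := hF3.arr 5 rfl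
    have mark3 : MarkInv N [] s3 := mark2.congr c5 (hF3.arr 12 rfl) (hF3.arr 13 rfl)
      (hF3.arr 14 rfl) (hF3.var 14 rfl)
    obtain ⟨T, hTT⟩ : ∃ T, seg (s2.arr 6) (d * N) (s2.arr 8 d) = T := ⟨_, rfl⟩
    have hTn : T.Nodup := hTT ▸ hop2.part.nodup_seg d
    have hTm : ∀ q, q ∈ T ↔ q < N ∧ s2.arr 5 q = d := fun q => by
      rw [← hTT, hop2.part.mem_seg_iff]
    have hTl : T.length = s2.arr 8 d := by rw [← hTT, length_seg]
    rw [hTT] at hT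
    have hTl' : T.length = s3.var 16 := by rw [← hT, length_seg]
    have st3 : Stable b N tr (fun x => s2.arr 5 x = d) s3.conf := by
      rw [conf3]; exact Stable.pop (c := s2.conf) st2
    have pop3 := hopPot_pop (N := N) (c := s2.conf) (weight b N tr) hd
    have hsumT : ∑ q ∈ (Finset.range N).filter (fun q => s2.conf.cls q = d), weight b N tr q =
        (T.map (weight b N tr)).sum := by
      rw [← List.sum_toFinset _ hTn]
      refine Finset.sum_congr ?_ fun _ _ => rfl
      ext q
      rw [List.mem_toFinset, hTm, Finset.mem_filter, Finset.mem_range]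
      exact Iff.rfl
    rw [hsumT] at pop3
    change hopPot N (weight b N tr) ⟨s2.arr 5, Function.update (s2.arr 9) d 0, s2.var 12⟩ + _ = _
      at pop3
    rw [← conf3] at pop3
    obtain ⟨q0, hq0, hq0d⟩ := hop2.wf.surj d (hop2.wf.pend_lt d hd)
    have hT1 : 1 ≤ T.length := List.length_pos_of_mem ((hTm q0).2 ⟨hq0, hq0d⟩)
    have hXE : ∀ a < b, ∀ p < N, ∀ q < N, E p q → (tr (a * N + p) ∈ T ↔ tr (a * N + q) ∈ T) := by
      intro a ha p hp q hq e
      rw [hTm, hTm, sd2 _ (ht' a ha p hp) _ (ht' a ha q hq) (hEtr p hp q hq e a ha)]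
      exact and_congr_left fun _ => iff_of_true (ht' a ha p hp) (ht' a ha q hq)
    refine (WP.for (fun a s' => RefineInv b N tr (s.arr 1) E (fun x => s2.arr 5 x = d) s' ∧
      hopPot N (weight b N tr) s'.conf ≤ hopPot N (weight b N tr) s3.conf ∧
      ∀ c < a, Separated N (fun x => tr (c * N + x) ∈ T) (s'.arr 5)) b
      (fun a => 150 * T.length + 650 * (T.map fun q => (preds N tr a q).length).sum + 150) rfl rfl
      (by omega) ⟨⟨hop3.congr rfl rfl rfl rfl rfl rfl rfl rfl, mark3.congr rfl rfl rfl rfl rfl,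
        st3, by rw [State.setVar_arr, c5]; exact sd2, by rw [State.setVar_arr, c5]; exact sp2⟩,
        le_rfl, by simp⟩
      (fun j s' _ _ hF _ => by simp [hF.var 0 rfl, hs3.base]) ?_).mono ?_
    · rintro a s4 ha ⟨⟨hop4, mark4, st4, sd4, sp4⟩, pot4, all4⟩ hF4 ha4
      refine (splitLetter_spec hP (T := T) (hs3.of_frame hF4) hop4 mark4 ha4 ha
        (by rw [hF4.arr 11 rfl, hF4.var 16 rfl, hT]) hTn fun q hq => ((hTm q).1 hq).1).mono ?_
      rintro t5 s5 - ⟨ht5, hop5, mark5, steps5, sep5⟩ -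
      refine ⟨ht5, ⟨hop5.congr rfl rfl rfl rfl rfl rfl rfl rfl, mark5.congr rfl rfl rfl rfl rfl,
        SplitSteps.stable steps5 hop4.wf ht' st4, ?_, ?_⟩, ?_, ?_⟩
      · exact SplitSteps.sound steps5 (hXE a ha) sd4
      · exact SplitSteps.separated steps5 hop4.wf sp4
      · exact (SplitSteps.pot_le steps5 hop4.wf _).trans pot4
      · intro c hc
        rcases Nat.lt_succ_iff_lt_or_eq.1 hc with hc | rfl
        · exact SplitSteps.separated steps5 hop4.wf (all4 c hc)
        · exact sep5
    · rintro t4 s4 hF4 ⟨⟨⟨hop4, mark4, st4, sd4, sp4⟩, pot4, all4⟩, -, ht4⟩ hF5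
      refine ⟨_, ⟨⟨hop4, mark4, st4.unsplit ?_, sd4, sp4⟩, rfl⟩, ?_⟩
      · intro a ha p hp q hq e h1
        exact ((hTm _).1 (all4 a ha p hp q hq e
          ((hTm _).2 ⟨ht' a ha p hp, h1⟩))).2
      · have e1 : (T.map (weight b N tr)).sum = b * T.length +
            ∑ a ∈ Finset.range b, (T.map fun q => (preds N tr a q).length).sum := by
          clear * -
          induction T with
          | nil => simp
          | cons q T ih =>
            simp only [List.map_cons, List.sum_cons, ih, weight, List.length_cons,
              Finset.sum_add_distrib]
            ring
        rw [Finset.sum_add_distrib, Finset.sum_add_distrib, Finset.sum_add_distrib] at ht4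
        simp only [Finset.sum_const, Finset.card_range, smul_eq_mul, ← Finset.mul_sum] at ht4
        have e2 : T.length ≤ b * T.length := Nat.le_mul_of_pos_left _ (by omega)
        -- The fixed cost of each letter is charged to the splitter, which is not empty; this is why
        -- the weight contains the summand `b`.
        have e3 : b ≤ b * T.length := Nat.le_mul_of_pos_right _ (by omega)
        have e4 : b * (150 * T.length) = 150 * (b * T.length) := by ring
        simp only [cost_var]
        omega
  · rintro t2 s2 hF2 ⟨p, ⟨⟨hop2, mark2, st2, sd2, sp2⟩, rfl⟩, h0, ht2⟩
    have nop : ∀ d, s2.arr 9 d = 0 := by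
      intro d
      by_contra hd
      have := (hop2.mem d).2 hd
      rw [eval_var] at h0
      rw [h0] at this
      simp at this
    refine ⟨?_, hop2, sd2, fun p hp q hq e => ⟨⟨sp2 p hp q hq e, sp2 q hq p hp e.symm⟩,
      fun a ha => ?_⟩⟩
    · rw [pot0] at pot1
      simp only [cost_var] at ht2
      have e1 : b * N ≤ b * N * (Nat.log 2 N + 1) := Nat.le_mul_of_pos_right _ (by omega)
      have e2 : 2 * (b * N) * (Nat.log 2 N + 1) = 2 * (b * N * (Nat.log 2 N + 1)) := by ring
      rw [e2] at pot1
      omega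
    · by_contra hne
      rcases st2 p hp q hq e a ha hne with h1 | h1 | h1
      · exact h1 (nop _)
      · exact h1 (nop _)
      · exact h1 Iff.rfl

end RAM

/-! ### Closure: dependents of an element and merging of two classes. -/

namespace RAM
open RAM.Expr RAM.Program

variable {b N B : ℕ} {tr : ℕ → ℕ}

theorem length_flatMap_range (g : ℕ → List ℕ) (m : ℕ) :
    ((List.range m).flatMap g).length = ∑ c ∈ Finset.range m, (g c).length := by
  induction m with
  | zero => rfl
  | succ m ih => simp [List.range_succ, Finset.sum_range_succ, ih]

/-- The cost of renaming the class of the element `z`. -/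
def dep (b N : ℕ) (tr : ℕ → ℕ) (z : ℕ) : ℕ := 1 + if z < N then weight b N tr z else 0

theorem sum_dep (hP : Params b N B tr) :
    ∑ z ∈ Finset.range (b * N), dep b N tr z = 3 * (b * N) := by
  obtain ⟨g1, g2, g3, g4⟩ := hP.le_bound
  unfold dep
  rw [Finset.sum_add_distrib, ← Finset.sum_filter]
  have : (Finset.range (b * N)).filter (fun z => z < N) = Finset.range N := by
    ext z
    simp only [Finset.mem_filter, Finset.mem_range]
    omega
  rw [this, sum_weight hP]
  simp
  ring

/-- The items `a * N + x` with `tr (a * N + x) = z`, for `a < m`. -/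
def users (N : ℕ) (tr : ℕ → ℕ) (m z : ℕ) : List ℕ :=
  (List.range m).flatMap fun a => (preds N tr a z).map (a * N + ·)

theorem users_succ {m z : ℕ} :
    users N tr (m + 1) z = users N tr m z ++ (preds N tr m z).map (m * N + ·) := by
  simp [users, List.range_succ]

theorem length_users {m z : ℕ} :
    (users N tr m z).length = ∑ a ∈ Finset.range m, (preds N tr a z).length := by
  rw [users, length_flatMap_range]
  simp

/-- The signature of the item e consists of the classes of e + N and `tr e`. If z < N, only
preimages of z can use it; if N ≤ z, it is never a value of `tr`, and its only user is z - N. One of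
the two branches therefore always suffices. -/
theorem pushDependents_spec (hP : Params b N B tr) {s : State} (hs : Static b N tr s) {z : ℕ}
    (hz : s.var 26 = z) (hzN : z < b * N) (hsp : s.var 19 + dep b N tr z ≤ B) :
    WP B pushDependents s fun t s' => t ≤ 200 * dep b N tr z ∧ ∃ l : List ℕ,
      seg (s'.arr 16) 0 (s'.var 19) = seg (s.arr 16) 0 (s.var 19) ++ l ∧ (∀ e ∈ l, e < b * N) ∧
      l.length ≤ dep b N tr z ∧ ∀ e < b * N, e + N = z ∨ tr e = z → e ∈ l := by
  obtain ⟨g1, g2, g3, g4⟩ := hP.le_bound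
  have h2N := hP.two_le_N
  have happ : ∀ (f : ℕ → ℕ) (l v : ℕ), seg (Function.update f l v) 0 (l + 1) = seg f 0 l ++ [v] :=
    fun f l v => by simpa using seg_update_append (f := f) (o := 0) (l := l) (v := v)
  refine WP.cond rfl (fun h0 => ?_) (fun h0 => ?_)
  · simp only [eval_sub, eval_var, hs.num, hz] at h0
    have hz' : z < N := by omega
    have hdep : dep b N tr z = 1 + (b + (users N tr b z).length) := by
      rw [dep, if_pos hz', weight, length_users]
    have hmono : ∀ {m m'}, m ≤ m' → (users N tr m z).length ≤ (users N tr m' z).length := by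
      intro m m' h
      rw [length_users, length_users]
      exact Finset.sum_le_sum_of_subset (Finset.range_mono h)
    refine (WP.for (fun a s' => seg (s'.arr 16) 0 (s'.var 19) = seg (s.arr 16) 0 (s.var 19) ++
      users N tr a z) b (fun a => 100 * (preds N tr a z).length + 50) rfl rfl (by omega)
      (by simp [users]) (fun j s' _ _ hF _ => by simp [hF.var 0 rfl, hs.base]) ?_).mono ?_
    · intro a s' ha hI hF haa
      have hst := hs.of_frame hF
      have hpl : (preds N tr a z).length ≤ N := length_preds_le
      refine (WP.for (fun j s'' => seg (s''.arr 16) 0 (s''.var 19) = seg (s.arr 16) 0 (s.var 19) ++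
        (users N tr a z ++ ((preds N tr a z).take j).map (a * N + ·))) (preds N tr a z).length
        (fun _ => 60) rfl rfl (by omega)
        (by simpa using hI) (fun j s'' _ _ hF' _ => ?_) ?_).mono ?_
      · simp [hF'.arr 3 rfl, hF'.var 4 rfl, hF'.var 3 rfl, hF'.var 26 rfl, hF.var 26 rfl, hz, haa,
          hst.num, hst.cnt ha hz']
      · intro j s'' hj hI' hF' hjj
        have hpr := hst.pred a ha z hz'
        rw [hst.cnt ha hz'] at hpr
        have hp := mem_of_seg_eq hpr hj
        have htj := take_succ_of_seg_eq hpr hj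
        generalize hpp : s'.arr 4 ((a * N + z) * N + j) = p at hp htj
        have hpN := (mem_preds.1 hp).1
        have haN : a * N + p < b * N := by nlinarith
        have hlen := congrArg List.length hI'
        simp only [length_seg, List.length_append, List.length_map, List.length_take] at hlen
        have h1 := hmono (show a + 1 ≤ b from ha)
        rw [users_succ, List.length_append, List.length_map] at h1
        refine WP.of_lf rfl ?_
        simp [lf, hF'.arr 4 rfl, hF'.var 4 rfl, hF'.var 3 rfl, hF'.var 26 rfl, hF.var 26 rfl, hz,
          haa, hst.num, hjj, hpp]
        refine ⟨by omega, by omega, fun _ => ?_⟩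
        rw [happ, hI', ← List.map_take, htj]
        simp
      · rintro t s'' hF' ⟨hI', -, ht⟩ -
        rw [List.take_length] at hI'
        simp at ht
        exact ⟨by omega, by simpa [users_succ] using hI'⟩
    · rintro t s' hF ⟨hI, -, ht⟩
      rw [Finset.sum_add_distrib, Finset.sum_add_distrib, ← Finset.mul_sum, ← length_users] at ht
      simp at ht
      refine ⟨by simp; omega, users N tr b z, hI, ?_, by omega, ?_⟩
      · intro e he
        obtain ⟨a, ha, he⟩ := List.mem_flatMap.1 he
        obtain ⟨x, hx, rfl⟩ := List.mem_map.1 he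
        have := (mem_preds.1 hx).1
        have := List.mem_range.1 ha
        nlinarith
      · intro e he hh
        have h1 := Nat.div_add_mod' e N
        have h2 : e % N < N := Nat.mod_lt _ (by omega)
        have h3 : e / N < b := Nat.div_lt_of_lt_mul (by rwa [mul_comm])
        refine List.mem_flatMap.2 ⟨e / N, List.mem_range.2 h3, List.mem_map.2 ⟨e % N,
          mem_preds.2 ⟨h2, ?_⟩, h1⟩⟩
        rw [h1]
        omega
  · simp only [eval_sub, eval_var, hs.num, hz] at h0
    have hdep : dep b N tr z = 1 := by rw [dep, if_neg (by omega)]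
    refine WP.of_lf rfl ?_
    simp [lf, hs.num, hz]
    refine ⟨by omega, by omega, by omega, [z - N], by rw [happ], by simp; omega, by simp [hdep], ?_⟩
    intro e he hh
    have := hP.tr_lt e he
    simp
    omega

/-- The sum of the costs of renaming the elements of a list. -/
abbrev depSum (b N : ℕ) (tr : ℕ → ℕ) (L : List ℕ) : ℕ := (L.map (dep b N tr)).sum

theorem depSum_take_le {L : List ℕ} (j : ℕ) : depSum b N tr (L.take j) ≤ depSum b N tr L :=
  ((List.take_sublist j L).map _).sum_le_sum fun _ _ => Nat.zero_le _

/-- The hypothesis `hN` keeps the extended list of `d` inside its row of length N, so no other row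
is overwritten. -/
theorem mergeInto_spec (hP : Params b N B tr) {s : State} (hs : Static b N tr s) {c d : ℕ}
    (hc : s.var 23 = c) (hd : s.var 24 = d) (hcd : c ≠ d) (hdB : d < b * N) {Lc Ld : List ℕ}
    (hLc : seg (s.arr 6) (c * N) (s.arr 8 c) = Lc) (hLd : seg (s.arr 6) (d * N) (s.arr 8 d) = Ld)
    (hLcB : ∀ z ∈ Lc, z < b * N) (hN : Lc.length + Ld.length ≤ N)
    (hsp : s.var 19 + depSum b N tr Lc ≤ B) :
    WP B mergeInto s fun t s' => t ≤ 300 * depSum b N tr Lc + 50 ∧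
      (∀ z, s'.arr 5 z = if z ∈ Lc then d else s.arr 5 z) ∧
      seg (s'.arr 6) (d * N) (s'.arr 8 d) = Ld ++ Lc ∧
      (∀ r, r ≠ d → s'.arr 8 r = s.arr 8 r ∧ ∀ l ≤ N, seg (s'.arr 6) (r * N) l =
        seg (s.arr 6) (r * N) l) ∧
      ∃ l : List ℕ, seg (s'.arr 16) 0 (s'.var 19) = seg (s.arr 16) 0 (s.var 19) ++ l ∧
        (∀ e ∈ l, e < b * N) ∧ l.length ≤ depSum b N tr Lc ∧
        ∀ e < b * N, e + N ∈ Lc ∨ tr e ∈ Lc → e ∈ l := by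
  obtain ⟨g1, g2, g3, g4⟩ := hP.le_bound
  have hcl : s.arr 8 c = Lc.length := by rw [← hLc, length_seg]
  refine (WP.for (fun j s' => (∀ z, s'.arr 5 z = if z ∈ Lc.take j then d else s.arr 5 z) ∧
      seg (s'.arr 6) (d * N) (s'.arr 8 d) = Ld ++ Lc.take j ∧
      (∀ r, r ≠ d → s'.arr 8 r = s.arr 8 r ∧ ∀ l ≤ N, seg (s'.arr 6) (r * N) l =
        seg (s.arr 6) (r * N) l) ∧
      ∃ l : List ℕ, seg (s'.arr 16) 0 (s'.var 19) = seg (s.arr 16) 0 (s.var 19) ++ l ∧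
        (∀ e ∈ l, e < b * N) ∧ l.length ≤ depSum b N tr (Lc.take j) ∧
        ∀ e < b * N, e + N ∈ Lc.take j ∨ tr e ∈ Lc.take j → e ∈ l) Lc.length
    (fun j => 200 * dep b N tr (s.arr 6 (c * N + j)) + 50) rfl rfl (by omega)
    ⟨by simp, by simpa using hLd, by simp, [], by simp⟩ ?_ ?_).mono ?_
  · rintro j s' - ⟨-, -, h3, -⟩ hF -
    simp [hF.var 23 rfl, hc, (h3 c hcd).1, hcl]
  · rintro j s' hj ⟨h1, h2, h3, l, h4, h5, h6, h7⟩ hF hjj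
    have hst := hs.of_frame hF
    have hj' : j < s.arr 8 c := by omega
    have hzm := mem_of_seg_eq hLc hj'
    have ht := take_succ_of_seg_eq hLc hj'
    -- Members are appended to the row of `d` only, so the list of `c` can be read while it is being
    -- merged.
    have e6 : s'.arr 6 (c * N + j) = s.arr 6 (c * N + j) := by
      have := (h3 c hcd).2 (s.arr 8 c) (by omega)
      have h8 := congrArg (fun L => L[j]?) this
      simpa [seg, hj'] using h8
    generalize hz : s.arr 6 (c * N + j) = z at *
    have hzB := hLcB z hzm
    have hdl : s'.arr 8 d = Ld.length + j := by
      have := congrArg List.length h2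
      rw [length_seg, List.length_append, List.length_take] at this
      omega
    have hspl : s'.var 19 = s.var 19 + l.length := by
      have := congrArg List.length h4
      simpa using this
    have hdsum : depSum b N tr (Lc.take (j + 1)) =
        depSum b N tr (Lc.take j) + dep b N tr z := by rw [ht]; simp [depSum]
    have hdle := depSum_take_le (b := b) (N := N) (tr := tr) (L := Lc) (j + 1)
    refine WP.seq (WP.of_lf rfl ⟨?_, ?_⟩)
    · simp [hF.var 23 rfl, hc, hst.num, hjj, e6]; omega
    refine WP.seq (WP.of_lf rfl ⟨?_, ?_⟩)
    · simp [hF.var 24 rfl, hd]; omega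
    refine WP.seq (WP.of_lf rfl ⟨?_, ?_⟩)
    · simp [hF.var 23 rfl, hc, hst.num, hjj, e6]; omega
    refine WP.seq (WP.of_lf rfl ⟨?_, ?_⟩)
    · simp [hF.var 24 rfl, hd]; omega
    simp [hF.var 24 rfl, hd, hF.var 23 rfl, hc, hst.num, hjj, e6]
    refine (pushDependents_spec hP (z := z) ⟨by simp [hst.base], by simp [hst.num],
      by simpa using hst.succ, by simpa using hst.pred⟩ (by simp) hzB (by simp; omega)).mono ?_
    rintro t s'' hF' ⟨ht', l', k1, k2, k3, k4⟩ -
    refine ⟨by omega, ?_, ?_, ?_, l ++ l', ?_, ?_, ?_, ?_⟩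
    · intro y
      simp [hF'.arr 5 rfl, Function.update_apply, h1, ht]
      by_cases hy : y = z <;> simp [hy]
    · simp [hF'.arr 6 rfl, hF'.arr 8 rfl]
      rw [seg_update_append, h2, ht, List.append_assoc]
    · intro r hr
      refine ⟨?_, fun m hm => ?_⟩
      · simp [hF'.arr 8 rfl, Function.update_of_ne hr, (h3 r hr).1]
      · simp [hF'.arr 6 rfl]
        rw [seg_update_row hm (by omega) hr, (h3 r hr).2 m hm]
    · have : seg (s''.arr 16) 0 (s''.var 19) = seg (s'.arr 16) 0 (s'.var 19) ++ l' := by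
        simpa using k1
      simp [this, h4]
    · intro e he
      rcases List.mem_append.1 he with he | he
      exacts [h5 e he, k2 e he]
    · rw [List.length_append, hdsum]; omega
    · intro e he hh
      rw [ht, List.mem_append, List.mem_append, List.mem_singleton, List.mem_singleton] at hh
      rw [List.mem_append]
      rcases hh with (hh | hh) | (hh | hh)
      · exact Or.inl (h7 e he (Or.inl hh))
      · exact Or.inr (k4 e he (Or.inl hh))
      · exact Or.inl (h7 e he (Or.inr hh))
      · exact Or.inr (k4 e he (Or.inr hh))
  · rintro t s' hF ⟨⟨h1, h2, h3, l, h4, h5, h6, h7⟩, -, ht⟩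
    rw [List.take_length] at *
    refine ⟨?_, h1, h2, h3, l, h4, h5, h6, h7⟩
    rw [← hcl, Finset.sum_add_distrib, Finset.sum_add_distrib, ← Finset.mul_sum,
      sum_of_seg_eq (w := dep b N tr) hLc] at ht
    simp at ht
    have : Lc.length ≤ depSum b N tr Lc := by
      clear * -
      induction Lc with
      | nil => simp
      | cons z L ih =>
        simp only [depSum, List.length_cons, List.map_cons, List.sum_cons, dep] at ih ⊢
        omega
    rw [hcl] at ht
    change _ ≤ 200 * depSum b N tr Lc + _ + _ + _ at ht
    omega

end RAM

/-! ### Closure: signatures by levels, the invariant and the potential. -/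

namespace RAM
open RAM.Expr RAM.Program

variable {b N B : ℕ} {tr : ℕ → ℕ}

/-- The elements `l * N + x` and `l * N + y` have the same level `l`, and the successors of `x` and
`y` by the letters `l, …, b - 1` are related by `U`. -/
def LevelRel (b N : ℕ) (tr : ℕ → ℕ) (U : ℕ → ℕ → Prop) (e f : ℕ) : Prop :=
  e / N = f / N ∧ ∀ a < b, e / N ≤ a → U (tr (a * N + e % N)) (tr (a * N + f % N))

/-- An equivalence relation on the states that is determined by the successors. -/
structure SuccRel (b N : ℕ) (tr : ℕ → ℕ) (U : ℕ → ℕ → Prop) : Prop where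
  equiv : Equivalence U
  iff : ∀ x < N, ∀ y < N, U x y ↔ ∀ a < b, U (tr (a * N + x)) (tr (a * N + y))

section LevelRel

variable {U : ℕ → ℕ → Prop}

theorem SuccRel.level_equiv (hU : SuccRel b N tr U) : Equivalence (LevelRel b N tr U) where
  refl _ := ⟨rfl, fun _ _ _ => hU.equiv.refl _⟩
  symm h := ⟨h.1.symm, fun a ha hl => hU.equiv.symm (h.2 a ha (h.1.trans_le hl))⟩
  trans h h' := ⟨h.1.trans h'.1, fun a ha hl =>
    hU.equiv.trans (h.2 a ha hl) (h'.2 a ha (h.1.ge.trans hl))⟩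

theorem SuccRel.level_zero (hU : SuccRel b N tr U) {x y : ℕ} (hx : x < N) (hy : y < N) :
    LevelRel b N tr U x y ↔ U x y := by
  rw [LevelRel, Nat.div_eq_of_lt hx, Nat.div_eq_of_lt hy, Nat.mod_eq_of_lt hx, Nat.mod_eq_of_lt hy,
    hU.iff x hx y hy]
  simp

/-- An element of level l stands for the successors by the letters l, …, b - 1: the first is the
state `tr e`, and the others are represented by e + N. So signatures of length 2 are enough,
whatever b is. -/
theorem SuccRel.level_step (hU : SuccRel b N tr U) (hN : 0 < N) (htr : ∀ e < b * N, tr e < N)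
    {e f : ℕ} (he : e < b * N) (hf : f < b * N) (h1 : LevelRel b N tr U (e + N) (f + N))
    (h2 : LevelRel b N tr U (tr e) (tr f)) : LevelRel b N tr U e f := by
  rw [hU.level_zero (htr e he) (htr f hf)] at h2
  obtain ⟨h3, h4⟩ := h1
  rw [Nat.add_div_right _ hN, Nat.add_div_right _ hN] at h3
  rw [Nat.add_div_right _ hN, Nat.add_mod_right, Nat.add_mod_right] at h4
  have h5 : e / N = f / N := by omega
  refine ⟨h5, fun a ha hl => ?_⟩
  rcases hl.lt_or_eq with hl | rfl
  · exact h4 a ha hl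
  · rw [Nat.div_add_mod', h5, Nat.div_add_mod']
    exact h2

end LevelRel

/-- Classes never mix levels, and a level has N elements. Rows of length N therefore suffice, and a
class can double at most log N times. -/
theorem length_le_of_div_eq {L : List ℕ} {l : ℕ} (hN : 0 < N) (hn : L.Nodup)
    (h : ∀ z ∈ L, z / N = l) : L.length ≤ N := by
  have h1 : (L.map (· % N)).Nodup := by
    refine List.Nodup.map_on (fun x hx y hy e => ?_) hn
    rw [← Nat.div_add_mod' x N, ← Nat.div_add_mod' y N, h x hx, h y hy, e]
  have := h1.length_le_of_lt (N := N) fun z hz => by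
    obtain ⟨x, -, rfl⟩ := List.mem_map.1 hz
    exact Nat.mod_lt _ hN
  simpa using this

/-- The invariant of the closure algorithm; `P f e` means that the classes of `f` and `e` are
about to be merged. -/
structure ClosInv (b N : ℕ) (tr : ℕ → ℕ) (U : ℕ → ℕ → Prop) (c0 : ℕ → ℕ) (P : ℕ → ℕ → Prop)
    (s : State) : Prop where
  sound : ∀ e < b * N + N, ∀ f < b * N + N, s.arr 5 e = s.arr 5 f → LevelRel b N tr U e f
  lt_zero : ∀ z < N, s.arr 5 z < N
  lt : ∀ z < b * N, s.arr 5 z < b * N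
  top : ∀ x < N, s.arr 5 (b * N + x) = b * N
  nodup : ∀ e < b * N, (seg (s.arr 6) (s.arr 5 e * N) (s.arr 8 (s.arr 5 e))).Nodup
  mem : ∀ e < b * N, ∀ z, z ∈ seg (s.arr 6) (s.arr 5 e * N) (s.arr 8 (s.arr 5 e)) ↔
    z < b * N ∧ s.arr 5 z = s.arr 5 e
  dict : ∀ c u f, u < N → s.arr 15 (c * N + u) = f + 1 → f < b * N ∧
    (∀ e < b * N + N, s.arr 5 e = c → s.arr 5 (f + N) = c) ∧
    (∀ e < N, s.arr 5 e = u → s.arr 5 (tr f) = u)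
  items : ∀ e < b * N, e ∈ seg (s.arr 16) 0 (s.var 19) ∨
    ∃ f, s.arr 15 (s.arr 5 (e + N) * N + s.arr 5 (tr e)) = f + 1 ∧
      (s.arr 5 f = s.arr 5 e ∨ P f e)
  stack : ∀ e ∈ seg (s.arr 16) 0 (s.var 19), e < b * N
  base : ∀ x < N, ∀ y < N, c0 x = c0 y → s.arr 5 x = s.arr 5 y

theorem ClosInv.size_pos {U : ℕ → ℕ → Prop} {c0 : ℕ → ℕ} {P : ℕ → ℕ → Prop} {s : State}
    (h : ClosInv b N tr U c0 P s) {e : ℕ} (he : e < b * N) : 0 < s.arr 8 (s.arr 5 e) := by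
  have := List.length_pos_of_mem ((h.mem e he e).2 ⟨he, rfl⟩)
  rwa [length_seg] at this

theorem ClosInv.size_le {U : ℕ → ℕ → Prop} {c0 : ℕ → ℕ} {P : ℕ → ℕ → Prop} {s : State}
    (h : ClosInv b N tr U c0 P s) (hN : 0 < N) {e : ℕ} (he : e < b * N) :
    s.arr 8 (s.arr 5 e) ≤ N := by
  have := length_le_of_div_eq hN (h.nodup e he) (l := e / N) fun z hz => by
    rw [h.mem e he] at hz
    exact (h.sound z (by omega) e (by omega) hz.2).1
  rwa [length_seg] at this

/-- The name `c` dies and `d` survives. Entries of the signature table are never erased: those that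
mention `c` become stale, and `dict` is harmless for them because it only speaks of names still in
use. An item whose signature changes uses a member of `Lc` and has been pushed again; the other
items keep their signature and their table entry. A pair related by `P` lies in the two merged
classes, hence in one class afterwards. -/
theorem ClosInv.merge {U : ℕ → ℕ → Prop} (hU : SuccRel b N tr U) {c0 : ℕ → ℕ}
    {P : ℕ → ℕ → Prop} {s s' : State} (h : ClosInv b N tr U c0 P s) (hP : Params b N B tr) {e f : ℕ}
    (he : e < b * N) (hf : f < b * N) (hef : LevelRel b N tr U e f) {c d : ℕ}
    (hc : s.arr 5 e = c) (hd : s.arr 5 f = d) (hcd : c ≠ d)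
    (hPcd : ∀ g i, P g i → (s.arr 5 g = c ∨ s.arr 5 g = d) ∧ (s.arr 5 i = c ∨ s.arr 5 i = d))
    {Lc Ld : List ℕ}
    (hLc : seg (s.arr 6) (c * N) (s.arr 8 c) = Lc) (hLd : seg (s.arr 6) (d * N) (s.arr 8 d) = Ld)
    (h5 : ∀ z, s'.arr 5 z = if z ∈ Lc then d else s.arr 5 z)
    (h6 : seg (s'.arr 6) (d * N) (s'.arr 8 d) = Ld ++ Lc)
    (h7 : ∀ r, r ≠ d → s'.arr 8 r = s.arr 8 r ∧ ∀ l ≤ N, seg (s'.arr 6) (r * N) l =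
        seg (s.arr 6) (r * N) l)
    (h15 : s'.arr 15 = s.arr 15) {l : List ℕ}
    (h16 : seg (s'.arr 16) 0 (s'.var 19) = seg (s.arr 16) 0 (s.var 19) ++ l)
    (hl : ∀ e ∈ l, e < b * N) (hl' : ∀ e < b * N, e + N ∈ Lc ∨ tr e ∈ Lc → e ∈ l) :
    ClosInv b N tr U c0 (fun _ _ => False) s' := by
  obtain ⟨g1, g2, g3, g4⟩ := hP.le_bound
  have h2N := hP.two_le_N
  have hLcm : ∀ z, z ∈ Lc ↔ z < b * N ∧ s.arr 5 z = c := fun z => by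
    rw [← hLc]; have := h.mem e he z; rwa [hc] at this
  have hLdm : ∀ z, z ∈ Ld ↔ z < b * N ∧ s.arr 5 z = d := fun z => by
    rw [← hLd]; have := h.mem f hf z; rwa [hd] at this
  have hLcn : Lc.Nodup := by rw [← hLc]; have := h.nodup e he; rwa [hc] at this
  have hLdn : Ld.Nodup := by rw [← hLd]; have := h.nodup f hf; rwa [hd] at this
  have hcB : c < b * N := hc ▸ h.lt e he
  have hdB : d < b * N := hd ▸ h.lt f hf
  have cls : ∀ z < b * N + N, s'.arr 5 z = if s.arr 5 z = c then d else s.arr 5 z := by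
    intro z hz
    rw [h5]
    by_cases hzb : z < b * N
    · simp [hLcm, hzb]
    · have h1 : z ∉ Lc := fun hh => hzb ((hLcm z).1 hh).1
      have h2 := h.top (z - b * N) (by omega)
      rw [Nat.add_sub_cancel' (by omega)] at h2
      rw [if_neg h1, if_neg (by omega)]
  have hle := hU.level_equiv
  have lev : ∀ z < b * N + N, s.arr 5 z = c → LevelRel b N tr U z f := fun z hz hzc =>
    hle.trans (h.sound z hz e (by omega) (hzc.trans hc.symm)) hef
  have lev' : ∀ z < b * N + N, s.arr 5 z = d → LevelRel b N tr U z f := fun z hz hzd =>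
    h.sound z hz f (by omega) (hzd.trans hd.symm)
  have mono : ∀ y < b * N + N, ∀ z < b * N + N, s.arr 5 y = s.arr 5 z → s'.arr 5 y = s'.arr 5 z := by
    intro y hy z hz e
    rw [cls y hy, cls z hz, e]
  constructor
  · intro y hy z hz e
    rw [cls y hy, cls z hz] at e
    split_ifs at e with k1 k2 k2
    · exact hle.trans (lev y hy k1) (hle.symm (lev z hz k2))
    · exact hle.trans (lev y hy k1) (hle.symm (lev' z hz e.symm))
    · exact hle.trans (lev' y hy e) (hle.symm (lev z hz k2))
    · exact h.sound y hy z hz e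
  · intro z hz
    rw [cls z (by omega)]
    split_ifs with k
    · have h1 := (lev z (by omega) k).1
      rw [Nat.div_eq_of_lt hz] at h1
      have h2 : f < N := by
        by_contra hcon
        have := Nat.div_pos (not_lt.1 hcon) (by omega : 0 < N)
        omega
      exact hd ▸ h.lt_zero f h2
    · exact h.lt_zero z hz
  · intro z hz
    rw [cls z (by omega)]
    split_ifs
    exacts [hdB, h.lt z hz]
  · intro x hx
    rw [cls _ (by omega), h.top x hx, if_neg (by omega)]
  · intro z hz
    by_cases k : s'.arr 5 z = d
    · rw [k, h6, List.nodup_append]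
      refine ⟨hLdn, hLcn, fun x hx y hy => ?_⟩
      rintro rfl
      exact hcd (((hLcm x).1 hy).2.symm.trans ((hLdm x).1 hx).2)
    · obtain ⟨k1, k2⟩ := h7 _ k
      rw [cls z (by omega)] at k
      have k3 : s.arr 5 z ≠ c := fun hh => k (by rw [if_pos hh])
      have k4 : s'.arr 5 z = s.arr 5 z := by rw [cls z (by omega), if_neg k3]
      rw [k1, k2 _ (by rw [k4]; exact h.size_le (by omega) hz), k4]
      exact h.nodup z hz
  · intro z hz y
    by_cases k : s'.arr 5 z = d
    · rw [k, h6, List.mem_append, hLcm, hLdm, ← and_or_left]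
      refine and_congr_right fun hy => ?_
      rw [cls y (by omega)]
      split_ifs with k1
      · simp [k1]
      · simp [k1]
    · obtain ⟨k1, k2⟩ := h7 _ k
      rw [cls z (by omega)] at k
      have k3 : s.arr 5 z ≠ c := fun hh => k (by rw [if_pos hh])
      rw [if_neg k3] at k
      have k4 : s'.arr 5 z = s.arr 5 z := by rw [cls z (by omega), if_neg k3]
      rw [k1, k2 _ (by rw [k4]; exact h.size_le (by omega) hz), k4, h.mem z hz]
      refine and_congr_right fun hy => ?_
      rw [cls y (by omega)]
      split_ifs with k1
      · exact iff_of_false (fun hh => k3 (hh.symm.trans k1)) (fun hh => k hh.symm)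
      · rfl
  · intro r u g hu hg
    rw [h15] at hg
    obtain ⟨k1, k2, k3⟩ := h.dict r u g hu hg
    refine ⟨k1, fun z hz hzr => ?_, fun z hz hzu => ?_⟩
    · rw [cls z hz] at hzr
      rw [cls _ (by omega)]
      split_ifs at hzr with k4
      · have := k2 f (by omega) (hd.trans hzr)
        rw [this, if_neg (by omega), ]
      · have := k2 z hz hzr
        rw [this, if_neg (by rw [← hzr]; exact k4)]
    · have htg := hP.tr_lt g k1
      rw [cls z (by omega)] at hzu
      rw [cls _ (by omega)]
      split_ifs at hzu with k4
      · have h1 := (lev z (by omega) k4).1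
        rw [Nat.div_eq_of_lt hz] at h1
        have h2 : f < N := by
          by_contra hcon
          have := Nat.div_pos (not_lt.1 hcon) (by omega : 0 < N)
          omega
        have := k3 f h2 (hd.trans hzu)
        rw [this, if_neg (by omega)]
      · have := k3 z hz hzu
        rw [this, if_neg (by rw [← hzu]; exact k4)]
  · intro z hz
    rw [h16, List.mem_append]
    rcases h.items z hz with k1 | ⟨g, k1, k2⟩
    · exact Or.inl (Or.inl k1)
    · by_cases k3 : z + N ∈ Lc ∨ tr z ∈ Lc
      · exact Or.inl (Or.inr (hl' z hz k3))
      · push Not at k3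
        have htz := hP.tr_lt z hz
        refine Or.inr ⟨g, ?_, Or.inl ?_⟩
        · rw [h15, h5, h5 (tr z), if_neg k3.1, if_neg k3.2, k1]
        · have hg : g < b * N := (h.dict _ _ g (h.lt_zero _ htz) k1).1
          rcases k2 with k2 | k2
          · exact mono g (by omega) z (by omega) k2
          · rw [cls g (by omega), cls z (by omega)]
            obtain ⟨k4, k5⟩ := hPcd g z k2
            rcases k4 with k4 | k4 <;> rcases k5 with k5 | k5 <;> simp [k4, k5, hcd.symm]
  · intro z hz
    rw [h16, List.mem_append] at hz
    rcases hz with hz | hz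
    exacts [h.stack z hz, hl z hz]
  · intro x hx y hy e
    exact mono x (by omega) y (by omega) (h.base x hx y hy e)

/-- The amortised cost of the remaining work. -/
def closPot (b N : ℕ) (tr : ℕ → ℕ) (s : State) : ℕ :=
  200 * s.var 19 + 600 * ∑ z ∈ Finset.range (b * N),
    dep b N tr z * (Nat.log 2 N - Nat.log 2 (s.arr 8 (s.arr 5 z)))

theorem depSum_le (hP : Params b N B tr) {L : List ℕ} (hn : L.Nodup) (hL : ∀ z ∈ L, z < b * N) :
    depSum b N tr L ≤ 3 * (b * N) := by
  rw [← sum_dep hP, depSum, ← List.sum_toFinset _ hn]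
  exact Finset.sum_le_sum_of_subset fun z hz => Finset.mem_range.2 (hL z (List.mem_toFinset.1 hz))

/-- Every renamed element ends in a class at least twice as large, so its logarithmic deficit drops
by at least 1 and releases 600 times its `dep`. The newly pushed items take up to 200 times the
total, and 400 times remains for the merge. -/
theorem closPot_merge {s s' : State} {c d : ℕ} {Lc : List ℕ}
    (hn : Lc.Nodup) (hm : ∀ z, z ∈ Lc ↔ z < b * N ∧ s.arr 5 z = c)
    (h5 : ∀ z, s'.arr 5 z = if z ∈ Lc then d else s.arr 5 z)
    (h8 : s'.arr 8 d = s.arr 8 d + s.arr 8 c) (h8' : ∀ r, r ≠ d → s'.arr 8 r = s.arr 8 r)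
    (hle : s.arr 8 c ≤ s.arr 8 d) (hsz : s.arr 8 d + s.arr 8 c ≤ N) (hc : 0 < s.arr 8 c)
    (h19 : s'.var 19 ≤ s.var 19 + depSum b N tr Lc) :
    closPot b N tr s' + 400 * depSum b N tr Lc ≤ closPot b N tr s := by
  have key : ∑ z ∈ Finset.range (b * N),
      dep b N tr z * (Nat.log 2 N - Nat.log 2 (s'.arr 8 (s'.arr 5 z))) + depSum b N tr Lc ≤
      ∑ z ∈ Finset.range (b * N), dep b N tr z * (Nat.log 2 N - Nat.log 2 (s.arr 8 (s.arr 5 z))) := by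
    have e1 : depSum b N tr Lc = ∑ z ∈ Finset.range (b * N), if z ∈ Lc then dep b N tr z else 0 := by
      rw [depSum, ← List.sum_toFinset _ hn, ← Finset.sum_filter]
      refine Finset.sum_congr ?_ fun _ _ => rfl
      ext z
      simp only [List.mem_toFinset, Finset.mem_filter, Finset.mem_range, hm]
      tauto
    rw [e1, ← Finset.sum_add_distrib]
    refine Finset.sum_le_sum fun z hz => ?_
    rw [Finset.mem_range] at hz
    by_cases hzL : z ∈ Lc
    · have hzc := ((hm z).1 hzL).2
      have h1 : s'.arr 5 z = d := by rw [h5, if_pos hzL]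
      rw [if_pos hzL, h1, hzc, ← Nat.mul_succ]
      refine Nat.mul_le_mul_left _ ?_
      have h2 := log_add_one_le hc (k := s'.arr 8 d) (by omega)
      have h3 : Nat.log 2 (s'.arr 8 d) ≤ Nat.log 2 N := Nat.log_mono_right (by omega)
      omega
    · have h1 : s'.arr 5 z = s.arr 5 z := by rw [h5, if_neg hzL]
      rw [if_neg hzL, h1, add_zero]
      refine Nat.mul_le_mul_left _ ?_
      by_cases hzd : s.arr 5 z = d
      · have : Nat.log 2 (s.arr 8 (s.arr 5 z)) ≤ Nat.log 2 (s'.arr 8 (s.arr 5 z)) :=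
          Nat.log_mono_right (by rw [hzd]; omega)
        omega
      · rw [h8' _ hzd]
  unfold closPot
  omega

end RAM

/-! ### Closure: examination of one item. -/

namespace RAM
open RAM.Expr RAM.Program

variable {b N B : ℕ} {tr : ℕ → ℕ}

section closure

variable {U : ℕ → ℕ → Prop} {c0 : ℕ → ℕ} {P : ℕ → ℕ → Prop} {s s' : State}

theorem mergeInto_closure (hP : Params b N B tr) (hs : Static b N tr s) (hU : SuccRel b N tr U)
    (h : ClosInv b N tr U c0 P s) {e f : ℕ} (he : e < b * N) (hf : f < b * N)
    (hef : LevelRel b N tr U e f) (hc : s.var 23 = s.arr 5 e) (hd : s.var 24 = s.arr 5 f)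
    (hne : s.arr 5 e ≠ s.arr 5 f) (hle : s.arr 8 (s.arr 5 e) ≤ s.arr 8 (s.arr 5 f))
    (hPcd : ∀ g i, P g i → (s.arr 5 g = s.arr 5 e ∨ s.arr 5 g = s.arr 5 f) ∧
      (s.arr 5 i = s.arr 5 e ∨ s.arr 5 i = s.arr 5 f)) (hsp : s.var 19 + 3 * (b * N) ≤ B) :
    WP B mergeInto s fun t s' => t + closPot b N tr s' ≤ closPot b N tr s ∧
      ClosInv b N tr U c0 (fun _ _ => False) s' := by
  obtain ⟨g1, g2, g3, g4⟩ := hP.le_bound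
  have h2N := hP.two_le_N
  have hme := h.mem e he
  have hmf := h.mem f hf
  have hne' := h.nodup e he
  have hnf := h.nodup f hf
  have hpos := h.size_pos he
  generalize hcc : s.arr 5 e = c at *
  generalize hdd : s.arr 5 f = d at *
  generalize hLc : seg (s.arr 6) (c * N) (s.arr 8 c) = Lc at *
  generalize hLd : seg (s.arr 6) (d * N) (s.arr 8 d) = Ld at *
  have hle' := hU.level_equiv
  have hlen : (Lc ++ Ld).length ≤ N := by
    refine length_le_of_div_eq (by omega) (l := f / N) ?_ ?_
    · rw [List.nodup_append]
      refine ⟨hne', hnf, fun x hx y hy => ?_⟩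
      rintro rfl
      exact hne (((hme x).1 hx).2.symm.trans ((hmf x).1 hy).2)
    · intro z hz
      rcases List.mem_append.1 hz with hz | hz
      · have h1 := (hme z).1 hz
        exact (h.sound z (by omega) e (by omega) (h1.2.trans hcc.symm)).1.trans hef.1
      · have h1 := (hmf z).1 hz
        exact (h.sound z (by omega) f (by omega) (h1.2.trans hdd.symm)).1
  rw [List.length_append] at hlen
  have hcl : s.arr 8 c = Lc.length := by rw [← hLc, length_seg]
  have hdl : s.arr 8 d = Ld.length := by rw [← hLd, length_seg]
  have hds := depSum_le hP hne' fun z hz => ((hme z).1 hz).1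
  refine (mergeInto_spec hP hs hc hd hne (hdd ▸ h.lt f hf) hLc hLd (fun z hz => ((hme z).1 hz).1)
    hlen (by omega)).mono ?_
  rintro t s' hF ⟨ht, h5, h6, h7, l, h16, hl, hll, hl'⟩
  have h8 : s'.arr 8 d = s.arr 8 d + s.arr 8 c := by
    have := congrArg List.length h6
    rw [length_seg, List.length_append] at this
    omega
  have h19 : s'.var 19 = s.var 19 + l.length := by simpa using congrArg List.length h16
  have hpot := closPot_merge (b := b) (N := N) (tr := tr) hne' hme h5 h8
    (fun r hr => (h7 r hr).1) hle (by omega) hpos (by omega)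
  have h1 : 1 ≤ depSum b N tr Lc := by
    rw [hcl] at hpos
    obtain ⟨z, L, rfl⟩ := List.exists_cons_of_length_pos hpos
    simp only [depSum, List.map_cons, List.sum_cons, dep]
    omega
  exact ⟨by omega, h.merge hU hP he hf hef hcc hdd hne hPcd hLc hLd h5 h6 h7 (hF.arr 15 rfl) h16 hl
    hl'⟩

theorem merge_closure (hP : Params b N B tr) (hs : Static b N tr s) (hU : SuccRel b N tr U)
    (h : ClosInv b N tr U c0 P s) {e f : ℕ} (he : e < b * N) (hf : f < b * N)
    (hef : LevelRel b N tr U e f) (hc : s.var 23 = s.arr 5 e) (hd : s.var 24 = s.arr 5 f)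
    (hPcd : ∀ g i, P g i → (s.arr 5 g = s.arr 5 e ∨ s.arr 5 g = s.arr 5 f) ∧
      (s.arr 5 i = s.arr 5 e ∨ s.arr 5 i = s.arr 5 f)) (hsp : s.var 19 + 3 * (b * N) ≤ B) :
    WP B merge s fun t s' => t + closPot b N tr s' ≤ closPot b N tr s + 50 ∧
      ClosInv b N tr U c0 (fun _ _ => False) s' := by
  obtain ⟨g1, g2, g3, g4⟩ := hP.le_bound
  have hce := h.lt e he
  have hcf := h.lt f hf
  refine WP.cond rfl (fun h0 => ?_) (fun h0 => ?_)
  · have hne : s.arr 5 e ≠ s.arr 5 f := by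
      simp [hc, hd] at h0; omega
    refine WP.seq (WP.of_lf rfl ⟨fun h1 => ?_, fun h1 => ?_⟩)
    · simp only [eval_sub, eval_cell, eval_var, hc, hd] at h1
      refine ⟨by simp [hc]; omega, by simp [hd]; omega, by simp [hc]; omega, ?_⟩
      simp [hc, hd]
      refine (mergeInto_closure (c0 := c0) (P := P) hP (e := f) (f := e)
        ⟨by simp [hs.base], by simp [hs.num], by simpa using hs.succ, by simpa using hs.pred⟩ hU
        ?_ hf he (hU.level_equiv.symm hef) (by simp) (by simp) (by simpa using hne.symm)
        (by simp; omega) ?_ (by simpa using hsp)).mono ?_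
      · obtain ⟨i1, i2, i3, i4, i5, i6, i7, i8, i9, i10⟩ := h
        constructor <;> simpa
      · intro g i hgi
        have := hPcd g i hgi
        simp only [State.setVar_arr]
        tauto
      · rintro t s' - ⟨h2, h3⟩
        refine ⟨?_, h3⟩
        have : closPot b N tr (((s.setVar 25 (s.arr 5 e)).setVar 23 (s.arr 5 f)).setVar 24
          (s.arr 5 e)) = closPot b N tr s := by simp [closPot]
        omega
    · simp only [eval_sub, eval_cell, eval_var, hc, hd] at h1
      refine (mergeInto_closure hP hs hU h he hf hef hc hd hne (by omega) hPcd hsp).mono ?_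
      rintro t s' - ⟨h2, h3⟩
      simp
      exact ⟨by omega, h3⟩
  · have heq : s.arr 5 e = s.arr 5 f := by
      simp [hc, hd] at h0; omega
    refine WP.of_lf rfl ?_
    simp [lf]
    refine ⟨by omega, { h with items := fun z hz => ?_ }⟩
    rcases h.items z hz with k1 | ⟨g, k1, k2⟩
    · exact Or.inl k1
    · refine Or.inr ⟨g, k1, Or.inl ?_⟩
      rcases k2 with k2 | k2
      · exact k2
      · obtain ⟨k3, k4⟩ := hPcd g z k2
        rw [← heq, or_self] at k3 k4
        rw [k3, k4]

theorem mem_seg_pop {f : ℕ → ℕ} {l m z : ℕ} (hl : l + 1 = m) :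
    z ∈ seg f 0 m ↔ z ∈ seg f 0 l ∨ z = f l := by
  rw [← hl, seg_succ]
  simp

/-- The popped item `e` is no longer protected by the stack; the parameter `P` records that it is
owed a merge with the item `g` found under its signature. -/
theorem ClosInv.examine_hit (h : ClosInv b N tr U c0 (fun _ _ => False) s) (ha : s'.arr = s.arr)
    (hv : s'.var 19 + 1 = s.var 19) {e g : ℕ} (he : s.arr 16 (s'.var 19) = e)
    (hg : s.arr 15 (s.arr 5 (e + N) * N + s.arr 5 (tr e)) = g + 1) :
    ClosInv b N tr U c0 (fun f' e' => f' = g ∧ e' = e) s' := by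
  obtain ⟨i1, i2, i3, i4, i5, i6, i7, i8, i9, i10⟩ := h
  constructor <;> rw [ha]
  all_goals try assumption
  · intro z hz
    rcases i8 z hz with k | ⟨f, k1, k2⟩
    · rw [mem_seg_pop hv, he] at k
      rcases k with k | rfl
      · exact Or.inl k
      · exact Or.inr ⟨g, hg, Or.inr ⟨rfl, rfl⟩⟩
    · exact Or.inr ⟨f, k1, Or.inl (k2.resolve_right id)⟩
  · exact fun z hz => i9 z ((mem_seg_pop hv).2 (Or.inl hz))

theorem row_eq {c u d v : ℕ} (hu : u < N) (hv : v < N) (h : c * N + u = d * N + v) :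
    c = d ∧ u = v := by
  have h1 : c = d := by
    by_contra hne
    exact row_ne hu hv hne h
  subst h1
  exact ⟨rfl, by omega⟩

theorem ClosInv.examine_miss (hP : Params b N B tr)
    (h : ClosInv b N tr U c0 (fun _ _ => False) s) (ha : ∀ k, k ≠ 15 → s'.arr k = s.arr k)
    (hv : s'.var 19 + 1 = s.var 19) {e : ℕ} (he : s.arr 16 (s'.var 19) = e)
    (hg : s.arr 15 (s.arr 5 (e + N) * N + s.arr 5 (tr e)) = 0)
    (h15 : s'.arr 15 =
      Function.update (s.arr 15) (s.arr 5 (e + N) * N + s.arr 5 (tr e)) (e + 1)) :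
    ClosInv b N tr U c0 (fun _ _ => False) s' := by
  have heB : e < b * N := h.stack e ((mem_seg_pop hv).2 (Or.inr he.symm))
  have hte := h.lt_zero _ (hP.tr_lt e heB)
  obtain ⟨i1, i2, i3, i4, i5, i6, i7, i8, i9, i10⟩ := h
  have a5 := ha 5 (by simp)
  have a6 := ha 6 (by simp)
  have a8 := ha 8 (by simp)
  have a16 := ha 16 (by simp)
  constructor
  all_goals try rw [a5]
  all_goals try rw [a6, a8]
  all_goals try rw [a16]
  all_goals try assumption
  · intro c u f hu hf
    rw [h15, Function.update_apply] at hf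
    split_ifs at hf with hk
    · obtain ⟨rfl, rfl⟩ := row_eq hu hte hk
      obtain rfl : e = f := by omega
      exact ⟨heB, fun _ _ _ => rfl, fun _ _ _ => rfl⟩
    · exact i7 c u f hu hf
  · intro z hz
    rcases i8 z hz with k | ⟨f, k1, k2⟩
    · rw [mem_seg_pop hv, he] at k
      rcases k with k | rfl
      · exact Or.inl k
      · exact Or.inr ⟨z, by rw [h15, Function.update_self], Or.inl rfl⟩
    · refine Or.inr ⟨f, ?_, k2⟩
      rw [h15, Function.update_of_ne, k1]
      intro hk
      rw [hk, hg] at k1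
      omega
  · exact fun z hz => i9 z ((mem_seg_pop hv).2 (Or.inl hz))

theorem examine_spec (hP : Params b N B tr) (hs : Static b N tr s) (hU : SuccRel b N tr U)
    (h : ClosInv b N tr U c0 (fun _ _ => False) s) (h0 : s.var 19 ≠ 0)
    (hsp : s.var 19 + 3 * (b * N) ≤ B) :
    WP B examine s fun t s' => t + 2 + closPot b N tr s' ≤ closPot b N tr s ∧
      ClosInv b N tr U c0 (fun _ _ => False) s' := by
  obtain ⟨g1, g2, g3, g4⟩ := hP.le_bound
  have h2N := hP.two_le_N
  have hB := hP.bound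
  obtain ⟨l, hl⟩ := Nat.exists_eq_succ_of_ne_zero h0
  generalize he : s.arr 16 l = e
  have heB : e < b * N := h.stack e ((mem_seg_pop hl.symm).2 (Or.inr he.symm))
  have htr := hP.tr_lt e heB
  have hte := h.lt_zero _ htr
  have hce : s.arr 5 (e + N) ≤ b * N := by
    by_cases hh : e + N < b * N
    · exact (h.lt _ hh).le
    · have := h.top (e + N - b * N) (by omega)
      rw [Nat.add_sub_cancel' (by omega)] at this
      exact this.le
  have hkey : s.arr 5 (e + N) * N ≤ b * N * N := Nat.mul_le_mul_right _ hce
  have hpot : ∀ s' : State, s'.arr 5 = s.arr 5 → s'.arr 8 = s.arr 8 → s'.var 19 = l →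
      ∀ k ≤ 200, k + closPot b N tr s' ≤ closPot b N tr s := by
    intro s' e5 e8 e19 k hk
    simp only [closPot, e5, e8, e19, hl]
    omega
  refine WP.seq (WP.of_lf rfl ⟨by simp; omega, ?_⟩)
  refine WP.seq (WP.of_lf rfl ⟨by simp [hl, he]; omega, ?_⟩)
  refine WP.seq (WP.of_lf rfl ⟨by simp [hl, he, hs.num, hs.succ e heB]; omega, ?_⟩)
  simp [hl, he, hs.num, hs.succ e heB]
  refine WP.cond rfl (fun h1 => ?_) (fun h1 => ?_)
  · simp at h1
    obtain ⟨g, hg⟩ := Nat.exists_eq_succ_of_ne_zero h1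
    obtain ⟨hgB, hd1, hd2⟩ := h.dict _ _ g hte hg
    -- The names in the signature of `e` are in use, so `dict` applies: `g` has the same signature
    -- now, and soundness transfers from both components to the items.
    have hge : LevelRel b N tr U e g := by
      refine hU.level_step (by omega) hP.tr_lt heB hgB (h.sound _ (by omega) _ (by omega) ?_)
        (h.sound _ (by omega) _ ?_ ?_)
      · exact (hd1 (e + N) (by omega) rfl).symm
      · have := hP.tr_lt g hgB
        omega
      · exact (hd2 (tr e) htr rfl).symm
    have hcE := h.lt e heB
    have hcG := h.lt g hgB
    refine WP.seq (WP.of_lf rfl ⟨by simp; omega, ?_⟩)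
    refine WP.seq (WP.of_lf rfl ⟨by simp [hg]; omega, ?_⟩)
    simp [hg]
    refine (merge_closure (c0 := c0) (P := fun f' e' => f' = g ∧ e' = e) hP (e := e) (f := g)
        ⟨by simp [hs.base], by simp [hs.num], by simpa using hs.succ, by simpa using hs.pred⟩ hU
        (h.examine_hit (by simp) (by simp [hl]) (by simp [he]) hg) heB hgB hge (by simp) (by simp)
        (by rintro _ _ ⟨rfl, rfl⟩; simp) (by simp; omega)).mono ?_
    rintro t s' - ⟨h2, h3⟩
    refine ⟨?_, h3⟩
    have h4 : ∀ s' : State, s'.arr 5 = s.arr 5 → s'.arr 8 = s.arr 8 → s'.var 19 = l →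
        ∀ p q, p ≤ closPot b N tr s' + 50 → q ≤ p + 100 → q ≤ closPot b N tr s := by
      intro s' e5 e8 e19 p q hp hq
      have := hpot s' e5 e8 e19 200 le_rfl
      omega
    exact h4 _ (by simp) (by simp) (by simp) _ _ h2 (by omega)
  · simp at h1
    refine WP.of_lf rfl ⟨by simp; omega, ?_⟩
    simp
    exact ⟨hpot _ (by simp) (by simp) (by simp) _ (by norm_num),
      h.examine_miss hP (fun k hk => by simp [hk]) (by simp [hl]) (by simp [he]) h1 (by simp)⟩

end closure

end RAM

/-! ### Closure: initialisation, correctness and cost. -/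

namespace RAM
open RAM.Expr RAM.Program

variable {b N B : ℕ} {tr : ℕ → ℕ}

section closure

variable {U : ℕ → ℕ → Prop} {c0 : ℕ → ℕ} {P : ℕ → ℕ → Prop} {s s' : State}

/-- Level 0 inherits the blocks of Hopcroft's algorithm with their lists; their names are below N,
so the elements of levels 1, …, b - 1 can be singletons named by themselves. Level b has no letters
left and forms one class, named b * N. -/
theorem initClasses_spec (hP : Params b N B tr) (hs : Static b N tr s) (hU : SuccRel b N tr U)
    (hop : HopInv N s) (h15 : ∀ i, s.arr 15 i = 0)
    (hc0 : ∀ x < N, ∀ y < N, s.arr 5 x = s.arr 5 y → U x y) :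
    WP B initClasses s fun t s' => t ≤ 500 * (b * N) ∧ s'.var 19 = b * N ∧
      ClosInv b N tr U (s.arr 5) (fun _ _ => False) s' := by
  obtain ⟨g1, g2, g3, g4⟩ := hP.le_bound
  have h2N := hP.two_le_N
  have h2b := hP.two_le_b
  have hpart := hop.part
  have hnb := hop.wf.nb_le
  have hlt : ∀ x < N, s.arr 5 x < N := fun x hx => (hop.wf.lt x hx).trans_le hnb
  have hbN : b * N - N + N = b * N := by omega
  have hrow : ∀ c, N ≤ c → N * N ≤ c * N := fun c hc => Nat.mul_le_mul_right _ hc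
  have hB := hP.bound
  refine WP.seq ((WP.for (fun j s' =>
      (∀ z, s'.arr 5 z = if N ≤ z ∧ z < N + j then z else s.arr 5 z) ∧
      (∀ z, s'.arr 8 z = if N ≤ z ∧ z < N + j then 1 else s.arr 8 z) ∧
      (∀ z, N ≤ z → z < N + j → s'.arr 6 (z * N) = z) ∧
      (∀ c < N, ∀ l ≤ N, seg (s'.arr 6) (c * N) l = seg (s.arr 6) (c * N) l)) (b * N - N)
      (fun _ => 60) rfl rfl (by omega) ⟨fun z => ?_, fun z => ?_, fun z _ _ => ?_, by simp⟩
      (fun j s' _ _ hF _ => by simp [hF.var 0 rfl, hF.var 3 rfl, hs.base, hs.num]) ?_).mono ?_)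
  · rw [if_neg (by omega)]; rfl
  · rw [if_neg (by omega)]; rfl
  · omega
  · rintro j s' hj ⟨i1, i2, i3, i4⟩ hF hjj
    have h3 : s'.var 3 = N := by rw [hF.var 3 rfl, hs.num]
    refine WP.of_lf rfl ?_
    simp [lf, h3, hjj]
    refine ⟨by omega, by omega, fun _ => ⟨fun z => ?_, fun z => ?_, fun z hz hz' => ?_,
      fun c hc l hl => ?_⟩⟩
    · rw [Function.update_apply, i1]
      split_ifs <;> omega
    · rw [Function.update_apply, i2]
      split_ifs <;> omega
    · rw [Function.update_apply]
      split_ifs with hh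
      · exact (Nat.eq_of_mul_eq_mul_right (by omega) hh).symm
      · refine i3 z hz ?_
        rcases Nat.lt_succ_iff_lt_or_eq.1 (show z < (N + j) + 1 by omega) with k | rfl
        · exact k
        · exact absurd rfl hh
    · rw [← i4 c hc l hl]
      exact seg_update_row (d := N + j) (i := 0) hl (by omega) (by omega)
  rintro t1 s1 hF1 ⟨⟨i1, i2, i3, i4⟩, -, ht1⟩
  rw [show N + (b * N - N) = b * N by omega] at i1 i2 i3
  have hs1 := hs.of_frame hF1
  refine WP.seq ((WP.for (fun j s' => ∀ z, s'.arr 5 z =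
      if b * N ≤ z ∧ z < b * N + j then b * N else s1.arr 5 z) N
      (fun _ => 60) rfl rfl (by omega) (fun z => ?_)
      (fun j s' _ _ hF _ => by simp [hF.var 3 rfl, hs1.num]) ?_).mono ?_)
  · rw [if_neg (by omega)]; rfl
  · rintro j s' hj k1 hF hjj
    have h3 : s'.var 3 = N := by rw [hF.var 3 rfl, hs1.num]
    have h0 : s'.var 0 = b := by rw [hF.var 0 rfl, hs1.base]
    refine WP.of_lf rfl ?_
    simp [lf, h3, h0, hjj]
    refine ⟨by omega, fun _ z => ?_⟩
    rw [Function.update_apply, k1]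
    split_ifs <;> omega
  rintro t2 s2 hF2 ⟨k1, -, ht2⟩
  have hs2 := hs1.of_frame hF2
  refine WP.seq ((WP.for (fun j s' => ∀ z < j, s'.arr 16 z = z) (b * N)
      (fun _ => 60) rfl rfl (by omega) (by simp)
      (fun j s' _ _ hF _ => by simp [hF.var 3 rfl, hF.var 0 rfl, hs2.num, hs2.base]) ?_).mono ?_)
  · rintro j s' hj l1 hF hjj
    refine WP.of_lf rfl ?_
    simp [lf, hjj]
    refine ⟨by omega, fun _ z hz => ?_⟩
    rw [Function.update_apply]
    split_ifs with hh
    · exact hh.symm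
    · exact l1 z (by omega)
  rintro t3 s3 hF3 ⟨l1, -, ht3⟩
  refine WP.of_lf rfl ?_
  simp [lf, hF3.var 3 rfl, hF3.var 0 rfl, hs2.num, hs2.base]
  refine ⟨by omega, ?_, ?_⟩
  · simp only [Finset.sum_const, Finset.card_range, smul_eq_mul] at ht1 ht2 ht3
    omega
  have c5 : ∀ z, s3.arr 5 z = if b * N ≤ z ∧ z < b * N + N then b * N else
      if N ≤ z ∧ z < b * N then z else s.arr 5 z := fun z => by rw [hF3.arr 5 rfl, k1, i1]
  have c5a : ∀ z < N, s3.arr 5 z = s.arr 5 z := fun z hz => by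
    rw [c5, if_neg (by omega), if_neg (by omega)]
  have c5b : ∀ z, N ≤ z → z < b * N → s3.arr 5 z = z := fun z hz hz' => by
    rw [c5, if_neg (by omega), if_pos ⟨hz, hz'⟩]
  have c5c : ∀ z, b * N ≤ z → z < b * N + N → s3.arr 5 z = b * N := fun z hz hz' => by
    rw [c5, if_pos ⟨hz, hz'⟩]
  have c8 : s3.arr 8 = s1.arr 8 := by rw [hF3.arr 8 rfl, hF2.arr 8 rfl]
  have c6 : s3.arr 6 = s1.arr 6 := by rw [hF3.arr 6 rfl, hF2.arr 6 rfl]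
  have c15 : ∀ i, s3.arr 15 i = 0 := fun i => by
    rw [hF3.arr 15 rfl, hF2.arr 15 rfl, hF1.arr 15 rfl, h15]
  have st : seg (s3.arr 16) 0 (b * N) = List.range (b * N) := by
    conv_rhs => rw [← List.map_id (List.range (b * N))]
    refine List.map_congr_left fun z hz => ?_
    rw [Nat.zero_add, l1 z (List.mem_range.1 hz)]
    rfl
  have sA : ∀ z < N, seg (s3.arr 6) (s3.arr 5 z * N) (s3.arr 8 (s3.arr 5 z)) =
      seg (s.arr 6) (s.arr 5 z * N) (s.arr 8 (s.arr 5 z)) := by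
    intro z hz
    have := hlt z hz
    rw [c5a z hz, c6, c8, i2, if_neg (by omega), i4 _ this _ (hpart.size_le _)]
  have sB : ∀ z, N ≤ z → z < b * N → seg (s3.arr 6) (s3.arr 5 z * N) (s3.arr 8 (s3.arr 5 z)) =
      [z] := by
    intro z hz hz'
    rw [c5b z hz hz', c6, c8, i2, if_pos ⟨hz, hz'⟩, seg_succ, seg_zero, Nat.add_zero, i3 z hz hz']
    rfl
  have lev : ∀ e < b * N + N, ∀ f < b * N + N, s3.arr 5 e = s3.arr 5 f →
      (e < N ∧ f < N ∧ s.arr 5 e = s.arr 5 f) ∨ e = f ∨ (b * N ≤ e ∧ b * N ≤ f) := by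
    intro e he f hf hh
    rcases lt_or_ge e N with h1 | h1
    · rw [c5a e h1] at hh
      have := hlt e h1
      rcases lt_or_ge f N with h2 | h2
      · rw [c5a f h2] at hh
        exact Or.inl ⟨h1, h2, hh⟩
      · rcases lt_or_ge f (b * N) with h3 | h3
        · rw [c5b f h2 h3] at hh; omega
        · rw [c5c f h3 hf] at hh; omega
    · rcases lt_or_ge e (b * N) with h4 | h4
      · rw [c5b e h1 h4] at hh
        rcases lt_or_ge f N with h2 | h2
        · rw [c5a f h2] at hh
          have := hlt f h2
          omega
        · rcases lt_or_ge f (b * N) with h3 | h3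
          · rw [c5b f h2 h3] at hh; exact Or.inr (Or.inl hh)
          · rw [c5c f h3 hf] at hh; omega
      · rw [c5c e h4 he] at hh
        rcases lt_or_ge f N with h2 | h2
        · rw [c5a f h2] at hh
          have := hlt f h2
          omega
        · rcases lt_or_ge f (b * N) with h3 | h3
          · rw [c5b f h2 h3] at hh; omega
          · exact Or.inr (Or.inr ⟨h4, h3⟩)
  constructor
  · intro e he f hf hh
    rcases lev e he f hf hh with ⟨h1, h2, h3⟩ | rfl | ⟨h1, h2⟩
    · exact (hU.level_zero h1 h2).2 (hc0 e h1 f h2 h3)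
    · exact hU.level_equiv.refl _
    -- At level b there is no letter a < b with b ≤ a, so the relation holds vacuously.
    · have key : ∀ z, b * N ≤ z → z < b * N + N → z / N = b := fun z h1 h2 =>
        Nat.div_eq_of_lt_le h1 (by rw [Nat.succ_mul]; exact h2)
      refine ⟨(key e h1 he).trans (key f h2 hf).symm, fun a ha hle => ?_⟩
      rw [key e h1 he] at hle
      omega
  · intro z hz
    simp [c5a z hz, hlt z hz]
  · intro z hz
    simp only [State.setVar_arr]
    rcases lt_or_ge z N with h1 | h1
    · rw [c5a z h1]
      exact (hlt z h1).trans_le (by omega)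
    · rwa [c5b z h1 hz]
  · intro x hx
    exact c5c _ (by omega) (by omega)
  · intro z hz
    simp only [State.setVar_arr]
    rcases lt_or_ge z N with h1 | h1
    · rw [sA z h1]
      exact hpart.nodup_seg _
    · rw [sB z h1 hz]
      simp
  · intro z hz y
    simp only [State.setVar_arr]
    have h2 : ∀ {y}, s3.arr 5 y = s3.arr 5 z → y < b * N → _ := fun {y} h hy =>
      lev y (by omega) z (by omega) h
    rcases lt_or_ge z N with h1 | h1
    · rw [sA z h1, hpart.mem_seg_iff]
      constructor
      · rintro ⟨h3, h4⟩
        exact ⟨by omega, by rw [c5a y h3, c5a z h1, h4]⟩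
      · rintro ⟨h3, h4⟩
        rcases h2 h4 h3 with h5 | rfl | h5
        · exact ⟨h5.1, h5.2.2⟩
        · exact ⟨h1, rfl⟩
        · omega
    · rw [sB z h1 hz, List.mem_singleton]
      constructor
      · rintro rfl
        exact ⟨hz, rfl⟩
      · rintro ⟨h3, h4⟩
        rcases h2 h4 h3 with h5 | rfl | h5
        · omega
        · rfl
        · omega
  · intro c u f _ hf
    have := c15 (c * N + u)
    simp at hf
    omega
  · intro e he
    left
    simp [st, he]
  · intro e he
    simpa [st] using he
  · intro x hx y hy e
    simp only [State.setVar_arr]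
    rw [c5a x hx, c5a y hy, e]

theorem coarsen_spec (hP : Params b N B tr) (hs : Static b N tr s) (hU : SuccRel b N tr U)
    (hB : 2000 * (b * N * (Nat.log 2 N + 1)) ≤ 200 * B)
    (hop : HopInv N s) (h15 : ∀ i, s.arr 15 i = 0)
    (hc0 : ∀ x < N, ∀ y < N, s.arr 5 x = s.arr 5 y → U x y) :
    WP B coarsen s fun t s' => t ≤ 3000 * (b * N * (Nat.log 2 N + 1)) ∧
      (∀ x < N, ∀ y < N, s.arr 5 x = s.arr 5 y → s'.arr 5 x = s'.arr 5 y) ∧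
      (∀ x < N, ∀ y < N, (∀ a < b, s'.arr 5 (tr (a * N + x)) = s'.arr 5 (tr (a * N + y))) →
        s'.arr 5 x = s'.arr 5 y) ∧
      ∀ x < N, ∀ y < N, s'.arr 5 x = s'.arr 5 y → U x y := by
  obtain ⟨g1, g2, g3, g4⟩ := hP.le_bound
  have h2N := hP.two_le_N
  refine WP.seq ((initClasses_spec hP hs hU hop h15 hc0).mono ?_)
  rintro t1 s1 hF1 ⟨ht1, h19, h1⟩
  have hs1 := hs.of_frame hF1
  have hpot : closPot b N tr s1 ≤ 200 * (b * N) + 1800 * (b * N * Nat.log 2 N) := by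
    have : ∑ z ∈ Finset.range (b * N),
        dep b N tr z * (Nat.log 2 N - Nat.log 2 (s1.arr 8 (s1.arr 5 z))) ≤
        3 * (b * N) * Nat.log 2 N := by
      rw [← sum_dep hP, Finset.sum_mul]
      exact Finset.sum_le_sum fun z _ => Nat.mul_le_mul_left _ (Nat.sub_le _ _)
    rw [closPot, h19]
    calc _ ≤ 200 * (b * N) + 600 * (3 * (b * N) * Nat.log 2 N) := by omega
      _ = _ := by ring
  have e1 : b * N * (Nat.log 2 N + 1) = b * N * Nat.log 2 N + b * N := by ring
  rw [e1] at hB ⊢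
  have hl : b * N ≤ b * N * Nat.log 2 N := Nat.le_mul_of_pos_right _ (Nat.log_pos (by omega) h2N)
  refine (WP.while (fun p s' => ClosInv b N tr U (s.arr 5) (fun _ _ => False) s' ∧
    p = closPot b N tr s' ∧ p ≤ closPot b N tr s1) _ rfl ⟨h1, rfl, le_rfl⟩ ?_).mono ?_
  · rintro p s2 ⟨h2, rfl, hp⟩ hF2 h0
    -- The potential also bounds the height of the stack, hence the words that hold its pointer.
    have hsp : 200 * s2.var 19 ≤ closPot b N tr s2 := Nat.le_add_right _ _
    refine (examine_spec hP (hs1.of_frame hF2) hU h2 h0 ?_).mono ?_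
    · omega
    · rintro t s3 - ⟨h3, h4⟩ -
      exact ⟨_, ⟨h4, rfl, by omega⟩, by simp only [cost_var]; omega⟩
  · rintro t s2 hF2 ⟨p, ⟨h2, -, -⟩, h0, ht⟩
    simp only [cost_var] at ht
    rw [eval_var] at h0
    refine ⟨by omega, h2.base, fun x hx y hy hxy => ?_, fun x hx y hy e =>
      (hU.level_zero hx hy).1 (h2.sound x (by omega) y (by omega) e)⟩
    -- Descending induction on the level, from the single class of level b. With an empty stack
    -- every item shares its class with the table entry of its signature, so equal signatures give
    -- equal classes.
    have key : ∀ m ≤ b, s2.arr 5 ((b - m) * N + x) = s2.arr 5 ((b - m) * N + y) := by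
      intro m
      induction m with
      | zero => intro _; rw [Nat.sub_zero, h2.top x hx, h2.top y hy]
      | succ m ih =>
        intro hm
        have h3 := ih (by omega)
        have h4 : ∀ z, (b - m) * N + z = (b - (m + 1)) * N + z + N := by
          intro z
          rw [show b - m = (b - (m + 1)) + 1 by omega]
          ring
        rw [h4, h4] at h3
        have h5 := hxy (b - (m + 1)) (by omega)
        have h6 : ∀ z < N, (b - (m + 1)) * N + z < b * N := by
          intro z hz
          have := Nat.mul_le_mul_right N (show b - (m + 1) + 1 ≤ b by omega)
          rw [Nat.succ_mul] at this
          omega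
        have h7 : ∀ e < b * N, ∃ f, s2.arr 15 (s2.arr 5 (e + N) * N + s2.arr 5 (tr e)) = f + 1 ∧
            s2.arr 5 f = s2.arr 5 e := by
          intro e he
          rcases h2.items e he with k | ⟨f, k1, k2⟩
          · simp [h0] at k
          · exact ⟨f, k1, k2.resolve_right id⟩
        obtain ⟨f, k1, k2⟩ := h7 _ (h6 x hx)
        obtain ⟨g, k3, k4⟩ := h7 _ (h6 y hy)
        rw [h3, h5, k3] at k1
        obtain rfl : g = f := by omega
        exact k2.symm.trans k4
    simpa using key b le_rfl

end closure

end RAM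

/-! ### Words, the Nerode equivalence and the ultimate equivalence. -/

namespace RAM

variable {b N : ℕ} {tr : ℕ → ℕ}

section words

/-- The state reached from `x` by reading a word. -/
def go (N : ℕ) (tr : ℕ → ℕ) (x : ℕ) (w : List ℕ) : ℕ := w.foldl (fun x a => tr (a * N + x)) x

@[simp] theorem go_nil {x : ℕ} : go N tr x [] = x := rfl

@[simp] theorem go_cons {x a : ℕ} {w : List ℕ} : go N tr x (a :: w) = go N tr (tr (a * N + x)) w :=
  rfl

@[simp] theorem go_append {x : ℕ} {v w : List ℕ} :
    go N tr x (v ++ w) = go N tr (go N tr x v) w := List.foldl_append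

/-- The words over the alphabet `{0, …, b - 1}`. -/
def IsWord (b : ℕ) (w : List ℕ) : Prop := ∀ a ∈ w, a < b

theorem isWord_nil : IsWord b [] := by simp [IsWord]

theorem isWord_cons {a : ℕ} {w : List ℕ} : IsWord b (a :: w) ↔ a < b ∧ IsWord b w := by
  simp [IsWord]

theorem isWord_append {v w : List ℕ} : IsWord b (v ++ w) ↔ IsWord b v ∧ IsWord b w := by
  simp only [IsWord, List.mem_append, or_imp, forall_and]

theorem isWord_reverse_digits (hb : 2 ≤ b) (m : ℕ) : IsWord b (Nat.digits b m).reverse :=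
  fun _ ha => Nat.digits_lt_base (by omega) (List.mem_reverse.1 ha)

theorem go_lt (htr : ∀ a < b, ∀ x < N, tr (a * N + x) < N) {x : ℕ} (hx : x < N) {w : List ℕ}
    (hw : IsWord b w) : go N tr x w < N := by
  induction w generalizing x with
  | nil => exact hx
  | cons a w ih =>
    rw [isWord_cons] at hw
    exact ih (htr a hw.1 x hx) hw.2

/-- The value of a word. -/
def val (b : ℕ) (w : List ℕ) : ℕ := Nat.ofDigits b w.reverse

@[simp] theorem val_nil : val b [] = 0 := rfl

theorem val_append_singleton {w : List ℕ} {a : ℕ} : val b (w ++ [a]) = val b w * b + a := by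
  simp [val, Nat.ofDigits_cons]
  ring

theorem val_zero_cons {w : List ℕ} : val b (0 :: w) = val b w := by
  simp [val, Nat.ofDigits_append]

theorem val_reverse_digits {m : ℕ} : val b (Nat.digits b m).reverse = m := by
  rw [val, List.reverse_reverse, Nat.ofDigits_digits]

theorem exists_val_eq (hb : 2 ≤ b) (j : ℕ) : ∀ v < b ^ j, ∃ w, IsWord b w ∧ w.length = j ∧
    val b w = v := by
  induction j with
  | zero => exact fun v hv => ⟨[], isWord_nil, rfl, by simp at hv; simp [hv]⟩
  | succ j ih =>
    intro v hv
    obtain ⟨w, h1, h2, h3⟩ := ih (v / b) (Nat.div_lt_of_lt_mul (by rwa [pow_succ'] at hv))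
    refine ⟨w ++ [v % b], isWord_append.2 ⟨h1, isWord_cons.2 ⟨Nat.mod_lt _ (by omega), isWord_nil⟩⟩,
      by simp [h2], ?_⟩
    rw [val_append_singleton, h3, Nat.div_add_mod']

/-- The state reached from `q` by the shortest representation of `m`. -/
def reach (b N : ℕ) (tr : ℕ → ℕ) (q m : ℕ) : ℕ := go N tr q (Nat.digits b m).reverse

@[simp] theorem reach_zero {q : ℕ} : reach b N tr q 0 = q := by simp [reach]

theorem reach_step (hb : 2 ≤ b) {q m a : ℕ} (ha : a < b) (h : m * b + a ≠ 0) :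
    reach b N tr q (m * b + a) = tr (a * N + reach b N tr q m) := by
  have : m * b + a = a + b * m := by ring
  rw [reach, this, Nat.digits_add b hb a m ha (by
    by_contra hcon
    push Not at hcon
    simp [hcon.1, hcon.2] at h)]
  simp [reach]

theorem reach_lt (hb : 2 ≤ b) (htr : ∀ a < b, ∀ x < N, tr (a * N + x) < N) {q : ℕ} (hq : q < N)
    (m : ℕ) : reach b N tr q m < N := go_lt htr hq (isWord_reverse_digits hb m)

/-- For m ≥ 1 the leading digit is not zero, so digits appended to the canonical representation
again give a canonical representation. -/
theorem go_reach (hb : 2 ≤ b) {q m : ℕ} (hm : 1 ≤ m) {w : List ℕ} (hw : IsWord b w) :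
    go N tr (reach b N tr q m) w = reach b N tr q (m * b ^ w.length + val b w) := by
  induction w using List.reverseRecOn with
  | nil => simp
  | append_singleton w a ih =>
    rw [isWord_append, isWord_cons] at hw
    have h1 : 1 ≤ m * b ^ w.length := Nat.one_le_iff_ne_zero.2 (by positivity)
    have h2 : m * b ^ (w ++ [a]).length + val b (w ++ [a]) =
        (m * b ^ w.length + val b w) * b + a := by
      rw [val_append_singleton, List.length_append, List.length_singleton, pow_succ]
      ring
    rw [go_append, ih hw.1, h2, reach_step hb hw.2.1]
    · rfl
    · have : 1 ≤ (m * b ^ w.length + val b w) * b := Nat.mul_pos (by omega) (by omega)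
      omega

variable {ac : ℕ → Prop}

/-- The same words lead from `x` and from `y` to acceptance. -/
def Nerode (b N : ℕ) (tr : ℕ → ℕ) (ac : ℕ → Prop) (x y : ℕ) : Prop :=
  ∀ w, IsWord b w → (ac (go N tr x w) ↔ ac (go N tr y w))

/-- The same words of large length lead from `x` and from `y` to acceptance. -/
def Ultimate (b N : ℕ) (tr : ℕ → ℕ) (ac : ℕ → Prop) (x y : ℕ) : Prop :=
  ∃ j, ∀ w, IsWord b w → j ≤ w.length → (ac (go N tr x w) ↔ ac (go N tr y w))

theorem Nerode.step {x y a : ℕ} (h : Nerode b N tr ac x y) (ha : a < b) :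
    Nerode b N tr ac (tr (a * N + x)) (tr (a * N + y)) := fun w hw =>
  h (a :: w) (isWord_cons.2 ⟨ha, hw⟩)

theorem Nerode.ultimate {x y : ℕ} (h : Nerode b N tr ac x y) : Ultimate b N tr ac x y :=
  ⟨0, fun w hw _ => h w hw⟩

/-- The determination by the successors holds because the alphabet is finite: the thresholds of the
letters have a maximum, and reading the first letter adds 1. The Nerode equivalence lacks this
property, as it also sees the empty word. -/
theorem succRel_ultimate : SuccRel b N tr (Ultimate b N tr ac) where
  equiv := by
    refine ⟨fun x => ⟨0, fun _ _ _ => Iff.rfl⟩, ?_, ?_⟩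
    · rintro x y ⟨j, h⟩
      exact ⟨j, fun w hw hj => (h w hw hj).symm⟩
    · rintro x y z ⟨j, h⟩ ⟨j', h'⟩
      exact ⟨max j j', fun w hw hj =>
        (h w hw (by omega)).trans (h' w hw (by omega))⟩
  iff := by
    intro x _ y _
    constructor
    · rintro ⟨j, h⟩ a ha
      exact ⟨j, fun w hw hj => h (a :: w) (isWord_cons.2 ⟨ha, hw⟩) (by simp; omega)⟩
    · intro h
      choose! j hj using h
      refine ⟨(Finset.range b).sup j + 1, fun w hw hl => ?_⟩
      rcases w with _ | ⟨a, w⟩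
      · simp at hl
      · rw [isWord_cons] at hw
        have h1 : j a ≤ (Finset.range b).sup j := Finset.le_sup (Finset.mem_range.2 hw.1)
        rw [List.length_cons] at hl
        exact hj a hw.1 w hw.2 (by omega)

/-- A relation that contains the Nerode equivalence and that satisfies the determination by the
successors contains the ultimate equivalence. -/
theorem Ultimate.imp {R : ℕ → ℕ → Prop} (htr : ∀ a < b, ∀ x < N, tr (a * N + x) < N)
    (h0 : ∀ x < N, ∀ y < N, Nerode b N tr ac x y → R x y)
    (h1 : ∀ x < N, ∀ y < N, (∀ a < b, R (tr (a * N + x)) (tr (a * N + y))) → R x y)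
    {x y : ℕ} (hx : x < N) (hy : y < N) (h : Ultimate b N tr ac x y) : R x y := by
  obtain ⟨j, h⟩ := h
  induction j generalizing x y with
  | zero => exact h0 x hx y hy fun w hw => h w hw (Nat.zero_le _)
  | succ j ih =>
    refine h1 x hx y hy fun a ha => ih (htr a ha x hx) (htr a ha y hy) fun w hw hl => ?_
    exact h (a :: w) (isWord_cons.2 ⟨ha, hw⟩) (by simp; omega)

theorem nerode_of_rel {R : ℕ → ℕ → Prop} (htr : ∀ a < b, ∀ x < N, tr (a * N + x) < N)
    (h : ∀ x < N, ∀ y < N, R x y → (ac x ↔ ac y) ∧ ∀ a < b, R (tr (a * N + x)) (tr (a * N + y)))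
    {x y : ℕ} (hx : x < N) (hy : y < N) (hR : R x y) : Nerode b N tr ac x y := by
  intro w
  induction w generalizing x y with
  | nil => exact fun _ => (h x hx y hy hR).1
  | cons a w ih =>
    intro hw
    rw [isWord_cons] at hw
    exact ih (htr a hw.1 x hx) (htr a hw.1 y hy) ((h x hx y hy hR).2 a hw.1) hw.2

/-- The automaton accepts some set by value if and only if leading zeros do not matter. -/
theorem nerode_reach (hb : 2 ≤ b) {q : ℕ} (h : Nerode b N tr ac q (tr (0 * N + q))) {w : List ℕ}
    (hw : IsWord b w) : Nerode b N tr ac (go N tr q w) (reach b N tr q (val b w)) := by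
  induction w using List.reverseRecOn with
  | nil => exact fun w _ => by simp
  | append_singleton w a ih =>
    rw [isWord_append, isWord_cons] at hw
    have h1 := (ih hw.1).step hw.2.1
    rw [go_append, val_append_singleton]
    by_cases h0 : val b w * b + a = 0
    · have h2 : a = 0 := by omega
      have h3 : val b w = 0 := by
        have : val b w * b = 0 := by omega
        exact (Nat.mul_eq_zero.1 this).resolve_right (by omega)
      rw [h0, reach_zero]
      rw [h3, reach_zero] at h1
      subst h2
      intro v hv
      exact (h1 v hv).trans (h v hv).symm
    · rw [reach_step hb hw.2.1 h0]
      exact h1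

/-- Canonical representations determine the set, so the quantifier over S disappears and the
property `p` is tested on one explicit set. -/
theorem exists_byValue_iff (hb : 2 ≤ b) {q : ℕ} {p : Set ℕ → Prop} :
    (∃ S, p S ∧ ∀ w, IsWord b w → (ac (go N tr q w) ↔ val b w ∈ S)) ↔
      Nerode b N tr ac q (tr (0 * N + q)) ∧ p {m | ac (reach b N tr q m)} := by
  constructor
  · rintro ⟨S, hS, h⟩
    have h1 : S = {m | ac (reach b N tr q m)} := by
      ext m
      have := h _ (isWord_reverse_digits hb m)
      rw [val_reverse_digits] at this
      exact this.symm
    refine ⟨fun w hw => ?_, h1 ▸ hS⟩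
    have := h (0 :: w) (isWord_cons.2 ⟨by omega, hw⟩)
    rw [val_zero_cons] at this
    exact (h w hw).trans this.symm
  · rintro ⟨h1, h2⟩
    exact ⟨_, h2, fun w hw => nerode_reach hb h1 hw [] isWord_nil⟩

end words

/-! ### Periods of the sequence of reached states modulo an equivalence determined by successors. -/

section period

variable {U : ℕ → ℕ → Prop} {F : ℕ → ℕ}

/-- The sequence `F` has the period `k` up to `U`, from `1` on. -/
def Period (U : ℕ → ℕ → Prop) (F : ℕ → ℕ) (k : ℕ) : Prop := ∀ x, 1 ≤ x → U (F x) (F (x + k))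

theorem Period.mul (hU : Equivalence U) {k : ℕ} (h : Period U F k) (t : ℕ) :
    Period U F (k * t) := by
  intro x hx
  induction t with
  | zero => exact hU.refl _
  | succ t ih =>
    rw [Nat.mul_succ, ← Nat.add_assoc]
    exact hU.trans ih (h (x + k * t) (by omega))

theorem Period.modEq (hU : Equivalence U) {k x y : ℕ} (h : Period U F k) (hx : 1 ≤ x) (hy : 1 ≤ y)
    (hxy : x ≡ y [MOD k]) : U (F x) (F y) := by
  wlog hle : x ≤ y generalizing x y
  · exact hU.symm (this hy hx hxy.symm (by omega))
  · obtain ⟨t, ht⟩ := (Nat.modEq_iff_dvd' hle).1 hxy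
    obtain rfl : y = x + k * t := by omega
    exact h.mul hU t x hx

variable (hb : 2 ≤ b) (hU : SuccRel b N tr U) (hlt : ∀ m, F m < N)
  (hF : ∀ m, 1 ≤ m → ∀ a < b, F (m * b + a) = tr (a * N + F m))
include hU hlt hF

theorem rel_reach {x y : ℕ} (hx : 1 ≤ x) (hy : 1 ≤ y) :
    U (F x) (F y) ↔ ∀ a < b, U (F (x * b + a)) (F (y * b + a)) := by
  rw [hU.iff _ (hlt x) _ (hlt y)]
  refine forall₂_congr fun a ha => ?_
  rw [hF x hx a ha, hF y hy a ha]

theorem rel_pow {x y : ℕ} (hx : 1 ≤ x) (hy : 1 ≤ y) (h : U (F x) (F y)) (j : ℕ) :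
    ∀ v < b ^ j, U (F (x * b ^ j + v)) (F (y * b ^ j + v)) := by
  induction j with
  | zero => intro v hv; simp at hv; simpa [hv]
  | succ j ih =>
    intro v hv
    have hb0 : 0 < b := by
      rcases Nat.eq_zero_or_pos b with rfl | h
      · simp at hv
      · exact h
    have h1 := ih (v / b) (Nat.div_lt_of_lt_mul (by rwa [pow_succ'] at hv))
    have key : ∀ z, z * b ^ (j + 1) + v = (z * b ^ j + v / b) * b + v % b := fun z => by
      conv_lhs => rw [← Nat.div_add_mod' v b]
      rw [pow_succ]
      ring
    have pos : ∀ z, 1 ≤ z → 1 ≤ z * b ^ j + v / b := fun z hz => by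
      have : 1 ≤ z * b ^ j := Nat.one_le_iff_ne_zero.2 (by positivity)
      exact this.trans (Nat.le_add_right _ _)
    rw [key, key]
    exact (rel_reach hU hlt hF (pos x hx) (pos y hy)).1 h1 _ (Nat.mod_lt _ hb0)

/-- A shift by d * b ^ (j + 1) relates the successors of x and of x + d * b ^ j letter by letter,
and related successors make the states themselves related. -/
theorem Period.of_mul_pow {d j : ℕ} (hb0 : 0 < b) (h : Period U F (d * b ^ j)) : Period U F d := by
  induction j with
  | zero => simpa using h
  | succ j ih =>
    refine ih fun x hx => (rel_reach hU hlt hF hx (by omega)).2 fun a _ => ?_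
    have h1 := h (x * b + a) (by nlinarith)
    rwa [show x * b + a + d * b ^ (j + 1) = (x + d * b ^ j) * b + a by rw [pow_succ]; ring] at h1

include hb

/-- Reading j further digits with k ≤ b ^ j turns the coincidence at m into coincidences at m * b ^
j + v, with shift d * b ^ j, for all v < b ^ j. These numbers meet every residue modulo the known
period k, so d * b ^ j is a period, and the factor b ^ j can be divided out. -/
theorem Period.of_rel {k m d : ℕ} (hk : 1 ≤ k) (h : Period U F k) (hm : 1 ≤ m)
    (hmd : U (F m) (F (m + d))) : Period U F d := by
  obtain ⟨j, hj⟩ : ∃ j, k ≤ b ^ j := ⟨k, (Nat.lt_pow_self (by omega)).le⟩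
  refine Period.of_mul_pow (j := j) hU hlt hF (by omega) fun x hx => ?_
  obtain ⟨v, hv, hxv⟩ : ∃ v < b ^ j, m * b ^ j + v ≡ x [MOD k] := by
    -- The residue of x - m * b ^ j modulo k, written without subtraction.
    refine ⟨(x + (k - 1) * (m * b ^ j)) % k, (Nat.mod_lt _ hk).trans_le hj, ?_⟩
    refine ((Nat.mod_modEq _ _).add_left _).trans ?_
    rw [show m * b ^ j + (x + (k - 1) * (m * b ^ j)) = x + (k - 1 + 1) * (m * b ^ j) by ring,
      Nat.sub_add_cancel hk]
    simp [Nat.ModEq]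
  have h1 := rel_pow hU hlt hF hm (by omega) hmd j v hv
  have h2 : 1 ≤ m * b ^ j := Nat.one_le_iff_ne_zero.2 (by positivity)
  have h3 := h.modEq hU.equiv (by omega) hx hxv
  have h4 := h.modEq hU.equiv (by omega) (by omega) (hxv.add_right (d * b ^ j))
  rw [show (m + d) * b ^ j + v = m * b ^ j + v + d * b ^ j by ring] at h1
  exact hU.equiv.trans (hU.equiv.symm h3) (hU.equiv.trans h1 h4)

/-- Beyond the tested range, x + k = (l + k) * b + a with l ≥ 1 and a digit a. By induction F l ~ F
(l + k), hence F (l * b + a) ~ F (x + k) after reading a; and l * b + a is joined to x by b - 1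
shifts of length k, all of them below x + k. -/
theorem Period.of_le {k : ℕ} (hk : 1 ≤ k)
    (h : ∀ x, 1 ≤ x → x + k < k * b + b → U (F x) (F (x + k))) : Period U F k := by
  have key : ∀ y x, 1 ≤ x → x + k = y → U (F x) (F y) := by
    intro y
    induction y using Nat.strong_induction_on with
    | _ y ih =>
      rintro x hx rfl
      by_cases hlt' : x + k < k * b + b
      · exact h x hx hlt'
      have hdiv : k + 1 ≤ (x + k) / b := by
        rw [Nat.le_div_iff_mul_le (by omega)]
        linarith
      have hmod : (x + k) % b < b := Nat.mod_lt _ (by omega)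
      have hdm := Nat.div_add_mod' (x + k) b
      generalize (x + k) / b = m at *
      generalize (x + k) % b = a at *
      obtain ⟨l, rfl⟩ := Nat.exists_eq_add_of_le' (show k ≤ m by omega)
      have hlk : l + k < x + k := by nlinarith
      have h1 := (rel_reach hU hlt hF (by omega) (by omega)).1
        (ih (l + k) hlk l (by omega) rfl) a hmod
      rw [hdm] at h1
      have h2 : ∀ t, l * b + a + k * t < x + k → U (F (l * b + a)) (F (l * b + a + k * t)) := by
        intro t
        induction t with
        | zero => exact fun _ => hU.equiv.refl _
        | succ t iht =>
          intro ht
          rw [Nat.mul_succ] at ht ⊢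
          refine hU.equiv.trans (iht (by omega)) (ih _ (by omega) _ ?_ (by ring))
          nlinarith
      have h3 : l * b + a + k * (b - 1) = x := by
        obtain ⟨c, rfl⟩ := Nat.exists_eq_add_of_le' hb
        simp only [show c + 2 - 1 = c + 1 by omega]
        nlinarith
      have h4 := h2 (b - 1) (by omega)
      rw [h3] at h4
      exact hU.equiv.trans (hU.equiv.symm h4) h1
  exact fun x hx => key _ x hx rfl

/-- The period is found by comparing the first values only. -/
theorem exists_period_iff {k : ℕ} (hk : 1 ≤ k) (h1 : ∀ i, 1 ≤ i → i < k → ¬ U (F 1) (F (1 + i)))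
    (h2 : k < N → U (F 1) (F (1 + k))) (hkN : k ≤ N) :
    (∃ l, 1 ≤ l ∧ Period U F l) ↔ ∀ x, 1 ≤ x → x + k < k * b + b → U (F x) (F (x + k)) := by
  constructor
  · rintro ⟨l, hl, hp⟩ x hx -
    -- Two of the N + 1 states F 1, …, F (N + 1) are equal, and such a coincidence is itself a
    -- period.
    obtain ⟨d, hd, hdN, hpd⟩ : ∃ d, 1 ≤ d ∧ d ≤ N ∧ Period U F d := by
      obtain ⟨i, hi, j, hj, hij, he⟩ := Finset.exists_ne_map_eq_of_card_lt_of_maps_to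
        (s := Finset.Icc 1 (N + 1)) (t := Finset.range N) (f := F) (by simp)
        (fun m _ => by simpa using hlt m)
      rw [Finset.mem_Icc] at hi hj
      wlog hle : i < j generalizing i j
      · exact this j hj i hi hij.symm he.symm (by omega)
      refine ⟨j - i, by omega, by omega, hp.of_rel hb hU hlt hF hl hi.1 ?_⟩
      rw [Nat.add_sub_cancel' hle.le, he]
      exact hU.equiv.refl _
    have hkd : k ≤ d := by
      by_contra hcon
      exact h1 d hd (by omega) (hpd 1 le_rfl)
    -- For k < N the coincidence at 1 makes k a period. The value k = N is reached without any
    -- comparison, but then d is squeezed between k and N.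
    rcases hkN.lt_or_eq with hlt' | rfl
    · exact hp.of_rel hb hU hlt hF hl le_rfl (h2 hlt') x hx
    · obtain rfl : d = k := by omega
      exact hpd x hx
  · exact fun h => ⟨k, hk, Period.of_le hb hU hlt hF hk h⟩

end period

/-- If p is an eventual period, a long word w read after x and after x + p gives two large numbers
that differ by p * b ^ |w|, a multiple of p. Conversely, a period k modulo `Ultimate` becomes an
eventual period k * b ^ J of the set once J is a threshold valid for all pairs of states. -/
theorem eventuallyPeriodic_iff (hb : 2 ≤ b) (htr : ∀ a < b, ∀ x < N, tr (a * N + x) < N)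
    {ac : ℕ → Prop} {q : ℕ} (hq : q < N) :
    EventuallyPeriodic {m | ac (reach b N tr q m)} ↔
      ∃ k, 1 ≤ k ∧ Period (Ultimate b N tr ac) (reach b N tr q) k := by
  constructor
  · rintro ⟨p, M, hp, h⟩
    refine ⟨p, hp, fun x hx => ⟨M, fun w hw hl => ?_⟩⟩
    rw [go_reach hb hx hw, go_reach hb (by omega) hw]
    have h1 : ∀ t y, M ≤ y → (ac (reach b N tr q y) ↔ ac (reach b N tr q (y + p * t))) := by
      intro t y hy
      induction t with
      | zero => rfl
      | succ t ih =>
        rw [Nat.mul_succ, ← Nat.add_assoc]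
        exact ih.trans (h (y + p * t) (by omega))
    have h2 : w.length < b ^ w.length := Nat.lt_pow_self (by omega)
    have h3 : b ^ w.length ≤ x * b ^ w.length := Nat.le_mul_of_pos_left _ hx
    rw [h1 (b ^ w.length) _ (by omega)]
    rw [show (x + p) * b ^ w.length + val b w = x * b ^ w.length + val b w + p * b ^ w.length by
      ring]
  · rintro ⟨k, hk, hp⟩
    -- There are finitely many pairs of states, so one threshold serves them all.
    obtain ⟨J, hJ⟩ : ∃ J, ∀ x < N, ∀ y < N, Ultimate b N tr ac x y →
        ∀ w, IsWord b w → J ≤ w.length → (ac (go N tr x w) ↔ ac (go N tr y w)) := by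
      have : ∀ x y, ∃ j, Ultimate b N tr ac x y →
          ∀ w, IsWord b w → j ≤ w.length → (ac (go N tr x w) ↔ ac (go N tr y w)) := by
        intro x y
        by_cases h : Ultimate b N tr ac x y
        · exact ⟨h.choose, fun _ => h.choose_spec⟩
        · exact ⟨0, fun h' => absurd h' h⟩
      choose j hj using this
      refine ⟨(Finset.range N ×ˢ Finset.range N).sup fun z => j z.1 z.2,
        fun x hx y hy hxy w hw hl => hj x y hxy w hw (le_trans ?_ hl)⟩
      exact Finset.le_sup (f := fun z : ℕ × ℕ => j z.1 z.2) (b := (x, y)) (by simp [hx, hy])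
    -- For x ≥ b ^ J, the last J digits of x form a word long enough for the threshold, read after x
    -- / b ^ J ≥ 1.
    refine ⟨k * b ^ J, b ^ J, Nat.mul_pos hk (by positivity), fun x hx => ?_⟩
    have hpos : 0 < b ^ J := by positivity
    have h1 : 1 ≤ x / b ^ J := Nat.div_pos hx hpos
    obtain ⟨w, hw, hwl, hwv⟩ := exists_val_eq hb J (x % b ^ J) (Nat.mod_lt _ hpos)
    have h2 := hJ _ (reach_lt hb htr hq _) _ (reach_lt hb htr hq _) (hp (x / b ^ J) h1) w hw hwl.ge
    rw [go_reach hb h1 hw, go_reach hb (by omega) hw, hwl, hwv, add_mul, add_right_comm,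
      Nat.div_add_mod'] at h2
    exact h2

end RAM

/-! ### Programs for leading zeros, reached states and the period. -/

namespace RAM
open RAM.Expr RAM.Program

variable {b N B : ℕ} {tr : ℕ → ℕ} {F : ℕ → ℕ} {s : State}

theorem checkStart_spec (hP : Params b N B tr) (hs : Static b N tr s) {q : ℕ} (hq : s.var 2 = q)
    (hqN : q < N) : WP B checkStart s fun t s' => t ≤ 50 ∧
      s'.var 18 = if s.arr 5 q = s.arr 5 (tr (0 * N + q)) then 1 else 0 := by
  obtain ⟨g1, g2, g3, g4⟩ := hP.le_bound
  have h2N := hP.two_le_N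
  refine WP.of_lf rfl ?_
  have h := hs.succ q (by omega)
  refine ⟨?_, ?_, ?_⟩
  · simp; omega
  · simp
  · simp [hq, h]
    split_ifs <;> omega

theorem reachAll_spec (hP : Params b N B tr) (hs : Static b N tr s) (hq : s.var 2 = F 0)
    (hF : ∀ m, ∀ a < b, m * b + a ≠ 0 → F (m * b + a) = tr (a * N + F m)) (hlt : ∀ m, F m < N) :
    WP B reachAll s fun t s' => t ≤ 500 * (b * N) ∧
      ∀ m, 1 ≤ m → m < (N + 1) * b → s'.arr 17 m = F m := by
  obtain ⟨g1, g2, g3, g4⟩ := hP.le_bound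
  have h2N := hP.two_le_N
  have h2b := hP.two_le_b
  refine WP.seq (WP.of_lf rfl ⟨by simp [hq]; have := hlt 0; omega, ?_⟩)
  simp [hq]
  refine (WP.for (fun j s' => (∀ m, 1 ≤ m → m < j * b → s'.arr 17 m = F m) ∧
    (j = 0 → s'.arr 17 0 = F 0)) (N + 1) (fun _ => 100 * b + 100) rfl rfl (by omega)
    ⟨by simp, by simp⟩ (fun j s' _ _ hF' _ => by simp [hF'.var 3 rfl, hs.num]) ?_).mono ?_
  · rintro j s' hj ⟨i1, i2⟩ hF' hjj
    have h2 : s'.arr 2 = s.arr 2 := by rw [hF'.arr 2 rfl]; simp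
    have h0 : s'.var 0 = b := by rw [hF'.var 0 rfl]; simp [hs.base]
    have h3 : s'.var 3 = N := by rw [hF'.var 3 rfl]; simp [hs.num]
    -- The first pass, with j = 0, overwrites cell 0 by the successor of the initial state by the
    -- letter 0. The cell is read before that and never needed again, hence the clause for j = 0 and
    -- the restriction to m ≥ 1.
    have hv : s'.arr 17 j = F j := by
      rcases Nat.eq_zero_or_pos j with rfl | hj0
      · exact i2 rfl
      · exact i1 j hj0 (by nlinarith)
    have hFj := hlt j
    refine WP.seq (WP.of_lf rfl ⟨by simp [hjj, hv]; omega, ?_⟩)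
    simp [hjj, hv]
    refine (WP.for (fun i s'' => ∀ m, 1 ≤ m → m < j * b + i → s''.arr 17 m = F m) b
      (fun _ => 40) rfl rfl (by omega) (by simpa using i1)
      (fun i s'' _ _ hF'' _ => by simp [hF''.var 0 rfl, h0]) ?_).mono ?_
    · rintro i s'' hi k1 hF'' hii
      have hsucc := hs.succ (i * N + F j) (by nlinarith)
      have hl := hP.tr_lt' hi hFj
      refine WP.of_lf rfl ?_
      simp [lf, hF''.arr 2 rfl, hF''.var 0 rfl, hF''.var 3 rfl, hF''.var 7 rfl, hF''.var 5 rfl, h0,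
        h2, h3, hii, hjj, hsucc]
      refine ⟨by omega, fun _ m hm1 hm2 => ?_⟩
      rw [Function.update_apply]
      split_ifs with he
      · subst he
        exact (hF j i hi (by omega)).symm
      · exact k1 m hm1 (by omega)
    · rintro t s'' - ⟨k1, -, ht⟩ -
      simp only [Finset.sum_const, Finset.card_range, smul_eq_mul] at ht
      exact ⟨by omega, fun m hm1 hm2 => k1 m hm1 (by rwa [Nat.succ_mul] at hm2)⟩
  · rintro t s' - ⟨⟨i1, -⟩, -, ht⟩
    simp only [Finset.sum_const, Finset.card_range, smul_eq_mul] at ht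
    refine ⟨?_, i1⟩
    have : (N + 1) * (100 * b + 100 + 40) = 100 * (b * N) + 140 * N + 100 * b + 140 := by ring
    have : 4 ≤ b * N := by nlinarith
    nlinarith

theorem eval_differ {e f : Expr} : (differ e f).eval s =
    (s.arr 5 (s.arr 17 (e.eval s)) - s.arr 5 (s.arr 17 (f.eval s))) +
      (s.arr 5 (s.arr 17 (f.eval s)) - s.arr 5 (s.arr 17 (e.eval s))) := rfl

theorem findPeriod_spec (hP : Params b N B tr) (hs : Static b N tr s)
    (h17 : ∀ m, 1 ≤ m → m < (N + 1) * b → s.arr 17 m = F m) :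
    WP B findPeriod s fun t s' => t ≤ 100 * N + 100 ∧ 1 ≤ s'.var 27 ∧ s'.var 27 ≤ N ∧
      (∀ i, 1 ≤ i → i < s'.var 27 → s.arr 5 (F 1) ≠ s.arr 5 (F (1 + i))) ∧
      (s'.var 27 < N → s.arr 5 (F 1) = s.arr 5 (F (1 + s'.var 27))) := by
  obtain ⟨g1, g2, g3, g4⟩ := hP.le_bound
  have h2N := hP.two_le_N
  have h2b := hP.two_le_b
  have hbig : 2 * N + 2 ≤ (N + 1) * b := by nlinarith
  refine WP.seq (WP.of_lf rfl ⟨by simp; omega, ?_⟩)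
  simp
  refine (WP.while (fun p s' => 1 ≤ s'.var 27 ∧ s'.var 27 ≤ N ∧
    (∀ i, 1 ≤ i → i < s'.var 27 → s.arr 5 (F 1) ≠ s.arr 5 (F (1 + i))) ∧
      p = 50 * (N - s'.var 27)) (50 * (N - 1)) rfl ⟨by simp, by simp; omega, ?_, by simp⟩ ?_).mono ?_
  · intro i h1 h2
    simp at h2
    omega
  · rintro p s' ⟨h1, h2, h3, rfl⟩ hF h0
    have h5 : s'.arr 5 = s.arr 5 := by rw [hF.arr 5 rfl]; simp
    have h17' : s'.arr 17 = s.arr 17 := by rw [hF.arr 17 rfl]; simp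
    have hn : s'.var 3 = N := by rw [hF.var 3 rfl]; simp [hs.num]
    simp [eval_differ, h5, h17', hn] at h0
    rw [h17 1 (by omega) (by omega), h17 (1 + s'.var 27) (by omega) (by omega)] at h0
    have hlt : s'.var 27 < N := by omega
    refine WP.of_lf rfl ⟨by simp; omega, fun _ => ⟨_, ⟨?_, ?_, ?_, rfl⟩, ?_⟩⟩
    · simp
    · simp; omega
    · intro i hi1 hi2
      simp only [eval_add, eval_var, eval_const, State.setVar_var, if_true] at hi2
      rcases Nat.lt_or_eq_of_le (Nat.le_of_lt_succ hi2) with k | rfl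
      · exact h3 i hi1 k
      · omega
    · simp [differ]; omega
  · rintro t s' hF ⟨p, ⟨h1, h2, h3, -⟩, h0, ht⟩
    have h5 : s'.arr 5 = s.arr 5 := by rw [hF.arr 5 rfl]; simp
    have h17' : s'.arr 17 = s.arr 17 := by rw [hF.arr 17 rfl]; simp
    have hn : s'.var 3 = N := by rw [hF.var 3 rfl]; simp [hs.num]
    simp [eval_differ, h5, h17', hn] at h0
    rw [h17 1 (by omega) (by omega), h17 (1 + s'.var 27) (by omega) (by omega)] at h0
    refine ⟨?_, h1, h2, h3, fun _ => by omega⟩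
    simp [differ] at ht
    omega

theorem checkPeriod_spec (hP : Params b N B tr) (hs : Static b N tr s)
    (h17 : ∀ m, 1 ≤ m → m < (N + 1) * b → s.arr 17 m = F m) {k : ℕ} (hk : s.var 27 = k)
    (hkN : k ≤ N) (h18 : s.var 18 ≤ 1) :
    WP B checkPeriod s fun t s' => t ≤ 500 * (b * N) ∧ s'.var 18 ≤ 1 ∧ (s'.var 18 = 1 ↔
      s.var 18 = 1 ∧ ∀ x, 1 ≤ x → x + k < k * b + b → s.arr 5 (F x) = s.arr 5 (F (x + k))) := by
  obtain ⟨g1, g2, g3, g4⟩ := hP.le_bound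
  have h2N := hP.two_le_N
  have h2b := hP.two_le_b
  have hbig : k * b + b ≤ (N + 1) * b := by nlinarith
  have hbig' : (N + 1) * b = b * N + b := by ring
  -- The iteration j compares at x = j + 1; the number of iterations is that of the x ≥ 1 with x + k
  -- < k * b + b.
  refine (WP.for (fun j s' => s'.var 18 ≤ 1 ∧ (s'.var 18 = 1 ↔ s.var 18 = 1 ∧
    ∀ x, 1 ≤ x → x < j + 1 → s.arr 5 (F x) = s.arr 5 (F (x + k)))) (k * b + b - (k + 1))
    (fun _ => 60) rfl rfl (by omega) ?_
    (fun j s' _ _ hF' _ => by simp [hF'.var 27 rfl, hF'.var 0 rfl, hs.base, hk]) ?_).mono ?_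
  · exact ⟨h18, (and_iff_left fun x h1 h2 => by omega).symm⟩
  · rintro j s' hj ⟨hI1, hI⟩ hF hjj
    have e1 : ((differ (const 1 + var 5) (const 1 + var 5 + var 27)).eval s' ≠ 0) ↔
        s.arr 5 (F (j + 1)) ≠ s.arr 5 (F (j + 1 + k)) := by
      rw [eval_differ]
      simp only [eval_add, eval_const, eval_var, hjj, hF.var 27 rfl, hk, hF.arr 5 rfl, hF.arr 17 rfl]
      rw [h17 (1 + j) (by omega) (by omega), h17 (1 + j + k) (by omega) (by omega),
        Nat.add_comm 1 j]
      omega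
    have e2 : (∀ x, 1 ≤ x → x < j + 1 + 1 → s.arr 5 (F x) = s.arr 5 (F (x + k))) ↔
        (∀ x, 1 ≤ x → x < j + 1 → s.arr 5 (F x) = s.arr 5 (F (x + k))) ∧
          s.arr 5 (F (j + 1)) = s.arr 5 (F (j + 1 + k)) := by
      constructor
      · exact fun h => ⟨fun x h1 h2 => h x h1 (by omega), h (j + 1) (by omega) (by omega)⟩
      · rintro ⟨h1, h2⟩ x hx hx'
        rcases Nat.lt_or_eq_of_le (Nat.le_of_lt_succ hx') with k | rfl
        · exact h1 x hx k
        · exact h2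
    refine WP.cond rfl (fun h0 => ?_) (fun h0 => ?_)
    · refine WP.of_lf rfl ⟨Nat.zero_le _, fun _ => ⟨by simp [differ], by simp, ?_⟩⟩
      rw [e2]
      simpa using fun _ _ => e1.1 h0
    · have h1 : s.arr 5 (F (j + 1)) = s.arr 5 (F (j + 1 + k)) := by
        by_contra hne
        exact e1.2 hne h0
      refine WP.of_lf rfl fun _ => ⟨by simp [differ], by simpa using hI1, ?_⟩
      rw [e2, and_iff_left h1]
      simpa using hI
  · rintro t s' - ⟨⟨hI1, hI⟩, -, ht⟩
    simp only [Finset.sum_const, Finset.card_range, smul_eq_mul] at ht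
    refine ⟨by omega, hI1, hI.trans (and_congr_right fun _ => forall₂_congr fun x hx => ?_)⟩
    rw [show x < k * b + b - (k + 1) + 1 ↔ x + k < k * b + b by
      have : k ≤ k * b := Nat.le_mul_of_pos_right _ (by omega)
      omega]

end RAM

/-! ### The whole decision procedure. -/

namespace RAM
open RAM.Expr RAM.Program

variable {b N B : ℕ} {tr : ℕ → ℕ} {s : State}

theorem decideProgram_spec (hP : Params b N B tr) (hb : s.var 0 = b) (hn : s.var 1 + 1 = N)
    {q : ℕ} (hq : s.var 2 = q) (hqN : q < N) (hv : s.var 14 = 0)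
    (htr : ∀ a < b, ∀ x < N, tr (a * N + x) = if x < s.var 1 then s.arr 0 (x * b + a) else s.var 1)
    (hz : ∀ k, 2 ≤ k → ∀ i, s.arr k i = 0) :
    WP B decideProgram s fun t s' => t ≤ 10000 * (b * N * (Nat.log 2 N + 1)) ∧ s'.var 0 ≤ 1 ∧
      (s'.var 0 = 1 ↔ ∃ S : Set ℕ, EventuallyPeriodic S ∧
        ∀ w, IsWord b w → (s.arr 1 (go N tr q w) ≠ 0 ↔ val b w ∈ S)) := by
  obtain ⟨g1, g2, g3, g4⟩ := hP.le_bound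
  have h2N := hP.two_le_N
  have h2b := hP.two_le_b
  have htlt : ∀ a < b, ∀ x < N, tr (a * N + x) < N := fun a ha x hx => hP.tr_lt' ha hx
  have hlog : Nat.log 2 N + 1 ≤ N := Nat.log_lt_self 2 (by omega)
  obtain ⟨T, hT⟩ : ∃ T, T = b * N * (Nat.log 2 N + 1) := ⟨_, rfl⟩
  -- The height of the closure stack is of order b N log N; this estimate makes it fit the word
  -- bound, which is of order b N N.
  have hTle : T ≤ b * N * N := hT ▸ Nat.mul_le_mul_left _ hlog
  have hleT : b * N ≤ T := hT ▸ Nat.le_mul_of_pos_right _ (by omega)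
  have hB := hP.bound
  obtain ⟨ac, hac⟩ : ∃ ac : ℕ → Prop, ac = (s.arr 1 · ≠ 0) := ⟨_, rfl⟩
  have hnl : ∀ {x y}, Nerode b N tr ac x y → (s.arr 1 x ≠ 0 ↔ s.arr 1 y ≠ 0) := fun {x y} h => by
    have := h [] isWord_nil
    rwa [hac] at this
  refine WP.seq ((setup_spec hP hb hn htr (hz 3 (by omega))).mono ?_)
  rintro t1 s1 hF1 ⟨ht1, hs1⟩
  have e1 : s1.arr 1 = s.arr 1 := hF1.arr 1 rfl
  refine WP.seq ((refine_spec hP hs1 (fun i => by rw [hF1.arr 5 rfl, hz 5 (by omega)])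
    (fun i => by rw [hF1.arr 8 rfl, hz 8 (by omega)])
    (fun i => by rw [hF1.arr 9 rfl, hz 9 (by omega)])
    (by rw [hF1.arr 10 rfl, hz 10 (by omega)])
    (fun i => by rw [hF1.arr 13 rfl, hz 13 (by omega)]) (by rw [hF1.var 14 rfl, hv])
    (E := Nerode b N tr ac) (fun x _ y _ h => by rw [e1]; exact hnl h)
    (fun x _ y _ h a ha => h.step ha)).mono ?_)
  rintro t2 s2 hF2 ⟨ht2, hop, hE, hcls⟩
  have hs2 := hs1.of_frame hF2
  have hner : ∀ x < N, ∀ y < N, s2.arr 5 x = s2.arr 5 y ↔ Nerode b N tr ac x y := by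
    refine fun x hx y hy => ⟨fun h => ?_, hE x hx y hy⟩
    refine nerode_of_rel (R := fun x y => s2.arr 5 x = s2.arr 5 y) htlt
      (fun x hx y hy h => ?_) hx hy h
    have := hcls x hx y hy h
    rw [e1] at this
    rw [hac]
    exact this
  -- Leading zeros must be tested with the Nerode classes, hence before the classes are coarsened.
  refine WP.seq ((checkStart_spec hP hs2 (q := q) (by rw [hF2.var 2 rfl, hF1.var 2 rfl, hq])
    hqN).mono ?_)
  rintro t3 s3 hF3 ⟨ht3, h18⟩
  have hs3 := hs2.of_frame hF3
  have c5 : s3.arr 5 = s2.arr 5 := hF3.arr 5 rfl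
  refine WP.seq ((coarsen_spec (U := Ultimate b N tr ac) hP hs3 succRel_ultimate (by omega)
    (hop.congr (hF3.arr 5 rfl) (hF3.arr 6 rfl) (hF3.arr 7 rfl) (hF3.arr 8 rfl) (hF3.arr 9 rfl)
      (hF3.arr 10 rfl) (hF3.var 12 rfl) (hF3.var 13 rfl))
    (fun i => by rw [hF3.arr 15 rfl, hF2.arr 15 rfl, hF1.arr 15 rfl, hz 15 (by omega)])
    (fun x hx y hy h => by rw [c5, hner x hx y hy] at h; exact h.ultimate)).mono ?_)
  rintro t4 s4 hF4 ⟨ht4, hmono, hclos, hsound⟩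
  have hs4 := hs3.of_frame hF4
  -- Soundness of the closure gives one direction. For the other, the computed relation contains the
  -- Nerode equivalence and is closed under equivalent successors, so it contains the least such
  -- relation.
  have hult : ∀ x < N, ∀ y < N, s4.arr 5 x = s4.arr 5 y ↔ Ultimate b N tr ac x y := by
    refine fun x hx y hy => ⟨hsound x hx y hy, fun h => ?_⟩
    refine h.imp (R := fun x y => s4.arr 5 x = s4.arr 5 y) htlt (fun x hx y hy h => ?_) hclos hx hy
    exact hmono x hx y hy (by rw [c5]; exact hE x hx y hy h)
  have hFlt : ∀ m, reach b N tr q m < N := reach_lt h2b htlt hqN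
  refine WP.seq ((reachAll_spec (F := reach b N tr q) hP hs4
    (by rw [hF4.var 2 rfl, hF3.var 2 rfl, hF2.var 2 rfl, hF1.var 2 rfl, hq, reach_zero])
    (fun m a ha h => reach_step h2b ha h) hFlt).mono ?_)
  rintro t5 s5 hF5 ⟨ht5, h17⟩
  have hs5 := hs4.of_frame hF5
  refine WP.seq ((findPeriod_spec hP hs5 h17).mono ?_)
  rintro t6 s6 hF6 ⟨ht6, hk1, hkN, hmin, hper⟩
  have hs6 := hs5.of_frame hF6
  have c6 : s6.arr 5 = s4.arr 5 := by rw [hF6.arr 5 rfl, hF5.arr 5 rfl]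
  have v18 : s6.var 18 = s3.var 18 := by rw [hF6.var 18 rfl, hF5.var 18 rfl, hF4.var 18 rfl]
  refine WP.seq ((checkPeriod_spec hP hs6 (F := reach b N tr q)
    (by rw [hF6.arr 17 rfl]; exact h17) rfl hkN (by rw [v18, h18]; split_ifs <;> omega)).mono ?_)
  rintro t7 s7 hF7 ⟨ht7, h18', hcheck⟩
  refine WP.of_lf rfl ⟨by simp; omega, ?_, by simpa using h18', ?_⟩
  · simp only [cost_var]
    rw [← hT] at ht2 ht4 ⊢
    omega
  · have hstart : s3.var 18 = 1 ↔ Nerode b N tr ac q (tr (0 * N + q)) := by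
      rw [← hner q hqN _ (htlt 0 (by omega) q hqN), h18]
      split_ifs with h
      · exact iff_of_true rfl h
      · exact iff_of_false id h
    rw [State.setVar_var, if_pos rfl, eval_var, hcheck, v18, hstart]
    have h1 := exists_byValue_iff (tr := tr) (N := N) (ac := ac) (q := q)
      (p := EventuallyPeriodic) h2b
    rw [eventuallyPeriodic_iff h2b htlt hqN, exists_period_iff h2b succRel_ultimate hFlt
      (fun m hm a ha => reach_step h2b ha (by have : 1 ≤ m * b := Nat.mul_pos hm (by omega)
                                              omega)) hk1
      (fun i hi hi' h => hmin i hi hi' (by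
        rw [hF5.arr 5 rfl]; exact (hult _ (hFlt _) _ (hFlt _)).2 h))
      (fun h => (hult _ (hFlt _) _ (hFlt _)).1 (by rw [← hF5.arr 5 rfl]; exact hper h)) hkN] at h1
    rw [hac] at h1
    refine Iff.trans (and_congr (by rw [hac]) ?_) h1.symm
    refine forall₃_congr fun x hx hxk => ?_
    rw [c6, hult _ (hFlt _) _ (hFlt _), hac]

end RAM

/-! ### From automata to machine inputs. -/

namespace DigitAutomaton

variable {b n : ℕ}

/-- The transition table of the completed automaton, with the additional state `n`. -/
def completed (A : DigitAutomaton b n) (e : ℕ) : ℕ :=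
  if e % (n + 1) < n then (RAM.input A).arr 0 (e % (n + 1) * b + e / (n + 1)) else n

variable (A : DigitAutomaton b n)

theorem input_arr_zero (q : Fin n) (a : Fin b) :
    (RAM.input A).arr 0 (q * b + a) = (A.step q a).elim n Fin.val := by
  have h : (q : ℕ) * b + a < n * b := by
    have := Nat.mul_le_mul_right b (show (q : ℕ) + 1 ≤ n from q.2)
    have := a.2
    rw [Nat.succ_mul] at *
    omega
  have h1 : Fin.divNat ⟨(q : ℕ) * b + a, h⟩ = q := by
    ext
    simp only [Fin.coe_divNat]
    rw [mul_comm, Nat.mul_add_div (by have := a.2; omega), Nat.div_eq_of_lt a.2, add_zero]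
  have h2 : Fin.modNat ⟨(q : ℕ) * b + a, h⟩ = a := by
    ext
    simp only [Fin.coe_modNat]
    rw [Nat.mul_add_mod', Nat.mod_eq_of_lt a.2]
  simp only [RAM.input, if_true, dif_pos h, h1, h2]

theorem completed_add (a x : ℕ) (hx : x < n + 1) : A.completed (a * (n + 1) + x) =
    if x < n then (RAM.input A).arr 0 (x * b + a) else n := by
  rw [completed, Nat.mul_add_mod', Nat.mod_eq_of_lt hx, mul_comm a, Nat.mul_add_div (by omega),
    Nat.div_eq_of_lt hx, add_zero]

theorem input_arr_zero_le (i : ℕ) : (RAM.input A).arr 0 i ≤ n := by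
  simp only [RAM.input, if_true]
  split_ifs
  · cases A.step _ _ with
    | none => simp
    | some q => exact q.2.le
  · omega

theorem completed_lt (e : ℕ) : A.completed e < n + 1 := by
  rw [completed]
  split_ifs
  · exact Nat.lt_succ_of_le (A.input_arr_zero_le _)
  · omega

theorem go_completed (u : List (Fin b)) (o : Option (Fin n)) :
    RAM.go (n + 1) A.completed (o.elim n Fin.val) (u.map Fin.val) =
      (o.bind fun q => A.run q u).elim n Fin.val := by
  induction u generalizing o with
  | nil => cases o <;> rfl
  | cons a u ih =>
    rw [List.map_cons, RAM.go_cons]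
    cases o with
    | none =>
      have h := A.completed_add a n (by omega)
      rw [if_neg (lt_irrefl n)] at h
      have := ih none
      simp only [Option.elim_none, Option.bind_none] at this ⊢
      rw [h, this]
    | some q =>
      have h := A.completed_add a q (by omega)
      rw [if_pos q.2, input_arr_zero] at h
      have := ih (A.step q a)
      simp only [Option.elim_some, Option.bind_some] at this ⊢
      rw [h, this]
      rfl

theorem accepts_iff (u : List (Fin b)) : A.Accepts u ↔
    (RAM.input A).arr 1 (RAM.go (n + 1) A.completed A.start (u.map Fin.val)) ≠ 0 := by
  have := A.go_completed u (some A.start)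
  simp only [Option.elim_some, Option.bind_some] at this
  rw [this, Accepts]
  cases A.run A.start u with
  -- A run that breaks off ends in the sink n, where the array of final states has its default value
  -- 0.
  | none => simp [RAM.input]
  | some q => simp [RAM.input]

theorem acceptsByValue_iff {S : Set ℕ} : A.AcceptsByValue S ↔ ∀ w, RAM.IsWord b w →
    ((RAM.input A).arr 1 (RAM.go (n + 1) A.completed A.start w) ≠ 0 ↔ RAM.val b w ∈ S) := by
  constructor
  · intro h w hw
    lift w to List (Fin b) using hw
    rw [← accepts_iff]
    exact h w
  · intro h u
    rw [accepts_iff]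
    refine h (u.map Fin.val) fun a ha => ?_
    obtain ⟨d, -, rfl⟩ := List.mem_map.1 ha
    exact d.2

theorem params_completed (hb : 1 < b) (hn : 0 < n) :
    RAM.Params b (n + 1) ((b * n) ^ 14) A.completed where
  two_le_b := hb
  two_le_N := by omega
  tr_lt e _ := A.completed_lt e
  bound := by
    -- As b * n ≥ 2, twelve factors absorb the constant 1000 * 4, where 4 comes from (n + 1) ^ 2 ≤ 4
    -- * n ^ 2; two more factors bound b * n ^ 2.
    have h1 : (2 : ℕ) ^ 12 ≤ (b * n) ^ 12 := Nat.pow_le_pow_left (by nlinarith) 12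
    have h2 : b * (n + 1) * (n + 1) ≤ b * (n * n) * 4 := by
      have : (n + 1) * (n + 1) ≤ n * n * 4 := by nlinarith
      calc _ = b * ((n + 1) * (n + 1)) := by ring
        _ ≤ b * (n * n * 4) := Nat.mul_le_mul_left _ this
        _ = _ := by ring
    have h3 : b * (n * n) ≤ (b * n) ^ 2 := by
      calc _ ≤ b * (b * (n * n)) := Nat.le_mul_of_pos_left _ (by omega)
        _ = _ := by ring
    calc 1000 * (b * (n + 1) * (n + 1)) ≤ 2 ^ 12 * (b * n) ^ 2 := by omega
      _ ≤ (b * n) ^ 12 * (b * n) ^ 2 := Nat.mul_le_mul_right _ h1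
      _ = _ := by ring

theorem bdd_input (hb : 1 < b) (hn : 0 < n) : RAM.Bdd ((b * n) ^ 14) (RAM.input A) := by
  have h1 : b * n ≤ (b * n) ^ 14 := Nat.le_self_pow (by norm_num) _
  have h2 : b ≤ b * n := Nat.le_mul_of_pos_right _ hn
  have h3 : n ≤ b * n := Nat.le_mul_of_pos_left _ (by omega)
  refine ⟨by omega, fun x => ?_, fun k i => ?_⟩
  · have := A.start.2
    simp only [RAM.input]
    split_ifs <;> omega
  · by_cases hk : k = 0
    · subst hk
      exact (A.input_arr_zero_le i).trans (h3.trans h1)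
    · simp only [RAM.input, hk, if_false]
      split_ifs <;> omega

end DigitAutomaton

theorem theorem1 :
    ∃ (P : RAM.Program) (c C : ℕ), ∀ (b n : ℕ) (_ : 1 < b) (A : DigitAutomaton b n),
      ∃ (t : ℕ) (s : RAM.State),
        RAM.Exec ((b * n) ^ c) P (RAM.input A) t s ∧
        t ≤ C * (b * n * (Nat.log 2 n + 1)) ∧
        (s.var 0 = 1 ↔ ∃ S : Set ℕ, EventuallyPeriodic S ∧ A.AcceptsByValue S) ∧
        (s.var 0 = 0 ↔ ¬ ∃ S : Set ℕ, EventuallyPeriodic S ∧ A.AcceptsByValue S) := by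
  -- Stored words are at most (b * n) ^ 14 and evaluation needs the power 30 of that. The time
  -- constant is 10000 * 2 * 2, as n + 1 ≤ 2 * n and log (n + 1) + 1 ≤ 2 * (log n + 1).
  refine ⟨RAM.decideProgram, 14 * 30, 40000, fun b n hb A => ?_⟩
  have hn : 0 < n := A.start.pos
  obtain ⟨t, s, hE, -, ht, h1, h2⟩ := RAM.decideProgram_spec (s := RAM.input A) (q := A.start)
    (A.params_completed hb hn) rfl rfl rfl (Nat.lt_succ_of_lt A.start.2) rfl
    (fun a _ x hx => A.completed_add a x hx)
    (fun k hk i => by simp [RAM.input, show k ≠ 0 by omega, show k ≠ 1 by omega])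
    (A.bdd_input hb hn)
  refine ⟨t, s, by rwa [pow_mul], ?_, ?_⟩
  · have h3 : Nat.log 2 (n + 1) ≤ Nat.log 2 n + 1 := by
      rw [← Nat.log_mul_base (by norm_num) hn.ne']
      exact Nat.log_mono_right (by omega)
    calc t ≤ 10000 * (b * (n + 1) * (Nat.log 2 (n + 1) + 1)) := ht
      _ ≤ 10000 * (b * (2 * n) * (2 * (Nat.log 2 n + 1))) := by gcongr <;> omega
      _ = _ := by ring
  · simp only [← A.acceptsByValue_iff] at h2
    refine ⟨h2, ?_⟩
    rw [← h2]
    omega
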